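/- **Setting.** Write $H=\{z\in\mathbb C:\operatorname{Im} z>0\}$, and for $\Omega\subseteq\mathbb C$ let $\pi(\Omega)$ be the set of non-zero polynomials in $\mathbb C[z]$ all of whose zeros lie in $\Omega$. For $n\in\mathbb N=\{0,1,2,\dots\}$ let $\mathbb C_n[z]$ (resp. $\mathbb R_n[z]$) be the complex (resp. real) polynomials of degree at most $n$. A non-zero real polynomial is *hyperbolic* if all its zeros are real. Two hyperbolic polynomials with zeros $\alpha_1\le\alpha_2\le\cdots$ and $\beta_1\le\beta_2\le\cdots$ (with multiplicity) have *interlacing zeros* if $\alpha_1\le\beta_1\le\alpha_2\le\beta_2\le\cdots$ or $\beta_1\le\alpha_1\le\beta_2\le\alpha_2\le\cdots$ (so their degrees differ by at most one). A polynomial $F\in\mathbb C[z,w]$ is *$\Omega$-stable* if $F(z,w)\ne0$ for all $z,w\in\Omega$. A linear operator $T$ on $\mathbb C[z]$ is extended to $\mathbb C[z,w]$ by $T(z^kw^\ell)=T(z^k)w^\ell$. Let $\Phi(z)=\frac{az+b}{cz+d}$ with $a,b,c,d\in\mathbb C$, $ad-bc\neq0$, be a Möbius transformation such that $C=\Phi^{-1}(H)=\{z\in\mathbb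 C: cz+d\ne0,\ \Phi(z)\in H\}$ is unbounded (so $C$ is an open half-plane or the complement of a closed disk); if $C$ is a half-plane, assume moreover that $c=0$. Let $\partial C$ be the boundary of $C$ in $\mathbb C$ (a line or a circle) and let $C^r$ be the interior of $\mathbb C\setminus C$. For $n\in\mathbb N$ let $\phi_n:\mathbb C_n[z]\to\mathbb C_n[z]$ be the invertible linear map $\phi_n(f)(z)=(cz+d)^nf(\Phi(z))$. **Statement.** Let $T:\mathbb C[z]\to\mathbb C[z]$ be a linear operator. Then $T(\pi(\partial C))\subseteq\pi(\partial C)\cup\{0\}$ if and only if at least one of the following holds: (a) $T$ has range of dimension at most one and is of the form $T(f)=\alpha(f)P$ for $f\in\mathbb C[z]$, where $\alpha:\mathbb C[z]\to\mathbb C$ is a linear functional and $P\in\pi(\partial C)$; (b) $T$ has range of dimension two and for every $n\in\mathbb N$, with $m(n)=\max\{\deg T(f):f\in\mathbb C_n[z]\}$ (where the zero polynomial is given degree $0$), the operator $S_n=\phi_{m(n)}^{-1}T\phi_n:\mathbb C_n[z]\to\mathbb C_{m(n)}[z]$ has range of dimension at most two and is of the form $S_n(f)=\eta\,\alpha(f)P+\eta\,\beta(f)Q$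 for $f\in\mathbb C_n[z]$, where $\eta\in\mathbb C$, $\alpha,\beta:\mathbb C_n[z]\to\mathbb C$ are linear functionals with $\alpha(\mathbb R_n[z])\subseteq\mathbb R$ and $\beta(\mathbb R_n[z])\subseteq\mathbb R$, and $P,Q$ are hyperbolic polynomials with interlacing zeros (all of these may depend on $n$); (c) for every $n\in\mathbb N$ the polynomial $T\big[\big((az+b)(cw+d)+(aw+b)(cz+d)\big)^n\big]$ is either identically zero or both $C$-stable and $C^r$-stable; (d) for every $n\in\mathbb N$ the polynomial $T\big[\big((az+b)(cw+d)-(aw+b)(cz+d)\big)^n\big]$ is either identically zero or both $C$-stable and $C^r$-stable. -/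

import Mathlib

open Polynomial

noncomputable section

namespace PolyaSchur

/-- `π(Ω)`: the (non-zero) complex polynomials all of whose zeros lie in `Ω`. -/
def zerosIn (Ω : Set ℂ) : Set ℂ[X] :=
  {f | f ≠ 0 ∧ ∀ z : ℂ, f.IsRoot z → z ∈ Ω}

/-- `Φ⁻¹(H)` as a subset of `ℂ`, where `Φ(z) = (a z + b) / (c z + d)` and `H` is the open
upper half-plane: the finite points `z` for which `Φ(z)` is finite and lies in `H`. -/
def mobiusDomain (a b c d : ℂ) : Set ℂ :=
  {z | c * z + d ≠ 0 ∧ 0 < ((a * z + b) / (c * z + d)).im}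

/-- Open affine half-planes of `ℂ`. -/
def IsOpenHalfPlane (S : Set ℂ) : Prop :=
  ∃ (u : ℂ) (r : ℝ), u ≠ 0 ∧ S = {z | r < (u * z).im}

/-- A bivariate polynomial `F(z, w)`, seen as a polynomial in `w` (outer variable) over `ℂ[z]`
(inner variable), is `Ω`-stable if it does not vanish on `Ω × Ω`. -/
def IsStableOn (Ω : Set ℂ) (F : ℂ[X][X]) : Prop :=
  ∀ z ∈ Ω, ∀ w ∈ Ω, F.evalEval z w ≠ 0

/-- The extension of a linear operator `T` on `ℂ[z]` to `ℂ[z, w] = ℂ[z][w]`, with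
`T(z ^ k * w ^ l) = T(z ^ k) * w ^ l`. -/
def extend (T : ℂ[X] →ₗ[ℂ] ℂ[X]) (F : ℂ[X][X]) : ℂ[X][X] :=
  F.sum fun l q => monomial l (T q)

theorem coeff_extend (T : ℂ[X] →ₗ[ℂ] ℂ[X]) (F : ℂ[X][X]) (l : ℕ) :
    (extend T F).coeff l = T (F.coeff l) := by
  unfold extend
  rw [Polynomial.sum_def, finsetSum_coeff]
  simp only [coeff_monomial]
  rw [Finset.sum_ite_eq']
  split_ifs with h
  · rfl
  · rw [notMem_support_iff.mp h, map_zero]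

/-- The constant `s` in `ℂ[z][w]`. -/
abbrev cst (s : ℂ) : ℂ[X][X] := C (C s)

/-- The variable `z` of `ℂ[z][w]`. -/
abbrev varZ : ℂ[X][X] := C X

/-- The variable `w` of `ℂ[z][w]`. -/
abbrev varW : ℂ[X][X] := X

/-- `(a z + b)(c w + d) + (a w + b)(c z + d)` -/
def plusKernel (a b c d : ℂ) : ℂ[X][X] :=
  (cst a * varZ + cst b) * (cst c * varW + cst d) +
    (cst a * varW + cst b) * (cst c * varZ + cst d)

/-- `(a z + b)(c w + d) - (a w + b)(c z + d)` -/
def minusKernel (a b c d : ℂ) : ℂ[X][X] :=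
  (cst a * varZ + cst b) * (cst c * varW + cst d) -
    (cst a * varW + cst b) * (cst c * varZ + cst d)

/-- `ℂ_n[z]`: the complex polynomials of degree at most `n`. -/
abbrev polyLE (n : ℕ) : Submodule ℂ ℂ[X] := degreeLE ℂ (n : WithBot ℕ)

/-- The homogenized substitution
`∑ k ≤ n, f_k (a z + b) ^ k (c z + d) ^ (n - k)` as an endomorphism of `ℂ_n[z]`. -/
def phiLin (a b c d : ℂ) (n : ℕ) : polyLE n →ₗ[ℂ] polyLE n where
  toFun f := ⟨∑ k ∈ Finset.range (n + 1),
      C ((f : ℂ[X]).coeff k) * ((C a * X + C b) ^ k * (C c * X + C d) ^ (n - k)), by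
    refine Submodule.sum_mem _ fun k hk => ?_
    rw [mem_degreeLE]
    have hk' : k ≤ n := Nat.lt_succ_iff.mp (Finset.mem_range.mp hk)
    refine natDegree_le_iff_degree_le.mp ?_
    refine (natDegree_C_mul_le _ _).trans (natDegree_mul_le.trans ?_)
    have h1 := natDegree_pow_le_of_le k (natDegree_linear_le (a := a) (b := b))
    have h2 := natDegree_pow_le_of_le (n - k) (natDegree_linear_le (a := c) (b := d))
    omega⟩
  map_add' f g := by
    ext1
    simp [add_mul, Finset.sum_add_distrib]
  map_smul' s f := by
    ext1
    simp [Finset.smul_sum, smul_eq_C_mul, mul_assoc]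

/-- `phiLin` is the map `f ↦ (c z + d) ^ n f(Φ(z))`. -/
theorem eval_phiLin (a b c d : ℂ) (n : ℕ) (f : polyLE n) (z : ℂ) (hz : c * z + d ≠ 0) :
    (phiLin a b c d n f : ℂ[X]).eval z =
      (c * z + d) ^ n * (f : ℂ[X]).eval ((a * z + b) / (c * z + d)) := by
  have hf : (f : ℂ[X]).natDegree < n + 1 :=
    Nat.lt_succ_iff.mpr (natDegree_le_iff_degree_le.mpr (mem_degreeLE.mp f.2))
  rw [eval_eq_sum_range' hf, Finset.mul_sum]
  simp only [phiLin, LinearMap.coe_mk, AddHom.coe_mk, eval_finsetSum]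
  refine Finset.sum_congr rfl fun k hk => ?_
  have hk' : k ≤ n := Nat.lt_succ_iff.mp (Finset.mem_range.mp hk)
  simp only [eval_mul, eval_pow, eval_add, eval_C, eval_X]
  rw [div_pow]
  have : (c * z + d) ^ n = (c * z + d) ^ k * (c * z + d) ^ (n - k) := by
    rw [← pow_add, Nat.add_sub_cancel' hk']
  rw [this]
  have hp : (c * z + d) ^ k ≠ 0 := pow_ne_zero _ hz
  generalize (c * z + d) ^ k = u at hp ⊢
  field_simp

theorem phiLin_injective {a b c d : ℂ} (h : a * d - b * c ≠ 0) (n : ℕ) :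
    Function.Injective (phiLin a b c d n) := by
  rw [injective_iff_map_eq_zero]
  intro f hf
  ext1
  have hfin : ({z : ℂ | c * z + d = 0} ∪ {z : ℂ | -c * z + a = 0}).Finite := by
    refine Set.Finite.union ?_ ?_
    · have hne : (C c * X + C d : ℂ[X]) ≠ 0 := by
        intro h0
        have hc := congrArg (fun p => coeff p 1) h0
        have hd := congrArg (fun p => coeff p 0) h0
        simp at hc hd
        simp [hc, hd] at h
      refine (finite_setOfPred_isRoot hne).subset fun z hz => ?_
      simpa [IsRoot] using hz
    · have hne : (C (-c) * X + C a : ℂ[X]) ≠ 0 := by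
        intro h0
        have hc := congrArg (fun p => coeff p 1) h0
        have hd := congrArg (fun p => coeff p 0) h0
        simp at hc hd
        simp [hc, hd] at h
      refine (finite_setOfPred_isRoot hne).subset fun z hz => ?_
      simpa [IsRoot] using hz
  refine eq_zero_of_infinite_isRoot _ (hfin.infinite_compl.mono fun ζ hζ => ?_)
  simp only [Set.mem_compl_iff, Set.mem_union, Set.mem_ofPred_eq, not_or] at hζ
  obtain ⟨-, h2⟩ := hζ
  have key : c * ((d * ζ - b) / (-c * ζ + a)) + d = (a * d - b * c) / (-c * ζ + a) := by
    rw [mul_div_assoc', div_add' _ _ _ h2]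
    congr 1
    ring
  have hz : c * ((d * ζ - b) / (-c * ζ + a)) + d ≠ 0 := by
    rw [key]
    exact div_ne_zero h h2
  have hev := eval_phiLin a b c d n f _ hz
  rw [hf] at hev
  have h3 : (a * ((d * ζ - b) / (-c * ζ + a)) + b) /
      (c * ((d * ζ - b) / (-c * ζ + a)) + d) = ζ := by
    rw [div_eq_iff hz, key, mul_div_assoc', mul_div_assoc', div_add' _ _ _ h2]
    congr 1
    ring
  rw [h3] at hev
  simp only [ZeroMemClass.coe_zero, eval_zero] at hev
  exact (mul_eq_zero.mp hev.symm).resolve_left (pow_ne_zero _ hz)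

instance (n : ℕ) : FiniteDimensional ℂ (polyLE n) := by
  have : polyLE n = degreeLT ℂ (n + 1) := by
    ext f
    rw [mem_degreeLE, mem_degreeLT, ← natDegree_le_iff_degree_le]
    rcases eq_or_ne f 0 with rfl | hf
    · simp only [natDegree_zero, zero_le, degree_zero, true_iff]
      exact WithBot.bot_lt_coe _
    · rw [← natDegree_lt_iff_degree_lt hf]
      omega
  rw [this]
  exact Module.Finite.equiv (degreeLTEquiv ℂ (n + 1)).symm

/-- The invertible linear map `φ_n : ℂ_n[z] → ℂ_n[z]`, `φ_n(f)(z) = (c z + d) ^ n f(Φ(z))`. -/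
def phi {a b c d : ℂ} (h : a * d - b * c ≠ 0) (n : ℕ) : polyLE n ≃ₗ[ℂ] polyLE n :=
  LinearEquiv.ofInjectiveEndo (phiLin a b c d n) (phiLin_injective h n)

/-- `m(n) = max {deg T(f) : f ∈ ℂ_n[z]}`. -/
def maxDeg (T : ℂ[X] →ₗ[ℂ] ℂ[X]) (n : ℕ) : ℕ :=
  sSup ((fun f => (T f).natDegree) '' (polyLE n : Set ℂ[X]))

/-- The maximum defining `maxDeg` is attained. -/
theorem isGreatest_maxDeg (T : ℂ[X] →ₗ[ℂ] ℂ[X]) (n : ℕ) :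
    IsGreatest ((fun f => (T f).natDegree) '' (polyLE n : Set ℂ[X])) (maxDeg T n) := by
  have hne : ((fun f => (T f).natDegree) '' (polyLE n : Set ℂ[X])).Nonempty :=
    ⟨_, 0, (polyLE n).zero_mem, rfl⟩
  have hbdd : BddAbove ((fun f => (T f).natDegree) '' (polyLE n : Set ℂ[X])) := by
    refine ⟨(Finset.range (n + 1)).sup fun k => (T (X ^ k)).natDegree, ?_⟩
    rintro _ ⟨f, hf, rfl⟩
    have hf' : f.natDegree < n + 1 :=
      Nat.lt_succ_iff.mpr (natDegree_le_iff_degree_le.mpr (mem_degreeLE.mp hf))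
    simp only
    rw [as_sum_range' f (n + 1) hf', map_sum]
    refine natDegree_sum_le_of_forall_le _ _ fun k hk => ?_
    rw [← smul_X_eq_monomial, map_smul]
    exact (natDegree_smul_le _ _).trans
      (Finset.le_sup (f := fun k => (T (X ^ k)).natDegree) hk)
  exact ⟨Nat.sSup_mem hne hbdd, fun x hx => le_csSup hbdd hx⟩

/-- `T` as a linear map `ℂ_n[z] → ℂ_{m(n)}[z]`. -/
def restrictT (T : ℂ[X] →ₗ[ℂ] ℂ[X]) (n : ℕ) : polyLE n →ₗ[ℂ] polyLE (maxDeg T n) :=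
  (T.comp (polyLE n).subtype).codRestrict (polyLE (maxDeg T n)) fun f =>
    mem_degreeLE.mpr (natDegree_le_iff_degree_le.mp
      ((isGreatest_maxDeg T n).2 ⟨f, f.2, rfl⟩))

/-- `S_n = φ_{m(n)}⁻¹ ∘ T ∘ φ_n`. -/
def conjugate {a b c d : ℂ} (h : a * d - b * c ≠ 0) (T : ℂ[X] →ₗ[ℂ] ℂ[X]) (n : ℕ) :
    polyLE n →ₗ[ℂ] polyLE (maxDeg T n) :=
  ((phi h (maxDeg T n)).symm.toLinearMap.comp (restrictT T n)).comp (phi h n).toLinearMap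

/-- A non-zero real polynomial is hyperbolic if all its complex zeros are real. -/
def IsHyperbolic (P : ℝ[X]) : Prop :=
  P ≠ 0 ∧ ∀ z : ℂ, aeval z P = 0 → z.im = 0

/-- `α₁ ≤ β₁ ≤ α₂ ≤ β₂ ≤ ⋯`, both lists being used up. -/
def InterlaceFrom (α β : List ℝ) : Prop :=
  β.length ≤ α.length ∧ α.length ≤ β.length + 1 ∧
    (∀ (i : ℕ) (hα : i < α.length) (hβ : i < β.length), α[i] ≤ β[i]) ∧
    (∀ (i : ℕ) (hβ : i < β.length) (hα : i + 1 < α.length), β[i] ≤ α[i + 1])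

/-- The zeros (with multiplicity, in increasing order) of `P` and `Q` interlace. -/
def Interlacing (P Q : ℝ[X]) : Prop :=
  InterlaceFrom (P.roots.sort (· ≤ ·)) (Q.roots.sort (· ≤ ·)) ∨
    InterlaceFrom (Q.roots.sort (· ≤ ·)) (P.roots.sort (· ≤ ·))

/-- A linear functional on `ℂ_n[z]` that takes real values on `ℝ_n[z]`. -/
def IsRealFunctional {n : ℕ} (α : polyLE n →ₗ[ℂ] ℂ) : Prop :=
  ∀ f : polyLE n, (∀ k, ((f : ℂ[X]).coeff k).im = 0) → (α f).im = 0

/-- `S` has range of dimension at most two and is of the form `S(f) = η α(f) P + η β(f) Q` with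
`η ∈ ℂ`, linear functionals `α, β` that are real on real polynomials, and hyperbolic `P, Q`
whose zeros interlace. -/
def IsRankTwoPreserver {n m : ℕ} (S : polyLE n →ₗ[ℂ] polyLE m) : Prop :=
  Module.finrank ℂ (LinearMap.range S) ≤ 2 ∧
    ∃ (η : ℂ) (α β : polyLE n →ₗ[ℂ] ℂ) (P Q : ℝ[X]),
      IsRealFunctional α ∧ IsRealFunctional β ∧ IsHyperbolic P ∧ IsHyperbolic Q ∧
      Interlacing P Q ∧
      ∀ f : polyLE n, (S f : ℂ[X]) =
        (η * α f) • P.map (algebraMap ℝ ℂ) + (η * β f) • Q.map (algebraMap ℝ ℂ)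

end PolyaSchur

end

namespace PolyaSchur
open Filter Topology

/-! An affine substitution turns the boundary of C into the real line when c = 0. When c ≠ 0, C is
unbounded and not a half-plane, and its boundary becomes the unit circle, with C the exterior of the
disk. Everything is read off the symbol T((X + w)^n): at each fixed z it is a polynomial in w, and
consecutive degrees are linked by differentiation in w (`derivative_symbolPoly`). The second general
tool is that π(S) is Zariski dense for infinite S: an expression that is polynomial on lines and
vanishes on the members of π(S) of degree n vanishes in all degrees up to n (`PolyOnLines.eq_zero`).

Line, sufficiency. Conditions (c) and (d) say that the symbol has no zero with Im z Im w > 0,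
respectively < 0. The Grace–Walsh–Szegő theorem passes from (X + w)^n to products of distinct
factors X + x with all x in one open half-plane, and Hurwitz's theorem lets the points x become
real. For (b), the arguments of P(z) and Q(z) in the upper half-plane are sums of angles, one per
zero; interlacing makes the difference an alternating sum, of modulus less than π, so a real
combination vanishes off the real line only if it is identically zero.

Line, necessity. In rank at least two, T is a scalar multiple of a real operator
(`exists_smul_real`). For fixed n there is a dichotomy. If the symbol E satisfies |E(z, w)| = |E(z,
conj w)| for some z, w in H, then T annihilates some Re(κ(X + w)^n). All zeros of this polynomial
are real and stay so under small real perturbations of degree at most n, so T sends every real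
polynomial of degree at most n to a real-rooted one or to zero. Otherwise the sign of |E(z, w)| -
|E(z, conj w)| is constant on H × H, which gives one of the two stability conditions. If the first
alternative holds for all n, evaluation at i embeds T(ℝ[z]) in ℂ = ℝ², and (b) follows from the
converse half of the argument criterion (Obreschkoff). Otherwise stability holds for all large n,
and Gauss–Lucas brings it down to small n.

Circle. On polynomials with zeros on the unit circle the conjugate reversal acts as a scalar, so T
commutes with it up to a scalar at each degree level; comparing levels n and n + 1 gives T(X g) = d
X^k T(g). Hence the preservers of rank at least two have the form f ↦ P f(d z^k) with |d| = 1 and k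
≥ 1, and these satisfy (c). Conversely, (d) forces rank at most one
(`preserves_unitCircle_of_same_side`), while (c) forces T to be zero or, in the affine coordinate,
of the form f ↦ P · (f ∘ u) with u⁻¹ of the circle contained in the circle unless u is constant
(`preserves_unitCircle_of_opposite_side`). Condition (b) is transported to the real line by φ_n. -/

/-- `T` maps `π(S)` into `π(S) ∪ {0}`. -/
def Preserves (S : Set ℂ) (T : ℂ[X] →ₗ[ℂ] ℂ[X]) : Prop :=
  ∀ f ∈ zerosIn S, T f ∈ zerosIn S ∪ {0}

/-! ### Elementary closure properties of π(S) -/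

theorem C_mul_mem_zerosIn {S : Set ℂ} {f : ℂ[X]} (hf : f ∈ zerosIn S) {s : ℂ} (hs : s ≠ 0) :
    C s * f ∈ zerosIn S := by
  refine ⟨mul_ne_zero (C_ne_zero.mpr hs) hf.1, fun z hz => hf.2 z ?_⟩
  simpa [IsRoot, hs] using hz

theorem C_mem_zerosIn (S : Set ℂ) {s : ℂ} (hs : s ≠ 0) : C s ∈ zerosIn S :=
  ⟨C_ne_zero.mpr hs, fun z hz => by simp [IsRoot, hs] at hz⟩

theorem mul_mem_zerosIn {S : Set ℂ} {f g : ℂ[X]} (hf : f ∈ zerosIn S) (hg : g ∈ zerosIn S) :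
    f * g ∈ zerosIn S := by
  refine ⟨mul_ne_zero hf.1 hg.1, fun z hz => ?_⟩
  rcases (root_mul.mp hz) with h | h
  exacts [hf.2 z h, hg.2 z h]

theorem X_sub_C_mem_zerosIn {S : Set ℂ} {s : ℂ} (hs : s ∈ S) : X - C s ∈ zerosIn S := by
  refine ⟨X_sub_C_ne_zero s, fun z hz => ?_⟩
  have : z = s := by simpa [IsRoot, sub_eq_zero] using hz
  rwa [this]

theorem smul_mem_zerosIn_union_zero {S : Set ℂ} {f : ℂ[X]} (hf : f ∈ zerosIn S) (s : ℂ) :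
    s • f ∈ zerosIn S ∪ {0} := by
  rcases eq_or_ne s 0 with rfl | hs
  · right; simp
  · left; rw [smul_eq_C_mul]; exact C_mul_mem_zerosIn hf hs

/-! ### Limits of zero-free polynomials -/

theorem norm_multiset_prod_sub_le {z₀ z : ℂ} {ρ : ℝ} (hz : ‖z - z₀‖ ≤ ρ) (s : Multiset ℂ)
    (hs : ∀ r ∈ s, ρ ≤ ‖z₀ - r‖) :
    ‖(s.map (z - ·)).prod‖ ≤ 2 ^ s.card * ‖(s.map (z₀ - ·)).prod‖ := by
  induction s using Multiset.induction_on with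
  | empty => simp
  | cons r s ih =>
    have h1 := ih fun r' hr' => hs r' (Multiset.mem_cons_of_mem hr')
    have h2 : ‖z - r‖ ≤ 2 * ‖z₀ - r‖ := by
      have h3 := hs r (Multiset.mem_cons_self r s)
      have h4 : ‖z - r‖ ≤ ‖z - z₀‖ + ‖z₀ - r‖ := norm_sub_le_norm_sub_add_norm_sub z z₀ r
      linarith
    simp only [Multiset.map_cons, Multiset.prod_cons, Multiset.card_cons, norm_mul]
    calc _ ≤ (2 * ‖z₀ - r‖) * (2 ^ s.card * ‖(s.map (z₀ - ·)).prod‖) := by gcongr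
      _ = _ := by ring

/-- Every root is at distance at least ρ from z₀, so each factor grows by at most 2 between z₀ and
z. Depending only on the degree, the estimate survives pointwise limits: a limit that vanishes at z₀
vanishes on the whole ball. -/
theorem norm_eval_le_of_forall_ne_zero {p : ℂ[X]} {z₀ z : ℂ} {ρ : ℝ}
    (hp : ∀ y ∈ Metric.ball z₀ ρ, p.eval y ≠ 0) (hz : ‖z - z₀‖ ≤ ρ) :
    ‖p.eval z‖ ≤ 2 ^ p.natDegree * ‖p.eval z₀‖ := by
  have hsp := IsAlgClosed.splits p
  rw [hsp.eval_eq_prod_roots, hsp.eval_eq_prod_roots, hsp.natDegree_eq_card_roots, norm_mul,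
    norm_mul]
  have h := norm_multiset_prod_sub_le hz p.roots fun r hr => by
    by_contra h
    refine hp r ?_ (isRoot_of_mem_roots hr)
    rw [Metric.mem_ball, dist_comm, dist_eq_norm]
    exact not_le.mp h
  calc _ ≤ ‖p.leadingCoeff‖ * (2 ^ p.roots.card * ‖(p.roots.map (z₀ - ·)).prod‖) := by gcongr
    _ = _ := by ring

/-- Hurwitz' theorem for polynomials of bounded degree. -/
theorem eq_zero_or_eval_ne_zero_of_tendsto {ι : Type*} {l : Filter ι} [l.NeBot] {p : ι → ℂ[X]}
    {P : ℂ[X]} {N : ℕ} (hN : ∀ᶠ i in l, (p i).natDegree ≤ N)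
    (hlim : ∀ z, Tendsto (fun i => (p i).eval z) l (𝓝 (P.eval z))) {U : Set ℂ} (hU : IsOpen U)
    (h : ∀ᶠ i in l, ∀ z ∈ U, (p i).eval z ≠ 0) : P = 0 ∨ ∀ z ∈ U, P.eval z ≠ 0 := by
  by_contra! hc
  obtain ⟨hP, z₀, hz₀, h0⟩ := hc
  obtain ⟨ρ, hρ, hball⟩ := Metric.isOpen_iff.mp hU z₀ hz₀
  refine hP (eq_zero_of_infinite_isRoot _ ((Set.Infinite.mono (s := Metric.ball z₀ ρ) ?_ ?_)))
  · intro z hz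
    have h1 : ‖P.eval z‖ ≤ 2 ^ N * ‖P.eval z₀‖ := by
      refine le_of_tendsto_of_tendsto (hlim z).norm ((hlim z₀).norm.const_mul _) ?_
      filter_upwards [hN, h] with i hi1 hi2
      have hz' : ‖z - z₀‖ ≤ ρ := by
        rw [← dist_eq_norm]; exact (Metric.mem_ball.mp hz).le
      refine (norm_eval_le_of_forall_ne_zero (fun y hy => hi2 y (hball hy)) hz').trans ?_
      gcongr
      norm_num
    rw [h0, norm_zero, mul_zero] at h1
    exact norm_le_zero_iff.mp h1
  · exact infinite_of_mem_nhds z₀ (Metric.ball_mem_nhds z₀ hρ)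

/-! ### Identities that hold on `π(S)` -/

/-- A function on polynomials whose restriction to each affine line is polynomial. -/
def PolyOnLines (G : ℂ[X] → ℂ) : Prop :=
  ∀ f g, ∃ p : ℂ[X], ∀ t : ℂ, G (f + t • g) = p.eval t

theorem PolyOnLines.of_linear (L : ℂ[X] →ₗ[ℂ] ℂ) : PolyOnLines L := fun f g =>
  ⟨C (L f) + X * C (L g), fun t => by simp [mul_comm t]⟩

theorem PolyOnLines.mul {G H : ℂ[X] → ℂ} (hG : PolyOnLines G) (hH : PolyOnLines H) :
    PolyOnLines fun f => G f * H f := fun f g => by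
  obtain ⟨p, hp⟩ := hG f g
  obtain ⟨q, hq⟩ := hH f g
  exact ⟨p * q, fun t => by simp [hp, hq]⟩

theorem PolyOnLines.sub {G H : ℂ[X] → ℂ} (hG : PolyOnLines G) (hH : PolyOnLines H) :
    PolyOnLines fun f => G f - H f := fun f g => by
  obtain ⟨p, hp⟩ := hG f g
  obtain ⟨q, hq⟩ := hH f g
  exact ⟨p - q, fun t => by simp [hp, hq]⟩

/-- The prescribed roots are freed one at a time: with all other factors fixed, the value of G is a
polynomial in the position t of one root, and it vanishes for all t in the infinite set S. -/
theorem PolyOnLines.eq_zero_of_multiset {S : Set ℂ} (hS : S.Infinite) {G : ℂ[X] → ℂ}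
    (hG : PolyOnLines G) {n : ℕ} (h : ∀ f ∈ zerosIn S, f.natDegree = n → G f = 0)
    (s : Multiset ℂ) (q : ℂ[X]) (hq : q ∈ zerosIn S) (hn : s.card + q.natDegree = n) :
    G ((s.map fun x => X - C x).prod * q) = 0 := by
  induction s using Multiset.induction_on generalizing q with
  | empty => simpa using h q hq (by simpa using hn)
  | cons a s ih =>
    set P := (s.map fun x => X - C x).prod with hP
    obtain ⟨p, hp⟩ := hG (X * (P * q)) (-(P * q))
    have hline : ∀ t : ℂ, X * (P * q) + t • (-(P * q)) = P * ((X - C t) * q) := fun t => by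
      rw [smul_eq_C_mul]; ring
    have hp0 : p = 0 := by
      refine eq_zero_of_infinite_isRoot _ (hS.mono fun t ht => ?_)
      change p.eval t = 0
      rw [← hp, hline]
      refine ih _ (mul_mem_zerosIn (X_sub_C_mem_zerosIn ht) hq) ?_
      rw [natDegree_mul (X_sub_C_ne_zero t) hq.1, natDegree_X_sub_C, ← hn, Multiset.card_cons]
      ring
    have := hp a
    rw [hline, hp0, eval_zero] at this
    rw [Multiset.map_cons, Multiset.prod_cons, ← hP, ← this]
    congr 1
    ring

/-- A function that is polynomial on lines and vanishes on the polynomials of degree `n` in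
`π(S)` vanishes on all polynomials of degree at most `n`. -/
theorem PolyOnLines.eq_zero {S : Set ℂ} (hS : S.Infinite) {G : ℂ[X] → ℂ}
    (hG : PolyOnLines G) {n : ℕ} (h : ∀ f ∈ zerosIn S, f.natDegree = n → G f = 0)
    {f : ℂ[X]} (hf : f.natDegree ≤ n) : G f = 0 := by
  have key : ∀ g : ℂ[X], g ≠ 0 → g.natDegree = n → G g = 0 := fun g hg hgn => by
    have hsp := IsAlgClosed.splits g
    have := hG.eq_zero_of_multiset hS h g.roots (C g.leadingCoeff)
      (C_mem_zerosIn S (leadingCoeff_ne_zero.mpr hg)) (by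
        rw [natDegree_C, ← hsp.natDegree_eq_card_roots, hgn, add_zero])
    rwa [mul_comm, ← hsp.eq_prod_roots] at this
  -- A polynomial f of smaller degree is reached from exact degree n: f + t X^n has degree n for all
  -- t but one, and f itself is the value t = 0.
  obtain ⟨p, hp⟩ := hG f (X ^ n)
  have hp0 : p = 0 := by
    refine eq_zero_of_infinite_isRoot _
      (((Set.finite_singleton (-f.coeff n)).infinite_compl).mono fun t ht => ?_)
    change p.eval t = 0
    rw [← hp]
    have hc : (f + t • X ^ n).coeff n ≠ 0 := by
      simp only [coeff_add, coeff_smul, coeff_X_pow, if_true, smul_eq_mul, mul_one]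
      intro h0
      exact ht (eq_neg_of_add_eq_zero_right h0)
    refine key _ (fun h0 => hc (by rw [h0, coeff_zero])) (le_antisymm ?_ (le_natDegree_of_ne_zero hc))
    refine (natDegree_add_le _ _).trans (max_le hf ((natDegree_smul_le _ _).trans ?_))
    rw [natDegree_X_pow]
  have := hp 0
  rwa [hp0, eval_zero, zero_smul, add_zero] at this

theorem exists_mem_zerosIn_map_ne_zero {S : Set ℂ} (hS : S.Infinite) {T : ℂ[X] →ₗ[ℂ] ℂ[X]}
    {f : ℂ[X]} (hf : T f ≠ 0) : ∃ g ∈ zerosIn S, T g ≠ 0 := by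
  by_contra! hc
  refine hf (Polynomial.ext fun k => ?_)
  rw [coeff_zero]
  exact (PolyOnLines.of_linear ((lcoeff ℂ k).comp T)).eq_zero hS
    (fun g hg _ => by simp [hc g hg]) le_rfl

/-! ### Pointwise proportional linear maps -/

section Proportional
variable {V W : Type*} [AddCommGroup V] [Module ℂ V] [AddCommGroup W] [Module ℂ W]

/-- Comparing coefficients in B(x + y) = e (A x + A y) gives c = e = d. -/
theorem eq_of_proportional {A B : V →ₗ[ℂ] W} (h : ∀ v, A v ≠ 0 → ∃ c : ℂ, B v = c • A v)
    {x y : V} (hxy : LinearIndependent ℂ ![A x, A y]) {c d : ℂ} (hx : B x = c • A x)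
    (hy : B y = d • A y) : c = d := by
  rw [LinearIndependent.pair_iff] at hxy
  obtain ⟨e, he⟩ := h (x + y) (fun h0 => by
    have := hxy 1 1 (by simpa using h0)
    exact one_ne_zero this.1)
  rw [map_add, map_add, hx, hy, smul_add] at he
  have := hxy (c - e) (d - e) (by
    rw [sub_smul, sub_smul, sub_add_sub_comm, he, sub_self])
  linear_combination this.1 - this.2

/-- Independent images share their scalar. If A v is parallel to A x, it is compared with A y
instead; if A v = 0, then x is replaced by x + v, which has the same image under A, and this forces
B v = 0. -/
theorem exists_eq_smul_of_proportional {A B : V →ₗ[ℂ] W}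
    (h : ∀ v, A v ≠ 0 → ∃ c : ℂ, B v = c • A v) {x y : V}
    (hxy : LinearIndependent ℂ ![A x, A y]) : ∃ c : ℂ, ∀ v, B v = c • A v := by
  have hx0 : A x ≠ 0 := by simpa using hxy.ne_zero 0
  have hy0 : A y ≠ 0 := by simpa using hxy.ne_zero 1
  obtain ⟨c, hc⟩ := h x hx0
  obtain ⟨d, hd⟩ := h y hy0
  have hcd := eq_of_proportional h hxy hc hd
  refine ⟨c, fun v => ?_⟩
  rcases eq_or_ne (A v) 0 with hv | hv
  · have h1 : A (x + v) = A x := by rw [map_add, hv, add_zero]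
    obtain ⟨e, he⟩ := h (x + v) (by rwa [h1])
    have := eq_of_proportional h (x := x + v) (y := y) (by rwa [h1]) he hd
    rw [h1, map_add, hc, this, ← hcd] at he
    rw [hv, smul_zero]
    simpa using he
  · obtain ⟨e, he⟩ := h v hv
    by_cases hi : LinearIndependent ℂ ![A x, A v]
    · rw [he, eq_of_proportional h hi hc he]
    · have hi' : LinearIndependent ℂ ![A v, A y] := by
        rw [LinearIndependent.pair_iff' hx0] at hi
        push Not at hi
        obtain ⟨s, hs⟩ := hi
        have hs0 : s ≠ 0 := by
          rintro rfl
          exact hv (by rw [← hs, zero_smul])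
        rw [LinearIndependent.pair_iff' hv]
        intro t ht
        rw [LinearIndependent.pair_iff' hx0] at hxy
        exact hxy (t * s) (by rw [mul_smul, hs, ht])
      rw [he, eq_of_proportional h hi' he hd, hcd]

theorem exists_linearIndependent_of_not_rank_le_one {A : V →ₗ[ℂ] W}
    (h : ¬ Module.rank ℂ (LinearMap.range A) ≤ 1) :
    ∃ x y, LinearIndependent ℂ ![A x, A y] := by
  by_contra! hc
  apply h
  rw [rank_le_one_iff]
  by_cases h0 : ∀ x, A x = 0
  · refine ⟨0, ?_⟩
    rintro ⟨_, x, rfl⟩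
    exact ⟨0, by ext; simp [h0 x]⟩
  · push Not at h0
    obtain ⟨x, hx⟩ := h0
    refine ⟨⟨A x, x, rfl⟩, ?_⟩
    rintro ⟨_, y, rfl⟩
    have := hc x y
    rw [LinearIndependent.pair_iff' hx] at this
    push Not at this
    obtain ⟨r, hr⟩ := this
    exact ⟨r, Subtype.ext hr⟩

end Proportional

theorem exists_smul_eq_of_coeff_mul_eq {p q : ℂ[X]} (hp : p ≠ 0)
    (h : ∀ i j, p.coeff i * q.coeff j - p.coeff j * q.coeff i = 0) : ∃ c : ℂ, q = c • p := by
  have hl : p.leadingCoeff ≠ 0 := leadingCoeff_ne_zero.mpr hp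
  refine ⟨q.coeff p.natDegree / p.leadingCoeff, Polynomial.ext fun j => ?_⟩
  rw [coeff_smul, smul_eq_mul]
  have := h p.natDegree j
  rw [coeff_natDegree] at this
  field_simp
  linear_combination this

/-! ### The polynomials `w ↦ L ((X + w) ^ n)` -/

/-- The polynomial `w ↦ L ((X + w) ^ n)`. -/
noncomputable def symbolPoly (L : ℂ[X] →ₗ[ℂ] ℂ) (n : ℕ) : ℂ[X] :=
  ∑ k ∈ Finset.range (n + 1), monomial (n - k) ((n.choose k : ℂ) * L (X ^ k))

theorem eval_symbolPoly (L : ℂ[X] →ₗ[ℂ] ℂ) (n : ℕ) (w : ℂ) :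
    (symbolPoly L n).eval w = L ((X + C w) ^ n) := by
  rw [symbolPoly, eval_finsetSum, add_pow, map_sum]
  refine Finset.sum_congr rfl fun k _ => ?_
  have : (X : ℂ[X]) ^ k * C w ^ (n - k) * (n.choose k : ℂ[X]) =
      (w ^ (n - k) * (n.choose k : ℂ)) • X ^ k := by
    rw [smul_eq_C_mul, C_mul, C_pow, map_natCast]; ring
  rw [this, map_smul, eval_monomial, smul_eq_mul]
  ring

theorem coeff_symbolPoly (L : ℂ[X] →ₗ[ℂ] ℂ) {n k : ℕ} (hk : k ≤ n) :
    (symbolPoly L n).coeff (n - k) = (n.choose k : ℂ) * L (X ^ k) := by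
  rw [symbolPoly, finsetSum_coeff, Finset.sum_eq_single k]
  · rw [coeff_monomial, if_pos rfl]
  · intro j hj hjk
    rw [coeff_monomial, if_neg]
    have := Finset.mem_range.mp hj
    omega
  · intro h
    exact absurd (Finset.mem_range.mpr (by omega)) h

theorem natDegree_symbolPoly_le (L : ℂ[X] →ₗ[ℂ] ℂ) (n : ℕ) :
    (symbolPoly L n).natDegree ≤ n :=
  natDegree_sum_le_of_forall_le _ _ fun _ _ => (natDegree_monomial_le _).trans (Nat.sub_le _ _)

/-- The symbols form an Appell sequence, since d/dw (X + w)^(n+1) = (n + 1)(X + w)^n. This is what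
links consecutive degrees in polar derivatives and in both Gauss–Lucas arguments. -/
theorem derivative_symbolPoly (L : ℂ[X] →ₗ[ℂ] ℂ) (n : ℕ) :
    derivative (symbolPoly L (n + 1)) = C ((n : ℂ) + 1) * symbolPoly L n := by
  ext j
  rw [coeff_derivative, coeff_C_mul]
  rcases le_or_gt j n with hj | hj
  · have h1 := coeff_symbolPoly L (n := n + 1) (k := n - j) (by omega)
    have h2 := coeff_symbolPoly L (n := n) (k := n - j) (by omega)
    rw [show n + 1 - (n - j) = j + 1 by omega] at h1
    rw [show n - (n - j) = j by omega] at h2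
    rw [h1, h2]
    have h3 : (n + 1).choose (n - j) * (j + 1) = (n + 1) * n.choose (n - j) := by
      have := Nat.choose_mul_succ_eq n (n - j)
      rw [show n + 1 - (n - j) = j + 1 by omega] at this
      rw [← this]; ring
    have h4 : ((n + 1).choose (n - j) : ℂ) * ((j : ℂ) + 1) = ((n : ℂ) + 1) * n.choose (n - j) := by
      exact_mod_cast h3
    linear_combination L (X ^ (n - j)) * h4
  · rw [coeff_eq_zero_of_natDegree_lt (lt_of_le_of_lt (natDegree_symbolPoly_le L (n + 1))
      (by omega)), coeff_eq_zero_of_natDegree_lt (lt_of_le_of_lt (natDegree_symbolPoly_le L n) hj)]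
    simp

theorem eq_zero_of_symbolPoly_eq_zero {L : ℂ[X] →ₗ[ℂ] ℂ} {n : ℕ} (h : symbolPoly L n = 0)
    {f : ℂ[X]} (hf : f.natDegree ≤ n) : L f = 0 := by
  rw [as_sum_range_C_mul_X_pow' f (Nat.lt_succ_of_le hf), map_sum]
  refine Finset.sum_eq_zero fun k hk => ?_
  have hk' : k ≤ n := by have := Finset.mem_range.mp hk; omega
  rw [← smul_eq_C_mul, map_smul]
  have := coeff_symbolPoly L hk'
  rw [h, coeff_zero] at this
  have hc : (n.choose k : ℂ) ≠ 0 := by exact_mod_cast (Nat.choose_pos hk').ne'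
  rw [(mul_eq_zero.mp this.symm).resolve_left hc, smul_zero]

/-- The functional `f ↦ T f (z)`. -/
noncomputable def evalAt (T : ℂ[X] →ₗ[ℂ] ℂ[X]) (z : ℂ) : ℂ[X] →ₗ[ℂ] ℂ :=
  (leval z).comp T

@[simp] theorem evalAt_apply (T : ℂ[X] →ₗ[ℂ] ℂ[X]) (z : ℂ) (f : ℂ[X]) :
    evalAt T z f = (T f).eval z := rfl

/-- For fixed z the symbol has infinitely many zeros w, and its coefficients are nonzero multiples
of T(X^k)(z) for k ≤ n. -/
theorem map_eq_zero_of_pow_eq_zero {T : ℂ[X] →ₗ[ℂ] ℂ[X]} {n : ℕ} {W : Set ℂ} (hW : W.Infinite)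
    (h : ∀ w ∈ W, T ((X + C w) ^ n) = 0) {f : ℂ[X]} (hf : f.natDegree ≤ n) : T f = 0 := by
  refine Polynomial.funext fun z => ?_
  rw [eval_zero]
  refine eq_zero_of_symbolPoly_eq_zero (L := evalAt T z) (n := n) ?_ hf
  refine eq_zero_of_infinite_isRoot _ (hW.mono fun w hw => ?_)
  change eval w _ = 0
  rw [eval_symbolPoly, evalAt_apply, h w hw, eval_zero]

/-! ### The extension of `T` to bivariate polynomials -/

theorem eval_extend (T : ℂ[X] →ₗ[ℂ] ℂ[X]) (F : ℂ[X][X]) (w : ℂ) :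
    (extend T F).eval (C w) = T (F.eval (C w)) := by
  have hdeg : (extend T F).natDegree < F.natDegree + 1 := by
    rw [Nat.lt_succ_iff, natDegree_le_iff_coeff_eq_zero]
    intro k hk
    rw [coeff_extend, coeff_eq_zero_of_natDegree_lt hk, map_zero]
  rw [eval_eq_sum_range' hdeg, eval_eq_sum_range, map_sum]
  refine Finset.sum_congr rfl fun k _ => ?_
  rw [coeff_extend, ← C_pow, mul_comm, mul_comm (F.coeff k), ← smul_eq_C_mul, ← smul_eq_C_mul,
    map_smul]

theorem evalEval_extend (T : ℂ[X] →ₗ[ℂ] ℂ[X]) (F : ℂ[X][X]) (z w : ℂ) :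
    (extend T F).evalEval z w = (T (F.eval (C w))).eval z := by
  rw [evalEval, eval_extend]

theorem extend_eq_zero_iff (T : ℂ[X] →ₗ[ℂ] ℂ[X]) (F : ℂ[X][X]) :
    extend T F = 0 ↔ ∀ w : ℂ, T (F.eval (C w)) = 0 := by
  refine ⟨fun h w => by rw [← eval_extend, h, eval_zero], fun h => ?_⟩
  refine eq_zero_of_infinite_isRoot _ ((Set.infinite_range_of_injective C_injective).mono ?_)
  rintro _ ⟨w, rfl⟩
  change eval _ _ = 0
  rw [eval_extend, h]

/-! ### Arguments of real-rooted polynomials in the upper half-plane -/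

/-- The argument of `z - x` for `z` in the upper half-plane and real `x`. -/
noncomputable def angle (z : ℂ) (x : ℝ) : ℝ := Real.pi / 2 - Real.arctan ((z.re - x) / z.im)

theorem angle_pos (z : ℂ) (x : ℝ) : 0 < angle z x := by
  have := Real.arctan_lt_pi_div_two ((z.re - x) / z.im)
  unfold angle; linarith

theorem angle_lt_pi (z : ℂ) (x : ℝ) : angle z x < Real.pi := by
  have := Real.neg_pi_div_two_lt_arctan ((z.re - x) / z.im)
  unfold angle; linarith

theorem strictMono_angle {z : ℂ} (hz : 0 < z.im) : StrictMono (angle z) := fun x y hxy => by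
  unfold angle
  have : Real.arctan ((z.re - y) / z.im) < Real.arctan ((z.re - x) / z.im) :=
    Real.arctan_strictMono (by gcongr)
  linarith

theorem sub_eq_mul_exp_angle {z : ℂ} (hz : 0 < z.im) (x : ℝ) :
    ∃ r : ℝ, 0 < r ∧ z - x = r * Complex.exp (angle z x * Complex.I) := by
  set u := (z.re - x) / z.im with hu
  have hs : 0 < √(1 + u ^ 2) := Real.sqrt_pos.mpr (by positivity)
  refine ⟨z.im * √(1 + u ^ 2), by positivity, ?_⟩
  rw [Complex.exp_mul_I, ← Complex.ofReal_cos, ← Complex.ofReal_sin, angle, ← hu,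
    Real.cos_pi_div_two_sub, Real.sin_pi_div_two_sub, Real.sin_arctan, Real.cos_arctan]
  apply Complex.ext
  · simp only [Complex.sub_re, Complex.ofReal_re, Complex.mul_re, Complex.add_re, Complex.add_im,
      Complex.ofReal_im, Complex.mul_im, Complex.I_re, Complex.I_im]
    have h1 : z.re - x = z.im * u := by rw [hu]; field_simp
    rw [h1]
    field_simp
    simp
    ring
  · simp only [Complex.sub_im, Complex.ofReal_re, Complex.mul_re, Complex.add_re, Complex.add_im,
      Complex.ofReal_im, Complex.mul_im, Complex.I_re, Complex.I_im]
    field_simp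
    simp

/-- The sum of the arguments of `z - x` over the zeros `x` of `P`. -/
noncomputable def angleSum (P : ℝ[X]) (z : ℂ) : ℝ := (P.roots.map (angle z)).sum

theorem IsHyperbolic.splits {P : ℝ[X]} (hP : IsHyperbolic P) : P.Splits := by
  refine Splits.of_splits_map_of_injective (i := algebraMap ℝ ℂ) (algebraMap ℝ ℂ).injective
    (IsAlgClosed.splits _) fun a ha => ?_
  have h1 : aeval a P = 0 := by
    have := isRoot_of_mem_roots ha
    rwa [IsRoot, eval_map_algebraMap] at this
  refine ⟨a.re, Complex.ext (by simp) ?_⟩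
  simp [hP.2 a h1]

theorem aeval_eq_mul_exp_angleSum {P : ℝ[X]} (hP : IsHyperbolic P) {z : ℂ} (hz : 0 < z.im) :
    ∃ ρ : ℝ, ρ ≠ 0 ∧ aeval z P = ρ * Complex.exp (angleSum P z * Complex.I) := by
  have key : ∀ s : Multiset ℝ, ∃ ρ : ℝ, ρ ≠ 0 ∧ (s.map fun x : ℝ => z - (x : ℂ)).prod =
      ρ * Complex.exp (((s.map (angle z)).sum : ℝ) * Complex.I) := fun s => by
    induction s using Multiset.induction_on with
    | empty => exact ⟨1, one_ne_zero, by simp⟩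
    | cons a s ih =>
      obtain ⟨ρ, hρ, h⟩ := ih
      obtain ⟨r, hr, h'⟩ := sub_eq_mul_exp_angle hz a
      refine ⟨r * ρ, by positivity, ?_⟩
      rw [Multiset.map_cons, Multiset.prod_cons, h, h', Multiset.map_cons, Multiset.sum_cons,
        Complex.ofReal_add, add_mul, Complex.exp_add]
      push_cast
      ring
  obtain ⟨ρ, hρ, h⟩ := key P.roots
  refine ⟨P.leadingCoeff * ρ, mul_ne_zero (leadingCoeff_ne_zero.mpr hP.1) hρ, ?_⟩
  conv_lhs => rw [hP.splits.eq_prod_roots]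
  rw [map_mul, map_multiset_prod, Multiset.map_map]
  simp only [Function.comp_def, map_sub, aeval_X, aeval_C]
  have : (algebraMap ℝ ℂ) = Complex.ofRealHom := rfl
  simp only [Complex.coe_algebraMap]
  rw [h, angleSum]
  push_cast
  ring

theorem aeval_conj (P : ℝ[X]) (z : ℂ) :
    aeval (starRingEnd ℂ z) P = starRingEnd ℂ (aeval z P) :=
  aeval_algHom_apply (Complex.conjAe.toAlgHom) z P

/-! ### Real combinations of polynomials with interlacing zeros -/

theorem InterlaceFrom.tail {a : ℝ} {α β : List ℝ} (h : InterlaceFrom (a :: α) β) :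
    InterlaceFrom β α := by
  obtain ⟨h1, h2, h3, h4⟩ := h
  simp only [List.length_cons] at h1 h2
  refine ⟨by omega, by omega, fun i hβ hα => ?_, fun i hα hβ => ?_⟩
  · exact h4 i hβ (by simpa using hα)
  · exact h3 (i + 1) (by simpa using hα) hβ

theorem InterlaceFrom.head_le {a b : ℝ} {α β : List ℝ} (h : InterlaceFrom (a :: α) (b :: β)) :
    a ≤ b := by
  exact h.2.2.1 0 (by simp) (by simp)

/-- Removing the first point a gives the difference f(a) - (Σβ - Σα'), where β now leads; thus the
odd case and the equal-length case feed each other in the induction. The equality clauses record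
that an extreme value forces the remaining points to coincide in pairs. -/
theorem InterlaceFrom.alternating_sum {f : ℝ → ℝ} (hf : StrictMono f) {M : ℝ}
    (hM : ∀ x, f x < M) (N : ℕ) : ∀ α β : List ℝ, α.length + β.length = N → InterlaceFrom α β →
      (∀ a α', α = a :: α' → α.length = β.length + 1 →
        f a ≤ (α.map f).sum - (β.map f).sum ∧ (α.map f).sum - (β.map f).sum < M ∧
          ((α.map f).sum - (β.map f).sum = f a → α' = β)) ∧
      (α.length = β.length → (α.map f).sum - (β.map f).sum ≤ 0 ∧
        ((α.map f).sum - (β.map f).sum = 0 → α = β) ∧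
        ∀ a α', α = a :: α' → f a - M < (α.map f).sum - (β.map f).sum) := by
  induction N with
  | zero =>
    intro α β hN _
    obtain rfl : α = [] := List.eq_nil_of_length_eq_zero (by omega)
    obtain rfl : β = [] := List.eq_nil_of_length_eq_zero (by omega)
    simp
  | succ N ih =>
    intro α β hN h
    rcases α with _ | ⟨a, α⟩
    · have := h.1
      simp at this hN
      simp [this] at hN
    simp only [List.length_cons] at hN
    obtain ⟨ih1, ih2⟩ := ih β α (by omega) h.tail
    simp only [List.map_cons, List.sum_cons, List.length_cons, List.cons.injEq, and_imp,
      forall_apply_eq_imp_iff, forall_eq', add_left_inj]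
    constructor
    · intro hl
      obtain ⟨h1, h2, h3⟩ := ih2 hl.symm
      rcases β with _ | ⟨b, β⟩
      · obtain rfl : α = [] := List.eq_nil_of_length_eq_zero (by simpa using hl)
        simp [hM]
      · have hab := hf.monotone h.head_le
        have h4 := h3 b β rfl
        refine ⟨by linarith, by linarith, fun h5 => (h2 (by linarith)).symm⟩
    · intro hl
      rcases β with _ | ⟨b, β⟩
      · simp at hl
      · have hab := hf.monotone h.head_le
        obtain ⟨h1, h2, h3⟩ := ih1 b β rfl hl.symm
        refine ⟨by linarith, fun h4 => ?_, by linarith⟩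
        have h5 : f a = f b := by linarith
        rw [hf.injective h5, h3 (by linarith)]

theorem angleSum_eq_sort (P : ℝ[X]) (z : ℂ) :
    angleSum P z = ((P.roots.sort (· ≤ ·)).map (angle z)).sum := by
  rw [angleSum]
  conv_lhs => rw [← Multiset.sort_eq P.roots (· ≤ ·)]
  rw [Multiset.map_coe, Multiset.sum_coe]

/-- A real relation between P(z) and Q(z) makes the difference S of the arguments a multiple of π.
Interlacing puts S in (0, π) when P has one more zero, which is impossible, and in (-π, 0] when the
numbers agree; then S = 0, the zeros coincide and P is a multiple of Q. -/
theorem combination_eq_zero_of_interlaceFrom {P Q : ℝ[X]} (hP : IsHyperbolic P)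
    (hQ : IsHyperbolic Q)
    (h : InterlaceFrom (P.roots.sort (· ≤ ·)) (Q.roots.sort (· ≤ ·))) {s t : ℝ} {z : ℂ}
    (hz : 0 < z.im) (h0 : s * aeval z P + t * aeval z Q = 0) : C s * P + C t * Q = 0 := by
  obtain ⟨ρ, hρ, hPz⟩ := aeval_eq_mul_exp_angleSum hP hz
  obtain ⟨ρ', hρ', hQz⟩ := aeval_eq_mul_exp_angleSum hQ hz
  have hQ0 : aeval z Q ≠ 0 := by
    rw [hQz]; exact mul_ne_zero (by exact_mod_cast hρ') (Complex.exp_ne_zero _)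
  rcases eq_or_ne s 0 with rfl | hs
  · have : (t : ℂ) = 0 := by simpa [hQ0] using h0
    have : t = 0 := by exact_mod_cast this
    simp [this]
  set S := angleSum P z - angleSum Q z with hS
  have hsin : Real.sin S = 0 := by
    have h1 : ((s * ρ : ℝ) : ℂ) * Complex.exp (S * Complex.I) + ((t * ρ' : ℝ) : ℂ) = 0 := by
      have h2 : Complex.exp (angleSum P z * Complex.I) =
          Complex.exp (S * Complex.I) * Complex.exp (angleSum Q z * Complex.I) := by
        rw [← Complex.exp_add, hS]; push_cast; ring_nf
      rw [hPz, hQz, h2] at h0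
      apply mul_right_cancel₀ (Complex.exp_ne_zero (angleSum Q z * Complex.I))
      push_cast
      linear_combination h0
    have h3 := congrArg Complex.im h1
    rw [Complex.add_im, Complex.im_ofReal_mul, Complex.exp_ofReal_mul_I_im, Complex.ofReal_im,
      add_zero, Complex.zero_im] at h3
    exact (mul_eq_zero.mp h3).resolve_left (mul_ne_zero hs hρ)
  have hSs : S = ((P.roots.sort (· ≤ ·)).map (angle z)).sum -
      ((Q.roots.sort (· ≤ ·)).map (angle z)).sum := by
    rw [hS, angleSum_eq_sort, angleSum_eq_sort]
  obtain ⟨hodd, heven⟩ := InterlaceFrom.alternating_sum (strictMono_angle hz) (angle_lt_pi z)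
    _ _ _ rfl h
  rw [← hSs] at hodd heven
  have hlist : P.roots.sort (· ≤ ·) = Q.roots.sort (· ≤ ·) := by
    rcases eq_or_ne (P.roots.sort (· ≤ ·)).length (Q.roots.sort (· ≤ ·)).length with hl | hl
    · obtain ⟨h1, h2, h3⟩ := heven hl
      refine h2 ?_
      have h4 : -Real.pi < S := by
        rcases hc : P.roots.sort (· ≤ ·) with _ | ⟨a, α⟩
        · have : Q.roots.sort (· ≤ ·) = [] :=
            List.eq_nil_of_length_eq_zero (by rw [← hl, hc]; rfl)
          rw [hSs, hc, this]
          simp [Real.pi_pos]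
        · have h5 := h3 a α hc
          have h6 := angle_pos z a
          linarith
      exact (Real.sin_eq_zero_iff_of_lt_of_lt h4 (by linarith [Real.pi_pos])).mp hsin
    · have hl' : (P.roots.sort (· ≤ ·)).length = (Q.roots.sort (· ≤ ·)).length + 1 := by
        have := h.1
        have := h.2.1
        omega
      rcases hc : P.roots.sort (· ≤ ·) with _ | ⟨a, α⟩
      · rw [hc] at hl'; simp at hl'
      · obtain ⟨h1, h2, -⟩ := hodd a α hc hl'
        have h6 := angle_pos z a
        have h7 := Real.sin_pos_of_pos_of_lt_pi (by linarith) h2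
        linarith
  have hroots : P.roots = Q.roots := by
    rw [← Multiset.sort_eq P.roots (· ≤ ·), hlist, Multiset.sort_eq]
  have hPQ : P = C (P.leadingCoeff / Q.leadingCoeff) * Q := by
    conv_lhs => rw [hP.splits.eq_prod_roots]
    conv_rhs => rw [hQ.splits.eq_prod_roots]
    rw [hroots, ← mul_assoc, ← C_mul, leadingCoeff_mul, leadingCoeff_C,
      (monic_multiset_prod_of_monic _ _ fun x _ => monic_X_sub_C x).leadingCoeff, mul_one,
      div_mul_cancel₀ _ (leadingCoeff_ne_zero.mpr hQ.1)]
  set c := P.leadingCoeff / Q.leadingCoeff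
  rw [hPQ] at h0 ⊢
  have : ((s * c + t : ℝ) : ℂ) = 0 := by
    apply mul_right_cancel₀ hQ0
    rw [map_mul, aeval_C, Complex.coe_algebraMap] at h0
    push_cast
    linear_combination h0
  rw [← mul_assoc, ← C_mul, ← add_mul, ← C_add, show s * c + t = 0 by exact_mod_cast this]
  simp

/-- Real linear combinations of hyperbolic polynomials with interlacing zeros are hyperbolic
or zero. -/
theorem Interlacing.combination_eq_zero {P Q : ℝ[X]} (hP : IsHyperbolic P)
    (hQ : IsHyperbolic Q) (h : Interlacing P Q) {s t : ℝ} {z : ℂ}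
    (hz : z.im ≠ 0) (h0 : s * aeval z P + t * aeval z Q = 0) : C s * P + C t * Q = 0 := by
  wlog hpos : 0 < z.im generalizing z
  · refine this (z := starRingEnd ℂ z) (by simpa using hz) ?_ ?_
    · have := congrArg (starRingEnd ℂ) h0
      simpa [aeval_conj] using this
    · rw [Complex.conj_im]
      have := lt_of_le_of_ne (not_lt.mp hpos) hz
      linarith
  rcases h with h | h
  · exact combination_eq_zero_of_interlaceFrom hP hQ h hpos h0
  · rw [add_comm] at h0 ⊢
    exact combination_eq_zero_of_interlaceFrom hQ hP h hpos h0

/-! ### The converse: Obreschkoff's theorem -/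

/-- In an increasing list the entry at index i exceeds x exactly when at least `length - i` entries
do. This translates interlacing into counting functions. -/
theorem lt_getElem_iff_of_sorted {x : ℝ} : ∀ {l : List ℝ}, l.SortedLE → ∀ (i : ℕ)
    (hi : i < l.length), x < l[i] ↔ l.length ≤ i + l.countP (x < ·)
  | [], _, i, hi => by simp at hi
  | a :: l, hl, i, hi => by
    have hl' : l.SortedLE := (List.pairwise_cons.mp hl.pairwise).2.sortedLE
    have ha : ∀ b ∈ l, a ≤ b := (List.pairwise_cons.mp hl.pairwise).1
    by_cases hx : x < a
    · have hall : ∀ b ∈ a :: l, x < b := by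
        intro b hb
        rcases List.mem_cons.mp hb with rfl | hb
        exacts [hx, hx.trans_le (ha b hb)]
      have : (a :: l).countP (x < ·) = (a :: l).length := by
        rw [List.countP_eq_length]; simpa using hall
      rw [this]
      exact iff_of_true (hall _ (List.getElem_mem hi)) (Nat.le_add_left _ _)
    · rw [List.countP_cons_of_neg (by simpa using hx)]
      rcases i with _ | i
      · have := List.countP_le_length (p := fun b => decide (x < b)) (l := l)
        simp only [List.getElem_cons_zero, hx, List.length_cons, false_iff]
        omega
      · simp only [List.getElem_cons_succ, List.length_cons]
        rw [lt_getElem_iff_of_sorted hl' i (by simpa using hi)]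
        omega

/-- A point below both lists shows that p has as many entries as q or one more. With equal lengths p
is shifted to the right and q comes first; with one extra entry p comes first. -/
theorem interlacing_of_countP {p q : List ℝ} (hp : p.SortedLE) (hq : q.SortedLE)
    (h1 : ∀ x : ℝ, q.countP (x < ·) ≤ p.countP (x < ·))
    (h2 : ∀ x : ℝ, p.countP (x < ·) ≤ q.countP (x < ·) + 1) :
    InterlaceFrom p q ∨ InterlaceFrom q p := by
  obtain ⟨x₀, hx₀⟩ : ∃ x₀ : ℝ, ∀ y ∈ p ++ q, x₀ < y := by
    obtain ⟨b, hb⟩ := (p ++ q).toFinset.bddBelow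
    exact ⟨b - 1, fun y hy => by
      have := hb (show y ∈ ((p ++ q).toFinset : Set ℝ) by simpa using hy)
      linarith⟩
  have hcp : p.countP (x₀ < ·) = p.length := by
    rw [List.countP_eq_length]
    intro y hy
    simpa using hx₀ y (List.mem_append_left _ hy)
  have hcq : q.countP (x₀ < ·) = q.length := by
    rw [List.countP_eq_length]
    intro y hy
    simpa using hx₀ y (List.mem_append_right _ hy)
  have hl1 := h1 x₀
  have hl2 := h2 x₀
  rw [hcp, hcq] at hl1 hl2
  rcases eq_or_ne p.length q.length with hl | hl
  · right
    refine ⟨by omega, by omega, fun i hiq hip => ?_, fun i hip hiq => ?_⟩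
    · by_contra! hc
      have := (lt_getElem_iff_of_sorted hq i hiq).mp hc
      have h3 := h1 p[i]
      exact lt_irrefl _ ((lt_getElem_iff_of_sorted hp i hip).mpr (by omega))
    · by_contra! hc
      have := (lt_getElem_iff_of_sorted hp i hip).mp hc
      have h3 := h2 q[i + 1]
      exact lt_irrefl _ ((lt_getElem_iff_of_sorted hq (i + 1) hiq).mpr (by omega))
  · left
    refine ⟨by omega, by omega, fun i hip hiq => ?_, fun i hiq hip => ?_⟩
    · by_contra! hc
      have := (lt_getElem_iff_of_sorted hp i hip).mp hc
      have h3 := h2 q[i]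
      exact lt_irrefl _ ((lt_getElem_iff_of_sorted hq i hiq).mpr (by omega))
    · by_contra! hc
      have := (lt_getElem_iff_of_sorted hq i hiq).mp hc
      have h3 := h1 p[i + 1]
      exact lt_irrefl _ ((lt_getElem_iff_of_sorted hp (i + 1) hip).mpr (by omega))

/-- The approach is along the parabola x + δ + iδ², so that a zero at x itself contributes 0 in the
limit: its angle has cotangent δ/δ². Zeros beyond x contribute π. -/
theorem tendsto_angleSum_boundary (P : ℝ[X]) (x : ℝ) :
    Tendsto (fun δ : ℝ => angleSum P (⟨x + δ, δ ^ 2⟩ : ℂ)) (𝓝[>] 0)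
      (𝓝 (((P.roots.sort (· ≤ ·)).countP (x < ·) : ℕ) * Real.pi)) := by
  have hinv : Tendsto (fun δ : ℝ => δ⁻¹) (𝓝[>] 0) atTop := tendsto_inv_nhdsGT_zero
  have hinv2 : Tendsto (fun δ : ℝ => (δ ^ 2)⁻¹) (𝓝[>] 0) atTop := by
    simp_rw [← inv_pow]
    exact (tendsto_pow_atTop two_ne_zero).comp hinv
  have hangle : ∀ a : ℝ, Tendsto (fun δ : ℝ => angle (⟨x + δ, δ ^ 2⟩ : ℂ) a) (𝓝[>] 0)
      (𝓝 (if x < a then Real.pi else 0)) := fun a => by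
    simp only [angle]
    split_ifs with h
    · have h1 : Tendsto (fun δ : ℝ => (x + δ - a) / δ ^ 2) (𝓝[>] 0) atBot := by
        simp_rw [div_eq_mul_inv]
        refine Tendsto.neg_mul_atTop (C := x - a) (by linarith) ?_ hinv2
        have : Tendsto (fun δ : ℝ => x + δ - a) (𝓝 0) (𝓝 (x + 0 - a)) :=
          (tendsto_id.const_add x).sub_const a
        rw [add_zero] at this
        exact this.mono_left nhdsWithin_le_nhds
      have h2 := (Real.tendsto_arctan_atBot.mono_right nhdsWithin_le_nhds).comp h1
      have h3 := h2.const_sub (Real.pi / 2)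
      simpa using h3
    · have h1 : Tendsto (fun δ : ℝ => (x + δ - a) / δ ^ 2) (𝓝[>] 0) atTop := by
        refine tendsto_atTop_mono' _ ?_ hinv
        filter_upwards [self_mem_nhdsWithin] with δ hδ
        have hδ' : (0 : ℝ) < δ := hδ
        rw [inv_eq_one_div, div_le_div_iff₀ hδ' (by positivity)]
        nlinarith [mul_nonneg (sub_nonneg.mpr (not_lt.mp h)) hδ'.le]
      have h2 := (Real.tendsto_arctan_atTop.mono_right nhdsWithin_le_nhds).comp h1
      have h3 := h2.const_sub (Real.pi / 2)
      simpa using h3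
  have key : ∀ l : List ℝ, Tendsto (fun δ : ℝ => (l.map (angle (⟨x + δ, δ ^ 2⟩ : ℂ))).sum)
      (𝓝[>] 0) (𝓝 ((l.countP (x < ·) : ℕ) * Real.pi)) := fun l => by
    induction l with
    | nil => simp
    | cons a l ih =>
      have := (hangle a).add ih
      simp only [List.map_cons, List.sum_cons]
      convert this using 2
      rw [List.countP_cons]
      simp only [decide_eq_true_eq]
      split_ifs <;> push_cast <;> ring
  simp_rw [angleSum_eq_sort]
  exact key _

theorem tendsto_angleSum_atTop (P : ℝ[X]) :
    Tendsto (fun x : ℝ => angleSum P (⟨x, 1⟩ : ℂ)) atTop (𝓝 0) := by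
  have key : ∀ l : List ℝ, Tendsto (fun x : ℝ => (l.map (angle (⟨x, 1⟩ : ℂ))).sum)
      atTop (𝓝 0) := fun l => by
    induction l with
    | nil => simp
    | cons a l ih =>
      have h1 : Tendsto (fun x : ℝ => angle (⟨x, 1⟩ : ℂ) a) atTop (𝓝 0) := by
        simp only [angle, div_one]
        have h2 := (Real.tendsto_arctan_atTop.mono_right nhdsWithin_le_nhds).comp
          (tendsto_atTop_add_const_right atTop (-a) tendsto_id)
        have h3 := h2.const_sub (Real.pi / 2)
        simpa [Function.comp_def, sub_eq_add_neg] using h3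
      simpa using h1.add ih
  simp_rw [angleSum_eq_sort]
  exact key _

theorem continuousOn_angleSum (P : ℝ[X]) : ContinuousOn (angleSum P) {z : ℂ | 0 < z.im} := by
  have key : ∀ s : Multiset ℝ, ContinuousOn (fun z => (s.map (angle z)).sum) {z : ℂ | 0 < z.im} :=
    fun s => by
      induction s using Multiset.induction_on with
      | empty => simpa using continuousOn_const
      | cons a s ih =>
        simp only [Multiset.map_cons, Multiset.sum_cons]
        refine ContinuousOn.add ?_ ih
        unfold angle
        refine continuousOn_const.sub (Real.continuous_arctan.comp_continuousOn ?_)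
        refine ContinuousOn.div (by fun_prop) (by fun_prop) fun z hz => ?_
        exact (show (0 : ℝ) < z.im from hz).ne'
  exact key _

theorem interlaceFrom_of_angleSum {P Q : ℝ[X]}
    (h0 : ∀ z : ℂ, 0 < z.im → 0 < angleSum P z - angleSum Q z)
    (hpi : ∀ z : ℂ, 0 < z.im → angleSum P z - angleSum Q z < Real.pi) : Interlacing P Q := by
  have hmem : ∀ x : ℝ, ((P.roots.sort (· ≤ ·)).countP (x < ·) : ℝ) * Real.pi -
      ((Q.roots.sort (· ≤ ·)).countP (x < ·) : ℕ) * Real.pi ∈ Set.Icc 0 Real.pi := fun x => by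
    refine isClosed_Icc.mem_of_tendsto
      ((tendsto_angleSum_boundary P x).sub (tendsto_angleSum_boundary Q x)) ?_
    filter_upwards [self_mem_nhdsWithin] with δ hδ
    have hδ' : (0 : ℝ) < δ := hδ
    have him : (0 : ℝ) < (⟨x + δ, δ ^ 2⟩ : ℂ).im := by
      change (0 : ℝ) < δ ^ 2
      positivity
    exact ⟨(h0 _ him).le, (hpi _ him).le⟩
  refine interlacing_of_countP ((Multiset.pairwise_sort _ _).sortedLE) ((Multiset.pairwise_sort _ _).sortedLE)
    (fun x => ?_) (fun x => ?_)
  · have := (hmem x).1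
    rw [← sub_mul] at this
    have := nonneg_of_mul_nonneg_left this Real.pi_pos
    exact_mod_cast (sub_nonneg.mp this)
  · have := (hmem x).2
    rw [← sub_mul] at this
    have := (mul_le_iff_le_one_left Real.pi_pos).mp this
    have h3 : ((P.roots.sort (· ≤ ·)).countP (x < ·) : ℝ) ≤
      ((Q.roots.sort (· ≤ ·)).countP (x < ·) : ℕ) + 1 := by linarith
    exact_mod_cast h3

/-- If no nontrivial real combination of two hyperbolic polynomials has a zero in the upper
half-plane, then their zeros interlace. -/
theorem interlacing_of_forall_combination {P Q : ℝ[X]} (hP : IsHyperbolic P)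
    (hQ : IsHyperbolic Q)
    (h : ∀ (s t : ℝ) (z : ℂ), 0 < z.im → s * aeval z P + t * aeval z Q = 0 → s = 0) :
    Interlacing P Q := by
  set D : ℂ → ℝ := fun z => angleSum P z - angleSum Q z with hD
  have hcont : ContinuousOn D {z : ℂ | 0 < z.im} :=
    (continuousOn_angleSum P).sub (continuousOn_angleSum Q)
  have hpre : IsPreconnected {z : ℂ | 0 < z.im} := (convex_halfSpace_im_gt 0).isPreconnected
  have hsin : ∀ z : ℂ, 0 < z.im → Real.sin (D z) ≠ 0 := fun z hz hs => by
    obtain ⟨ρ, hρ, hPz⟩ := aeval_eq_mul_exp_angleSum hP hz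
    obtain ⟨ρ', hρ', hQz⟩ := aeval_eq_mul_exp_angleSum hQ hz
    -- If sin D = 0, then e^{iD} is the real number cos D, and ρ' P - ρ cos(D) Q vanishes at z.
    refine hρ' (h ρ' (-(Real.cos (D z) * ρ)) z hz ?_)
    have h2 : Complex.exp (angleSum P z * Complex.I) =
        Real.cos (D z) * Complex.exp (angleSum Q z * Complex.I) := by
      have : (angleSum P z : ℂ) * Complex.I = D z * Complex.I + angleSum Q z * Complex.I := by
        rw [hD]; push_cast; ring
      rw [this, Complex.exp_add, Complex.exp_mul_I, ← Complex.ofReal_cos, ← Complex.ofReal_sin, hs]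
      simp
    rw [hPz, hQz, h2]
    push_cast
    ring
  have hne : ∀ z : ℂ, 0 < z.im → D z ≠ 0 ∧ D z ≠ Real.pi ∧ D z ≠ -Real.pi := fun z hz =>
    ⟨fun h0 => hsin z hz (by simp [h0]), fun h0 => hsin z hz (by simp [h0]),
      fun h0 => hsin z hz (by simp [h0])⟩
  -- Far to the right both argument sums tend to 0, so D has a value in (-π, π). As D omits 0 and ±π
  -- on a connected set, it stays in one of the intervals (-π, 0), (0, π).
  obtain ⟨z₁, hz₁, hlt⟩ : ∃ z₁ : ℂ, 0 < z₁.im ∧ D z₁ ∈ Set.Ioo (-Real.pi) Real.pi := by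
    have h1 := (tendsto_angleSum_atTop P).sub (tendsto_angleSum_atTop Q)
    rw [sub_zero] at h1
    have h2 := h1.eventually (Ioo_mem_nhds (neg_lt_zero.mpr Real.pi_pos) Real.pi_pos)
    obtain ⟨x, hx⟩ := h2.exists
    exact ⟨⟨x, 1⟩, one_pos, hx⟩
  have hiv : ∀ z : ℂ, 0 < z.im → ∀ y : ℝ, (∀ w : ℂ, 0 < w.im → D w ≠ y) →
      (y < D z ↔ y < D z₁) := fun z hz y hy => by
    constructor
    · intro h1
      by_contra! h2
      obtain ⟨w, hw, hwy⟩ := hpre.intermediate_value hz₁ hz hcont ⟨h2, h1.le⟩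
      exact hy w hw hwy
    · intro h1
      by_contra! h2
      obtain ⟨w, hw, hwy⟩ := hpre.intermediate_value hz hz₁ hcont ⟨h2, h1.le⟩
      exact hy w hw hwy
  rcases lt_or_gt_of_ne (hne z₁ hz₁).1 with hneg | hpos
  · have : Interlacing Q P := by
      refine interlaceFrom_of_angleSum (fun z hz => ?_) (fun z hz => ?_)
      · have h1 := (hiv z hz 0 fun w hw => (hne w hw).1).not.mpr hneg.not_gt
        have h2 := lt_of_le_of_ne (not_lt.mp h1) (hne z hz).1
        simp only [hD] at h2
        linarith
      · have h1 := (hiv z hz (-Real.pi) fun w hw => (hne w hw).2.2).mpr hlt.1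
        simp only [hD] at h1
        linarith
    exact this.symm
  · refine interlaceFrom_of_angleSum (fun z hz => ?_) (fun z hz => ?_)
    · exact (hiv z hz 0 fun w hw => (hne w hw).1).mpr hpos
    · have h1 := (hiv z hz Real.pi fun w hw => (hne w hw).2.1).not.mpr hlt.2.not_gt
      exact lt_of_le_of_ne (not_lt.mp h1) (hne z hz).2.1

/-! ### The Grace–Walsh–Szegő theorem for half-planes -/

/-- The map r ↦ 1/(w - r) sends the real line to the circle through 0 and 1/(i Im w), whose centre
is 1/(2i Im w); the closed half-plane not containing w goes into the closed disk. -/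
theorem norm_inv_sub_sub_le_iff {w r : ℂ} (hw : w.im ≠ 0) (hr : w ≠ r) :
    ‖1 / (w - r) - 1 / (2 * w.im * Complex.I)‖ ≤ ‖1 / (2 * w.im * Complex.I)‖ ↔
      w.im * r.im ≤ 0 := by
  have hwr : w - r ≠ 0 := sub_ne_zero.mpr hr
  have hwc : (2 * w.im * Complex.I : ℂ) ≠ 0 :=
    mul_ne_zero (mul_ne_zero two_ne_zero (by exact_mod_cast hw)) Complex.I_ne_zero
  rw [div_sub_div _ _ hwr hwc, one_mul, mul_one, norm_div, norm_mul, norm_div, norm_one,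
    div_le_div_iff₀ (by positivity) (by positivity), one_mul, mul_le_mul_iff_left₀ (by positivity),
    ← sq_le_sq₀ (norm_nonneg _) (norm_nonneg _), Complex.sq_norm, Complex.sq_norm,
    Complex.normSq_apply, Complex.normSq_apply]
  simp only [Complex.sub_re, Complex.mul_re, Complex.re_ofNat, Complex.ofReal_re, Complex.im_ofNat,
    Complex.ofReal_im, Complex.mul_im, Complex.I_re, Complex.I_im, Complex.sub_im]
  constructor <;> intro h <;> nlinarith

theorem norm_multiset_sum_sub_le {κ : ℂ} (m : Multiset ℂ) (h : ∀ s ∈ m, ‖s - κ‖ ≤ ‖κ‖) :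
    ‖m.sum - m.card * κ‖ ≤ m.card * ‖κ‖ := by
  induction m using Multiset.induction_on with
  | empty => simp
  | cons a m ih =>
    have h1 := ih fun s hs => h s (Multiset.mem_cons_of_mem hs)
    have h2 := h a (Multiset.mem_cons_self a m)
    rw [Multiset.sum_cons, Multiset.card_cons]
    push_cast
    calc ‖a + m.sum - (m.card + 1) * κ‖ = ‖(a - κ) + (m.sum - m.card * κ)‖ := by congr 1; ring
      _ ≤ ‖a - κ‖ + ‖m.sum - m.card * κ‖ := norm_add_le _ _
      _ ≤ _ := by linarith

/-- The polar derivative with respect to a point of a half-plane of a polynomial without zeros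
there has no zeros there. -/
theorem eval_polarDerivative_ne_zero {q : ℂ[X]} {n : ℕ} (hq : q.natDegree ≤ n) (hn : 0 < n)
    {s : ℝ} (h : ∀ w : ℂ, 0 < s * w.im → q.eval w ≠ 0) {x w : ℂ} (hx : 0 < s * x.im)
    (hw : 0 < s * w.im) : (n : ℂ) * q.eval w + (x - w) * (derivative q).eval w ≠ 0 := by
  intro h0
  have hqw := h w hw
  have hnC : (n : ℂ) ≠ 0 := by exact_mod_cast hn.ne'
  have hwx : w ≠ x := by
    rintro rfl
    rw [sub_self, zero_mul, add_zero] at h0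
    exact (mul_ne_zero hnC hqw) h0
  have hw0 : w.im ≠ 0 := by rintro h; rw [h] at hw; simp at hw
  have hsum := (IsAlgClosed.splits q).eval_derivative_div_eval_of_ne_zero hqw
  set m := q.roots.map fun r => 1 / (w - r) with hm
  have hms : m.sum = n * (1 / (w - x)) := by
    rw [← hsum]
    have : w - x ≠ 0 := sub_ne_zero.mpr hwx
    field_simp
    linear_combination -h0
  -- All terms 1/(w - r) lie in the disk |s - κ| ≤ |κ|. This disk contains 0, so the n - deg q
  -- missing roots may be counted as zero terms; the mean 1/(w - x) of n points of the disk lies in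
  -- it too, which places x outside the half-plane.
  set κ : ℂ := 1 / (2 * w.im * Complex.I) with hκ
  have hcard : m.card ≤ n := by
    rw [hm, Multiset.card_map]; exact (card_roots' q).trans hq
  have h1 : ‖m.sum - m.card * κ‖ ≤ m.card * ‖κ‖ := by
    refine norm_multiset_sum_sub_le m fun σ hσ => ?_
    obtain ⟨r, hr, rfl⟩ := Multiset.mem_map.mp hσ
    have hr0 : q.eval r = 0 := isRoot_of_mem_roots hr
    refine (norm_inv_sub_sub_le_iff hw0 ?_).mpr ?_
    · rintro rfl; exact hqw hr0
    · have h2 : ¬ 0 < s * r.im := fun h3 => h r h3 hr0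
      by_contra! h3
      apply h2
      have hs2 : 0 < (s * w.im) * (s * r.im) := by
        have : 0 < s ^ 2 := by
          have : s ≠ 0 := by rintro rfl; simp at hw
          positivity
        nlinarith [mul_pos this h3]
      exact (pos_iff_pos_of_mul_pos hs2).mp hw
  have h2 : ‖(n : ℂ) * (1 / (w - x) - κ)‖ ≤ n * ‖κ‖ := by
    have h3 : (n : ℂ) * (1 / (w - x) - κ) =
        (m.sum - m.card * κ) - ((n - m.card : ℝ) : ℂ) * κ := by
      rw [hms]; push_cast; ring
    have h4 : (0 : ℝ) ≤ n - m.card := sub_nonneg.mpr (by exact_mod_cast hcard)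
    rw [h3]
    refine (norm_sub_le _ _).trans ?_
    rw [norm_mul, Complex.norm_real, Real.norm_of_nonneg h4]
    linarith
  rw [norm_mul, Complex.norm_natCast] at h2
  have h3 := (norm_inv_sub_sub_le_iff hw0 hwx).mp
    (le_of_mul_le_mul_left h2 (by exact_mod_cast hn))
  have : 0 < (s * s) * (w.im * x.im) := by nlinarith [mul_pos hx hw]
  nlinarith [mul_self_nonneg s]

/-- The Grace–Walsh–Szegő theorem for half-planes, for linear functionals. -/
theorem apply_prod_ne_zero_of_apply_pow_ne_zero {s : ℝ} (hs : s ≠ 0) (m : Multiset ℂ) :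
    ∀ L : ℂ[X] →ₗ[ℂ] ℂ, (∀ w : ℂ, 0 < s * w.im → L ((X + C w) ^ m.card) ≠ 0) →
      (∀ x ∈ m, 0 < s * x.im) → L ((m.map fun x => X + C x).prod) ≠ 0 := by
  induction m using Multiset.induction_on with
  | empty =>
    intro L hL _
    simpa using hL (s * Complex.I) (by simpa using mul_self_pos.mpr hs)
  | cons x m ih =>
    intro L hL hm
    rw [Multiset.map_cons, Multiset.prod_cons]
    -- With one factor X + x absorbed into the functional, the new symbol is, up to the factor
    -- `m.card + 1`, the polar derivative of the old one with respect to x.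
    refine ih (L.comp (LinearMap.mulLeft ℂ (X + C x))) (fun w hw => ?_)
      (fun y hy => hm y (Multiset.mem_cons_of_mem hy))
    have h := eval_polarDerivative_ne_zero (natDegree_symbolPoly_le L (m.card + 1))
      (Nat.succ_pos _) (s := s) (fun w hw => by
        rw [eval_symbolPoly]; simpa using hL w hw) (hm x (Multiset.mem_cons_self x m)) hw
    rw [derivative_symbolPoly, eval_mul, eval_C, eval_symbolPoly, eval_symbolPoly] at h
    rw [LinearMap.comp_apply, LinearMap.mulLeft_apply]
    intro h0
    apply h
    have h1 : (X + C x) * (X + C w) ^ m.card =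
        (X + C w) ^ (m.card + 1) + (x - w) • (X + C w) ^ m.card := by
      rw [smul_eq_C_mul, C_sub]; ring
    rw [h1, map_add, map_smul, smul_eq_mul] at h0
    push_cast
    linear_combination ((m.card : ℂ) + 1) * h0

/-! ### Stability implies preservation of real-rootedness -/

/-- The real line in `ℂ`. -/
def realLine : Set ℂ := {z | z.im = 0}

theorem infinite_realLine : realLine.Infinite :=
  (Set.infinite_range_of_injective Complex.ofReal_injective).mono
    (by rintro _ ⟨x, rfl⟩; exact Complex.ofReal_im x)

/-- `T ((X + w) ^ n)` does not vanish at `z` when `e * Im z * Im w > 0`. -/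
def SymbolStable (e : ℝ) (T : ℂ[X] →ₗ[ℂ] ℂ[X]) (n : ℕ) : Prop :=
  ∀ z w : ℂ, 0 < e * z.im * w.im → (T ((X + C w) ^ n)).eval z ≠ 0

theorem continuous_apply_prod (c : ℂ) (m : Multiset ℂ) :
    ∀ (L : ℂ[X] →ₗ[ℂ] ℂ),
      Continuous fun ε : ℝ => L ((m.map fun x => X + C (x + ε * c)).prod) := by
  induction m using Multiset.induction_on with
  | empty => intro L; simpa using continuous_const
  | cons a m ih =>
    intro L
    have h1 := ih (L.comp (LinearMap.mulLeft ℂ X))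
    have h2 := ih L
    have h3 : ∀ ε : ℝ, L (((a ::ₘ m).map fun x => X + C (x + ε * c)).prod) =
        L (X * (m.map fun x => X + C (x + ε * c)).prod) +
          (a + ε * c) * L ((m.map fun x => X + C (x + ε * c)).prod) := fun ε => by
      rw [Multiset.map_cons, Multiset.prod_cons, add_mul, map_add, ← smul_eq_C_mul, map_smul,
        smul_eq_mul]
    simp_rw [h3]
    simp only [LinearMap.comp_apply, LinearMap.mulLeft_apply] at h1
    exact h1.add ((continuous_const.add (Complex.continuous_ofReal.mul continuous_const)).mul h2)

theorem natDegree_map_le_maxDeg (T : ℂ[X] →ₗ[ℂ] ℂ[X]) {n : ℕ} {f : ℂ[X]} (hf : f.natDegree ≤ n) :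
    (T f).natDegree ≤ maxDeg T n :=
  (isGreatest_maxDeg T n).2 ⟨f, mem_degreeLE.mpr (natDegree_le_iff_degree_le.mp hf), rfl⟩

/-- The real numbers x in the factors X + x of f are pushed into an open half-plane, where
Grace–Walsh–Szegő applies, and Hurwitz's theorem handles ε → 0+. The direction c = e s i is dictated
by the sign: for s Im z > 0, stability concerns the w with e s Im w > 0. -/
theorem map_eq_zero_or_eval_ne_zero {e : ℝ} (he : e ≠ 0) {T : ℂ[X] →ₗ[ℂ] ℂ[X]} {f : ℂ[X]}
    (hf : f ∈ zerosIn realLine) (h : SymbolStable e T f.natDegree) {s : ℝ} (hs : s ≠ 0) :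
    T f = 0 ∨ ∀ z : ℂ, 0 < s * z.im → (T f).eval z ≠ 0 := by
  set l := f.leadingCoeff
  have hl : l ≠ 0 := leadingCoeff_ne_zero.mpr hf.1
  set m := f.roots.map fun r => -r with hm
  have hcard : m.card = f.natDegree := by
    rw [hm, Multiset.card_map, (IsAlgClosed.splits f).natDegree_eq_card_roots]
  have hmim : ∀ x ∈ m, x.im = 0 := fun x hx => by
    obtain ⟨r, hr, rfl⟩ := Multiset.mem_map.mp hx
    have : r.im = 0 := hf.2 r (isRoot_of_mem_roots hr)
    simp [this]
  have hfm : f = l • (m.map fun x => X + C x).prod := by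
    conv_lhs => rw [(IsAlgClosed.splits f).eq_prod_roots]
    rw [smul_eq_C_mul, hm, Multiset.map_map]
    simp [sub_eq_add_neg, l]
  set c : ℂ := (e * s : ℝ) * Complex.I with hc
  set p : ℝ → ℂ[X] := fun ε => T ((m.map fun x => X + C (x + ε * c)).prod) with hp
  have hT : T f = l • T ((m.map fun x => X + C x).prod) := by
    conv_lhs => rw [hfm]
    rw [map_smul]
  have key : T ((m.map fun x => X + C x).prod) = 0 ∨
      ∀ z ∈ {z : ℂ | 0 < s * z.im}, (T ((m.map fun x => X + C x).prod)).eval z ≠ 0 := by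
    refine eq_zero_or_eval_ne_zero_of_tendsto (l := 𝓝[>] (0 : ℝ)) (p := p)
      (N := maxDeg T f.natDegree) (Eventually.of_forall fun ε => ?_) (fun z => ?_)
      (isOpen_lt continuous_const (by fun_prop)) ?_
    · refine natDegree_map_le_maxDeg T ?_
      refine (natDegree_multiset_prod_le _).trans ?_
      rw [Multiset.map_map]
      have : (m.map (natDegree ∘ fun x => X + C (x + (ε : ℂ) * c))).sum ≤ m.card • 1 := by
        rw [← Multiset.card_map (natDegree ∘ fun x => X + C (x + (ε : ℂ) * c)) m]
        refine Multiset.sum_le_card_nsmul _ _ fun k hk => ?_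
        obtain ⟨x, _, rfl⟩ := Multiset.mem_map.mp hk
        exact (natDegree_X_add_C _).le
      rwa [smul_eq_mul, mul_one, hcard] at this
    · have h1 := (continuous_apply_prod c m (evalAt T z)).tendsto 0
      simp only [Complex.ofReal_zero, zero_mul, add_zero] at h1
      exact h1.mono_left nhdsWithin_le_nhds
    · filter_upwards [self_mem_nhdsWithin] with ε hε z hz
      have hε' : (0 : ℝ) < ε := hε
      have hz' : 0 < s * z.im := hz
      have hpr := apply_prod_ne_zero_of_apply_pow_ne_zero (mul_ne_zero he hs)
        (m.map fun x => x + ε * c) (evalAt T z) (fun w hw => ?_) (fun y hy => ?_)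
      · rw [Multiset.map_map] at hpr
        exact hpr
      · rw [Multiset.card_map, hcard, evalAt_apply]
        refine h z w ?_
        have hs2 : 0 < s ^ 2 := by positivity
        have : 0 < (s * z.im) * (e * s * w.im) := mul_pos hz' hw
        have h3 : (s * z.im) * (e * s * w.im) = s ^ 2 * (e * z.im * w.im) := by ring
        rw [h3] at this
        exact (pos_iff_pos_of_mul_pos this).mp hs2
      · obtain ⟨x, hx, rfl⟩ := Multiset.mem_map.mp hy
        have : (x + ε * c).im = ε * (e * s) := by simp [hmim x hx, hc]
        rw [this]
        have : 0 < (e * s) ^ 2 := by positivity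
        nlinarith [mul_pos hε' this]
  rw [hT]
  rcases key with h0 | h0
  · left; rw [h0, smul_zero]
  · right
    intro z hz
    rw [eval_smul, smul_eq_mul]
    exact mul_ne_zero hl (h0 z hz)

theorem preserves_realLine_of_symbolStable {e : ℝ} (he : e ≠ 0) {T : ℂ[X] →ₗ[ℂ] ℂ[X]}
    (h : ∀ n, (∀ w : ℂ, T ((X + C w) ^ n) = 0) ∨ SymbolStable e T n) :
    Preserves realLine T := by
  intro f hf
  rcases h f.natDegree with h0 | h0
  · right
    exact map_eq_zero_of_pow_eq_zero Set.infinite_univ (fun w _ => h0 w) le_rfl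
  · by_cases hTf : T f = 0
    · right; exact hTf
    · left
      refine ⟨hTf, fun z hz => ?_⟩
      have h1 := (map_eq_zero_or_eval_ne_zero he hf h0 one_ne_zero).resolve_left hTf z
      have h2 := (map_eq_zero_or_eval_ne_zero he hf h0 (neg_ne_zero.mpr one_ne_zero)).resolve_left
        hTf z
      change z.im = 0
      by_contra hne
      rcases lt_or_gt_of_ne hne with hlt | hgt
      · exact h2 (by linarith) hz
      · exact h1 (by linarith) hz

/-! ### Real operators -/

/-- Complex conjugation of the coefficients. -/
noncomputable def conjPoly (f : ℂ[X]) : ℂ[X] := f.map (starRingEnd ℂ)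

@[simp] theorem conjPoly_conjPoly (f : ℂ[X]) : conjPoly (conjPoly f) = f := by
  ext k; simp [conjPoly, coeff_map]

@[simp] theorem conjPoly_add (f g : ℂ[X]) : conjPoly (f + g) = conjPoly f + conjPoly g :=
  Polynomial.map_add _

@[simp] theorem conjPoly_smul (s : ℂ) (f : ℂ[X]) :
    conjPoly (s • f) = starRingEnd ℂ s • conjPoly f := by
  ext k; simp [conjPoly, coeff_map]

theorem eval_conjPoly (f : ℂ[X]) (z : ℂ) :
    (conjPoly f).eval z = starRingEnd ℂ (f.eval (starRingEnd ℂ z)) := by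
  have h := eval_map_apply (starRingEnd ℂ) (p := f) (starRingEnd ℂ z)
  rwa [Complex.conj_conj] at h

theorem natDegree_conjPoly (f : ℂ[X]) : (conjPoly f).natDegree = f.natDegree :=
  natDegree_map _

theorem coeff_conjPoly (f : ℂ[X]) (k : ℕ) :
    (conjPoly f).coeff k = starRingEnd ℂ (f.coeff k) := coeff_map _ _

/-- The operator `f ↦ conj (T (conj f))`. -/
noncomputable def conjOp (T : ℂ[X] →ₗ[ℂ] ℂ[X]) : ℂ[X] →ₗ[ℂ] ℂ[X] where
  toFun f := conjPoly (T (conjPoly f))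
  map_add' f g := by simp
  map_smul' s f := by simp

theorem conjOp_apply (T : ℂ[X] →ₗ[ℂ] ℂ[X]) (f : ℂ[X]) :
    conjOp T f = conjPoly (T (conjPoly f)) := rfl

theorem conjPoly_eq_smul_of_mem_zerosIn {f : ℂ[X]} (hf : f ∈ zerosIn realLine) :
    ∃ c : ℂ, conjPoly f = c • f := by
  have hl : f.leadingCoeff ≠ 0 := leadingCoeff_ne_zero.mpr hf.1
  refine ⟨starRingEnd ℂ f.leadingCoeff / f.leadingCoeff, ?_⟩
  have h1 : conjPoly f = C (starRingEnd ℂ f.leadingCoeff) *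
      (f.roots.map fun x => X - C x).prod := by
    conv_lhs => rw [(IsAlgClosed.splits f).eq_prod_roots]
    rw [conjPoly, Polynomial.map_mul, map_C, Polynomial.map_multiset_prod, Multiset.map_map]
    congr 2
    refine Multiset.map_congr rfl fun r hr => ?_
    have hr' : starRingEnd ℂ r = r :=
      Complex.conj_eq_iff_im.mpr (hf.2 r (isRoot_of_mem_roots hr))
    simp [hr']
  rw [h1, smul_eq_C_mul]
  conv_rhs => arg 2; rw [(IsAlgClosed.splits f).eq_prod_roots]
  rw [← mul_assoc, ← C_mul, div_mul_cancel₀ _ hl]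

/-- Take κ² = c: since |κ| = 1, conj(κ) κ² = κ. This removes a unimodular phase. -/
theorem exists_sq_mul_eq_one {c : ℂ} (hc : starRingEnd ℂ c * c = 1) :
    ∃ κ : ℂ, κ ≠ 0 ∧ starRingEnd ℂ κ * c = κ := by
  obtain ⟨κ, hκ⟩ := IsAlgClosed.exists_pow_nat_eq c (n := 2) two_pos
  have hc0 : c ≠ 0 := by rintro rfl; simp at hc
  have hκ0 : κ ≠ 0 := by rintro rfl; simp at hκ; exact hc0 hκ.symm
  refine ⟨κ, hκ0, ?_⟩
  have hn : Complex.normSq κ = 1 := by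
    have h1 : ‖c‖ ^ 2 = 1 := by
      rw [Complex.conj_mul'] at hc
      exact_mod_cast hc
    rw [Complex.normSq_eq_norm_sq, ← norm_pow, hκ]
    have := norm_nonneg c
    nlinarith
  have h3 := Complex.normSq_eq_conj_mul_self (z := κ)
  rw [hn] at h3
  rw [← hκ, pow_two, ← mul_assoc, ← h3]
  simp

/-- A preserver of real-rootedness of rank at least two is a multiple of a real operator. -/
theorem exists_smul_real {T : ℂ[X] →ₗ[ℂ] ℂ[X]} (hT : Preserves realLine T) {x y : ℂ[X]}
    (hxy : LinearIndependent ℂ ![T x, T y]) :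
    ∃ κ : ℂ, κ ≠ 0 ∧ ∀ f, conjPoly ((κ • T) f) = (κ • T) (conjPoly f) := by
  -- On π(ℝ) conjugation multiplies both f and T f by scalars, so the 2 × 2 minors of the
  -- coefficients of T f and `conjOp T f` vanish there. Being polynomial on lines, they vanish for
  -- every f.
  have hprop : ∀ f, T f ≠ 0 → ∃ c : ℂ, conjOp T f = c • T f := fun f hf => by
    refine exists_smul_eq_of_coeff_mul_eq hf fun i j => ?_
    refine PolyOnLines.eq_zero (n := f.natDegree) infinite_realLine
      (((PolyOnLines.of_linear ((lcoeff ℂ i).comp T)).mul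
        (PolyOnLines.of_linear ((lcoeff ℂ j).comp (conjOp T)))).sub
      ((PolyOnLines.of_linear ((lcoeff ℂ j).comp T)).mul
        (PolyOnLines.of_linear ((lcoeff ℂ i).comp (conjOp T))))) (fun g hg _ => ?_) le_rfl
    obtain ⟨c, hc⟩ := conjPoly_eq_smul_of_mem_zerosIn hg
    obtain ⟨d, hd⟩ : ∃ d : ℂ, conjPoly (T g) = d • T g := by
      rcases hT g hg with h | h
      · exact conjPoly_eq_smul_of_mem_zerosIn h
      · exact ⟨0, by rw [Set.mem_singleton_iff.mp h]; simp [conjPoly]⟩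
    have : conjOp T g = (starRingEnd ℂ c * d) • T g := by
      rw [conjOp_apply, hc, map_smul, conjPoly_smul, hd, smul_smul]
    simp only [LinearMap.comp_apply, this, lcoeff_apply, coeff_smul, smul_eq_mul]
    ring
  obtain ⟨c, hc⟩ := exists_eq_smul_of_proportional hprop hxy
  have hcc : starRingEnd ℂ c * c = 1 := by
    have h1 : T x = (starRingEnd ℂ c * c) • T x := by
      have h2 := hc (conjPoly x)
      rw [conjOp_apply, conjPoly_conjPoly] at h2
      have h3 := congrArg conjPoly h2
      rw [conjPoly_conjPoly, conjPoly_smul, ← conjOp_apply, hc, smul_smul] at h3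
      exact h3
    have hx : T x ≠ 0 := by simpa using hxy.ne_zero 0
    have h4 : (starRingEnd ℂ c * c - 1) • T x = 0 := by rw [sub_smul, ← h1, one_smul, sub_self]
    exact sub_eq_zero.mp ((smul_eq_zero.mp h4).resolve_right hx)
  obtain ⟨κ, hκ, hκc⟩ := exists_sq_mul_eq_one hcc
  refine ⟨κ, hκ, fun f => ?_⟩
  have h := hc (conjPoly f)
  rw [conjOp_apply, conjPoly_conjPoly] at h
  rw [LinearMap.smul_apply, LinearMap.smul_apply, conjPoly_smul, h, smul_smul, hκc]

/-! ### Perturbation of real-rooted polynomials -/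

theorem eval_ofReal_of_real {f : ℂ[X]} (hf : conjPoly f = f) (x : ℝ) :
    (((f.eval (x : ℂ)).re : ℝ) : ℂ) = f.eval (x : ℂ) := by
  have h := eval_conjPoly f x
  rw [hf, Complex.conj_ofReal] at h
  exact Complex.conj_eq_iff_re.mp h.symm

/-- A real polynomial of degree at most `n` whose values alternate in sign at `n` points has only
real zeros. -/
theorem mem_zerosIn_of_alternating {f : ℂ[X]} (hf : conjPoly f = f) {n : ℕ} (hn : 0 < n)
    (hdeg : f.natDegree ≤ n) {x : ℕ → ℝ} (hx : ∀ i j, i < j → j < n → x j < x i) {c : ℝ}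
    (hsign : ∀ j < n, 0 < c * (-1) ^ j * (f.eval (x j : ℂ)).re) : f ∈ zerosIn realLine := by
  have hf0 : f ≠ 0 := by
    rintro rfl
    have := hsign 0 hn
    simp at this
  refine ⟨hf0, fun z hz => ?_⟩
  by_contra hzim
  have hzim' : z.im ≠ 0 := hzim
  have hcont : Continuous fun t : ℝ => (f.eval (t : ℂ)).re :=
    Complex.continuous_re.comp (f.continuous.comp Complex.continuous_ofReal)
  have hroot : ∀ j, ∃ y : ℝ, j + 1 < n → y ∈ Set.Ioo (x (j + 1)) (x j) ∧ f.eval (y : ℂ) = 0 := by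
    intro j
    by_cases hj : j + 1 < n
    · have h1 := hsign j (by omega)
      have h2 := hsign (j + 1) hj
      have hlt := hx j (j + 1) (by omega) hj
      set k := c * (-1) ^ j with hk
      have h2' : k * (f.eval (x (j + 1) : ℂ)).re < 0 := by
        rw [pow_succ] at h2
        have : c * ((-1) ^ j * -1) = -k := by rw [hk]; ring
        rw [this] at h2
        linarith
      have hk0 : k ≠ 0 := by rintro h; rw [h] at h1; simp at h1
      obtain ⟨y, hy, hy0⟩ := intermediate_value_Ioo hlt.le
        (f := fun t : ℝ => k * (f.eval (t : ℂ)).re) (hcont.const_mul k |>.continuousOn) ⟨h2', h1⟩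
      refine ⟨y, fun _ => ⟨hy, ?_⟩⟩
      rw [← eval_ofReal_of_real hf, (mul_eq_zero.mp hy0).resolve_left hk0, Complex.ofReal_zero]
    · exact ⟨0, fun h => absurd h hj⟩
  choose y hy using hroot
  have hanti : ∀ i j, i < j → j + 1 < n → y j < y i := fun i j hij hj => by
    have h1 := (hy j hj).1.2
    have h2 := (hy i (by omega)).1.1
    rcases eq_or_lt_of_le (Nat.succ_le_of_lt hij) with h | h
    · have h' : j = i + 1 := h.symm
      rw [h'] at h1 ⊢
      linarith
    · have := hx (i + 1) j h (by omega)
      linarith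
  set S : Finset ℂ := (Finset.range (n - 1)).image fun j => (y j : ℂ) with hS
  have hScard : S.card = n - 1 := by
    rw [hS, Finset.card_image_of_injOn, Finset.card_range]
    intro i hi j hj hij
    have hi' := Finset.mem_range.mp (Finset.mem_coe.mp hi)
    have hj' := Finset.mem_range.mp (Finset.mem_coe.mp hj)
    have hij' : y i = y j := Complex.ofReal_injective hij
    rcases lt_trichotomy i j with h | h | h
    · exact absurd hij' (hanti i j h (by omega)).ne'
    · exact h
    · exact absurd hij' (hanti j i h (by omega)).ne
  have hSim : ∀ w ∈ S, w.im = 0 := fun w hw => by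
    obtain ⟨j, _, rfl⟩ := Finset.mem_image.mp hw
    exact Complex.ofReal_im _
  have hzS : z ∉ S := fun h => hzim' (hSim z h)
  have hzbar : starRingEnd ℂ z ∉ insert z S := by
    intro h
    rcases Finset.mem_insert.mp h with h | h
    · exact hzim' (Complex.conj_eq_iff_im.mp h)
    · have := hSim _ h
      rw [Complex.conj_im, neg_eq_zero] at this
      exact hzim' this
  -- The n - 1 zeros between sign changes together with z and its conjugate would be n + 1 distinct
  -- zeros.
  have hsub : insert (starRingEnd ℂ z) (insert z S) ⊆ f.roots.toFinset := by
    intro w hw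
    rw [Multiset.mem_toFinset, mem_roots hf0]
    rcases Finset.mem_insert.mp hw with rfl | hw
    · change f.eval _ = 0
      have h := eval_conjPoly f (starRingEnd ℂ z)
      have hz' : f.eval z = 0 := hz
      rw [hf, Complex.conj_conj, hz', map_zero] at h
      exact h
    · rcases Finset.mem_insert.mp hw with rfl | hw
      · exact hz
      · obtain ⟨j, hj, rfl⟩ := Finset.mem_image.mp hw
        exact (hy j (by have := Finset.mem_range.mp hj; omega)).2
  have hcard := (Finset.card_le_card hsub).trans (Multiset.toFinset_card_le _) |>.trans
    (card_roots' f)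
  rw [Finset.card_insert_of_notMem hzbar, Finset.card_insert_of_notMem hzS, hScard] at hcard
  omega

/-- The points at which `w + x` has a prescribed argument. -/
theorem exists_angle_eq {w : ℂ} (hw : 0 < w.im) {θ : ℝ} (h0 : 0 < θ) (hpi : θ < Real.pi) :
    ∃ x : ℝ, angle w x = θ := by
  refine ⟨w.re - w.im * Real.tan (Real.pi / 2 - θ), ?_⟩
  have : (w.re - (w.re - w.im * Real.tan (Real.pi / 2 - θ))) / w.im =
      Real.tan (Real.pi / 2 - θ) := by field_simp; ring
  rw [angle, this, Real.arctan_tan (by linarith) (by linarith)]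
  ring

theorem exists_exp_re_ne_zero {κ : ℂ} (hκ : κ ≠ 0) :
    ∃ δ : ℝ, 0 < δ ∧ δ < Real.pi ∧ (κ * Complex.exp (δ * Complex.I)).re ≠ 0 := by
  by_contra! h
  have h1 := h (Real.pi / 2) (by positivity) (by linarith [Real.pi_pos])
  have h2 := h (Real.pi / 4) (by positivity) (by linarith [Real.pi_pos])
  rw [Complex.mul_re, Complex.exp_ofReal_mul_I_re, Complex.exp_ofReal_mul_I_im] at h1 h2
  rw [Real.cos_pi_div_two, Real.sin_pi_div_two] at h1
  rw [Real.cos_pi_div_four, Real.sin_pi_div_four] at h2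
  have him : κ.im = 0 := by linarith
  have hre : κ.re = 0 := by
    rw [him, zero_mul, sub_zero] at h2
    exact (mul_eq_zero.mp h2).resolve_right (by positivity)
  exact hκ (Complex.ext hre him)

theorem conjPoly_X_add_C_pow (w : ℂ) (n : ℕ) :
    conjPoly ((X + C w) ^ n) = (X + C (starRingEnd ℂ w)) ^ n := by
  simp [conjPoly]

theorem natDegree_X_add_C_pow (w : ℂ) (n : ℕ) : ((X + C w) ^ n : ℂ[X]).natDegree = n := by
  rw [natDegree_pow, natDegree_X_add_C, mul_one]

/-- Small real perturbations of `Re (κ (X + w) ^ n)` have only real zeros. -/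
theorem eventually_mem_zerosIn {w : ℂ} (hw : 0 < w.im) {κ : ℂ} (hκ : κ ≠ 0) {n : ℕ} (hn : 0 < n)
    {g : ℂ[X]} (hg : conjPoly g = g) (hdeg : g.natDegree ≤ n) :
    ∀ᶠ ε : ℝ in 𝓝 0, κ • (X + C w) ^ n + conjPoly (κ • (X + C w) ^ n) + (ε : ℂ) • g ∈
      zerosIn realLine := by
  obtain ⟨δ, hδ0, hδpi, hδ⟩ := exists_exp_re_ne_zero hκ
  have hnR : (0 : ℝ) < n := by exact_mod_cast hn
  -- At the point -x_j where w - x_j has argument θ_j, the power (w - x_j)^n has argument δ + jπ, so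
  -- the real part of κ(w - x_j)^n alternates in sign. The shift δ keeps these values away from 0,
  -- and strict alternation at n points survives small perturbations.
  set θ : ℕ → ℝ := fun j => (δ + j * Real.pi) / n with hθ
  have hθ0 : ∀ j, 0 < θ j := fun j => by
    have := Real.pi_pos
    simp only [hθ]
    positivity
  have hθpi : ∀ j < n, θ j < Real.pi := fun j hj => by
    simp only [hθ]
    rw [div_lt_iff₀ hnR]
    have h1 : (j : ℝ) + 1 ≤ n := by exact_mod_cast hj
    nlinarith [Real.pi_pos]
  have hex : ∀ j, ∃ x : ℝ, j < n → angle w x = θ j := fun j => by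
    by_cases hj : j < n
    · obtain ⟨x, hx⟩ := exists_angle_eq hw (hθ0 j) (hθpi j hj)
      exact ⟨x, fun _ => hx⟩
    · exact ⟨0, fun h => absurd h hj⟩
  choose x hx using hex
  set f := κ • (X + C w) ^ n + conjPoly (κ • (X + C w) ^ n) with hf
  set c := (κ * Complex.exp (δ * Complex.I)).re with hc
  have hval : ∀ j < n, 0 < c * (-1) ^ j * (f.eval ((-x j : ℝ) : ℂ)).re := fun j hj => by
    obtain ⟨r, hr, hrw⟩ := sub_eq_mul_exp_angle hw (x j)
    rw [hx j hj] at hrw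
    have h1 : (((-x j : ℝ) : ℂ) + w) ^ n = r ^ n * ((-1) ^ j * Complex.exp (δ * Complex.I)) := by
      have h2 : ((-x j : ℝ) : ℂ) + w = w - x j := by push_cast; ring
      rw [h2, hrw, mul_pow, ← Complex.exp_nat_mul]
      congr 1
      have h3 : (n : ℂ) * ((θ j : ℝ) * Complex.I) = j * (Real.pi * Complex.I) + δ * Complex.I := by
        simp only [hθ]
        have : (n : ℂ) ≠ 0 := by exact_mod_cast hn.ne'
        push_cast
        field_simp
        ring
      rw [h3, Complex.exp_add, Complex.exp_nat_mul, Complex.exp_pi_mul_I]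
    have h4 : f.eval ((-x j : ℝ) : ℂ) = ((2 * (r ^ n * (-1) ^ j * c) : ℝ) : ℂ) := by
      have h5 : κ * (((-x j : ℝ) : ℂ) + w) ^ n =
          ((r ^ n * (-1) ^ j : ℝ) : ℂ) * (κ * Complex.exp (δ * Complex.I)) := by
        rw [h1]; push_cast; ring
      rw [hf, eval_add, eval_conjPoly, Complex.conj_ofReal, eval_smul, eval_pow, eval_add, eval_X,
        eval_C, smul_eq_mul, h5, Complex.add_conj, Complex.re_ofReal_mul]
    rw [h4, Complex.ofReal_re]
    have h6 : c * (-1) ^ j * (2 * (r ^ n * (-1) ^ j * c)) = 2 * r ^ n * c ^ 2 * ((-1) ^ j) ^ 2 := by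
      ring
    rw [h6, ← pow_mul, mul_comm j 2, pow_mul]
    norm_num
    positivity
  have hev : ∀ᶠ ε : ℝ in 𝓝 0, ∀ j ∈ Finset.range n,
      0 < c * (-1) ^ j * ((f + (ε : ℂ) • g).eval ((-x j : ℝ) : ℂ)).re := by
    rw [Filter.eventually_all_finset]
    intro j hj
    have h1 : Tendsto (fun ε : ℝ => c * (-1) ^ j * ((f + (ε : ℂ) • g).eval ((-x j : ℝ) : ℂ)).re)
        (𝓝 0) (𝓝 (c * (-1) ^ j * ((f + ((0 : ℝ) : ℂ) • g).eval ((-x j : ℝ) : ℂ)).re)) := by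
      simp only [eval_add, eval_smul, smul_eq_mul]
      refine Continuous.tendsto (f := fun ε : ℝ => c * (-1) ^ j *
        (f.eval ((-x j : ℝ) : ℂ) + (ε : ℂ) * g.eval ((-x j : ℝ) : ℂ)).re) ?_ 0
      fun_prop
    rw [Complex.ofReal_zero, zero_smul, add_zero] at h1
    exact h1.eventually_const_lt (hval j (Finset.mem_range.mp hj))
  filter_upwards [hev] with ε hε
  refine mem_zerosIn_of_alternating ?_ hn ?_ (x := fun j => -x j) ?_
    (fun j hj => hε j (Finset.mem_range.mpr hj))
  · rw [conjPoly_add, conjPoly_smul, hg, Complex.conj_ofReal, hf, conjPoly_add, conjPoly_conjPoly,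
      add_comm (conjPoly _)]
  · refine (natDegree_add_le _ _).trans (max_le ?_ ((natDegree_smul_le _ _).trans hdeg))
    have h1 : (κ • (X + C w) ^ n : ℂ[X]).natDegree ≤ n :=
      (natDegree_smul_le _ _).trans (natDegree_X_add_C_pow w n).le
    exact (natDegree_add_le _ _).trans (max_le h1 (by rwa [natDegree_conjPoly]))
  · intro i j hij hj
    have h1 : θ i < θ j := by
      simp only [hθ]
      have : (i : ℝ) < j := by exact_mod_cast hij
      have := Real.pi_pos
      gcongr
    rw [← hx i (by omega), ← hx j hj] at h1
    exact neg_lt_neg ((strictMono_angle hw).lt_iff_lt.mp h1)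

/-! ### The dichotomy for real preservers -/

/-- `T` maps every real polynomial of degree at most `n` to a real-rooted polynomial or zero. -/
def MapsRealToRealRooted (T : ℂ[X] →ₗ[ℂ] ℂ[X]) (n : ℕ) : Prop :=
  ∀ g : ℂ[X], conjPoly g = g → g.natDegree ≤ n → T g ∈ zerosIn realLine ∪ {0}

theorem MapsRealToRealRooted.mono {T : ℂ[X] →ₗ[ℂ] ℂ[X]} {m n : ℕ}
    (h : MapsRealToRealRooted T n) (hmn : m ≤ n) : MapsRealToRealRooted T m :=
  fun g hg hd => h g hg (hd.trans hmn)

/-- The annihilated polynomial f has room for perturbation: f + εg has only real zeros for small ε,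
and its image is ε T(g). -/
theorem mapsRealToRealRooted_of_map_eq_zero {T : ℂ[X] →ₗ[ℂ] ℂ[X]} (hT : Preserves realLine T)
    {n : ℕ} (hn : 0 < n) {w : ℂ} (hw : 0 < w.im) {κ : ℂ} (hκ : κ ≠ 0)
    (h0 : T (κ • (X + C w) ^ n + conjPoly (κ • (X + C w) ^ n)) = 0) :
    MapsRealToRealRooted T n := by
  intro g hg hdeg
  have h1 := (eventually_mem_zerosIn hw hκ hn hg hdeg).filter_mono
    (nhdsWithin_le_nhds (s := Set.Ioi 0))
  obtain ⟨ε, hε, hpos⟩ := (h1.and self_mem_nhdsWithin).exists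
  have hε0 : (ε : ℂ) ≠ 0 := by exact_mod_cast (show (0 : ℝ) < ε from hpos).ne'
  have h2 := hT _ hε
  rw [map_add, h0, zero_add, map_smul] at h2
  have h3 : T g = (ε : ℂ)⁻¹ • ((ε : ℂ) • T g) := by rw [smul_smul, inv_mul_cancel₀ hε0, one_smul]
  rw [h3]
  rcases h2 with h2 | h2
  · exact smul_mem_zerosIn_union_zero h2 _
  · right
    rw [Set.mem_singleton_iff.mp h2, smul_zero]
    rfl

theorem exists_mul_add_conj_mul_eq_zero {α β : ℂ} (h : ‖α‖ = ‖β‖) :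
    ∃ κ : ℂ, κ ≠ 0 ∧ κ * α + starRingEnd ℂ κ * β = 0 := by
  rcases eq_or_ne β 0 with rfl | hβ
  · rw [norm_zero, norm_eq_zero] at h
    exact ⟨1, one_ne_zero, by simp [h]⟩
  have hα : α ≠ 0 := by rw [← norm_ne_zero_iff, h]; exact norm_ne_zero_iff.mpr hβ
  have hc : starRingEnd ℂ (-β / α) * (-β / α) = 1 := by
    rw [← Complex.normSq_eq_conj_mul_self, Complex.normSq_eq_norm_sq, norm_div, norm_neg, h,
      div_self (norm_ne_zero_iff.mpr hβ)]
    norm_num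
  obtain ⟨κ, hκ, hκc⟩ := exists_sq_mul_eq_one hc
  refine ⟨κ, hκ, ?_⟩
  field_simp at hκc
  linear_combination -hκc

theorem continuous_eval_pow (T : ℂ[X] →ₗ[ℂ] ℂ[X]) (n : ℕ) :
    Continuous fun p : ℂ × ℂ => (T ((X + C p.2) ^ n)).eval p.1 := by
  have h : ∀ p : ℂ × ℂ, (T ((X + C p.2) ^ n)).eval p.1 =
      ∑ k ∈ Finset.range (n + 1),
        ((n.choose k : ℂ) * (T (X ^ k)).eval p.1) * p.2 ^ (n - k) := fun p => by
    rw [← evalAt_apply, ← eval_symbolPoly, symbolPoly, eval_finsetSum]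
    simp [eval_monomial]
  simp_rw [h]
  refine continuous_finsetSum _ fun k _ => ?_
  exact (continuous_const.mul ((T (X ^ k)).continuous.comp continuous_fst)).mul
    (continuous_snd.pow _)

/-- Equality |E(z, w)| = |E(z, conj w)| with z, w in H would give κ ≠ 0 for which the image of κ(X +
w)^n plus its conjugate vanishes at z. That image is real-rooted or zero, hence zero, against the
hypothesis. So the difference of moduli has constant sign on H × H; the larger term has no zeros
there, and conjugation gives the other half of the stability region. -/
theorem symbolStable_of_not_mapsRealToRealRooted {T : ℂ[X] →ₗ[ℂ] ℂ[X]}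
    (hT : Preserves realLine T) (hreal : ∀ f, conjPoly (T f) = T (conjPoly f)) {n : ℕ} (hn : 0 < n)
    (hnot : ¬ MapsRealToRealRooted T n) : SymbolStable 1 T n ∨ SymbolStable (-1) T n := by
  set E : ℂ → ℂ → ℂ := fun z w => (T ((X + C w) ^ n)).eval z with hE
  have hconj : ∀ z w, E (starRingEnd ℂ z) (starRingEnd ℂ w) = starRingEnd ℂ (E z w) := fun z w => by
    simp only [hE]
    rw [← conjPoly_X_add_C_pow, ← hreal, eval_conjPoly, Complex.conj_conj]
  have hne : ∀ z w : ℂ, 0 < z.im → 0 < w.im → ‖E z w‖ ≠ ‖E z (starRingEnd ℂ w)‖ := by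
    intro z w hz hw h
    obtain ⟨κ, hκ, hκ0⟩ := exists_mul_add_conj_mul_eq_zero h
    refine hnot (mapsRealToRealRooted_of_map_eq_zero hT hn hw hκ ?_)
    have h1 := eventually_mem_zerosIn hw hκ hn (g := 0) (by simp [conjPoly]) (by simp)
    have h2 := hT _ h1.self_of_nhds
    rw [smul_zero, add_zero] at h2
    refine h2.resolve_left fun h3 => ?_
    have h4 : (T (κ • (X + C w) ^ n + conjPoly (κ • (X + C w) ^ n))).eval z = 0 := by
      rw [conjPoly_smul, conjPoly_X_add_C_pow, map_add, map_smul, map_smul, eval_add, eval_smul,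
        eval_smul, smul_eq_mul, smul_eq_mul]
      exact hκ0
    exact hz.ne' (h3.2 z h4)
  set D : ℂ × ℂ → ℝ := fun p => ‖E p.1 p.2‖ - ‖E p.1 (starRingEnd ℂ p.2)‖ with hD
  have hDc : Continuous D := by
    have h1 := continuous_eval_pow T n
    have h2 : Continuous fun p : ℂ × ℂ => E p.1 (starRingEnd ℂ p.2) :=
      h1.comp (continuous_fst.prodMk (Complex.continuous_conj.comp continuous_snd))
    exact h1.norm.sub h2.norm
  have hpre : IsPreconnected ({z : ℂ | 0 < z.im} ×ˢ {w : ℂ | 0 < w.im}) :=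
    (convex_halfSpace_im_gt 0).isPreconnected.prod (convex_halfSpace_im_gt 0).isPreconnected
  have hI : (Complex.I, Complex.I) ∈ {z : ℂ | 0 < z.im} ×ˢ {w : ℂ | 0 < w.im} := by
    constructor <;> simp
  have hD0 : ∀ p ∈ {z : ℂ | 0 < z.im} ×ˢ {w : ℂ | 0 < w.im}, D p ≠ 0 := fun p hp =>
    sub_ne_zero.mpr (hne p.1 p.2 hp.1 hp.2)
  rcases lt_or_gt_of_ne (hD0 _ hI) with hneg | hpos
  · right
    have hall : ∀ z w : ℂ, 0 < z.im → 0 < w.im → E z (starRingEnd ℂ w) ≠ 0 := by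
      intro z w hz hw h0
      have h1 : 0 ≤ D (z, w) := by simp [hD, h0]
      obtain ⟨p, hp, hp0⟩ := hpre.intermediate_value hI (show (z, w) ∈ _ from ⟨hz, hw⟩)
        hDc.continuousOn ⟨hneg.le, h1⟩
      exact hD0 p hp hp0
    intro z w hzw
    rcases lt_trichotomy z.im 0 with hz | hz | hz
    · have hw : 0 < w.im := by nlinarith
      have := hall (starRingEnd ℂ z) w (by simpa using hz) hw
      rw [hconj, _root_.map_ne_zero] at this
      exact this
    · simp [hz] at hzw
    · have hw : w.im < 0 := by nlinarith
      have := hall z (starRingEnd ℂ w) hz (by simpa using hw)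
      rwa [Complex.conj_conj] at this
  · left
    have hall : ∀ z w : ℂ, 0 < z.im → 0 < w.im → E z w ≠ 0 := by
      intro z w hz hw h0
      have h1 : D (z, w) ≤ 0 := by simp [hD, h0]
      obtain ⟨p, hp, hp0⟩ := hpre.intermediate_value (show (z, w) ∈ _ from ⟨hz, hw⟩) hI
        hDc.continuousOn ⟨h1, hpos.le⟩
      exact hD0 p hp hp0
    intro z w hzw
    rcases lt_trichotomy z.im 0 with hz | hz | hz
    · have hw : w.im < 0 := by nlinarith
      have := hall (starRingEnd ℂ z) (starRingEnd ℂ w) (by simpa using hz) (by simpa using hw)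
      rw [hconj, _root_.map_ne_zero] at this
      exact this
    · simp [hz] at hzw
    · exact hall z w hz (by nlinarith)

/-! ### Descending the degree in the stability condition -/

/-- For fixed z the w-zeros of the symbol of degree n + 1 lie in a closed half-plane, and by
Gauss–Lucas so do those of its derivative, which is the symbol of degree n up to a constant, unless
the derivative vanishes identically. -/
theorem symbolStable_of_succ {e : ℝ} {T : ℂ[X] →ₗ[ℂ] ℂ[X]} (hT : Preserves realLine T) {n : ℕ}
    (h : (∀ w : ℂ, T ((X + C w) ^ (n + 1)) = 0) ∨ SymbolStable e T (n + 1)) :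
    (∀ w : ℂ, T ((X + C w) ^ n) = 0) ∨ SymbolStable e T n := by
  rcases h with h | h
  · left
    intro w
    exact map_eq_zero_of_pow_eq_zero Set.infinite_univ (fun w _ => h w)
      (by rw [natDegree_X_add_C_pow]; omega)
  by_contra! hc
  obtain ⟨⟨w₁, hw₁⟩, hst⟩ := hc
  simp only [SymbolStable, not_forall] at hst
  obtain ⟨z₀, w₀, hzw, h0⟩ := hst
  rw [not_not] at h0
  have hz₀ : z₀.im ≠ 0 := by rintro hz; simp [hz] at hzw
  set q := symbolPoly (evalAt T z₀) (n + 1) with hq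
  have hder : (derivative q).eval w₀ = 0 := by
    rw [hq, derivative_symbolPoly, eval_mul, eval_symbolPoly, evalAt_apply, h0, mul_zero]
  have hder0 : derivative q = 0 := by
    by_contra hne
    have hdeg : 0 < q.degree := by
      rw [← natDegree_pos_iff_degree_pos, Nat.pos_iff_ne_zero]
      intro h1
      exact hne (derivative_of_natDegree_zero h1)
    have hmem : w₀ ∈ convexHull ℝ (q.rootSet ℂ) :=
      rootSet_derivative_subset_convexHull_rootSet hdeg (by
        rw [mem_rootSet]
        exact ⟨hne, by rwa [coe_aeval_eq_eval]⟩)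
    have hconv : Convex ℝ {w : ℂ | e * z₀.im * w.im ≤ 0} := by
      have : IsLinearMap ℝ fun w : ℂ => e * z₀.im * w.im :=
        { map_add := fun x y => by simp [mul_add]
          map_smul := fun c x => by simp; ring }
      exact convex_halfSpace_le this 0
    have hsub : q.rootSet ℂ ⊆ {w : ℂ | e * z₀.im * w.im ≤ 0} := by
      intro w hw
      rw [mem_rootSet, coe_aeval_eq_eval] at hw
      by_contra hlt
      refine h z₀ w (not_le.mp hlt) ?_
      have := hw.2
      rwa [hq, eval_symbolPoly] at this
    exact absurd (convexHull_min hsub hconv hmem) (not_le.mpr hzw)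
  have hsym : symbolPoly (evalAt T z₀) n = 0 := by
    rw [hq, derivative_symbolPoly] at hder0
    refine (mul_eq_zero.mp hder0).resolve_left ?_
    refine C_ne_zero.mpr ?_
    exact_mod_cast (Nat.succ_ne_zero n)
  -- In the degenerate case all images of degree-n inputs vanish at the nonreal point z₀; images of
  -- members of π(ℝ) cannot do so without being zero, and density extends this to all polynomials of
  -- degree at most n.
  have hkill : ∀ f : ℂ[X], f.natDegree ≤ n → T f = 0 := by
    intro f hf
    ext k
    rw [coeff_zero]
    refine (PolyOnLines.of_linear ((lcoeff ℂ k).comp T)).eq_zero infinite_realLine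
      (fun g hg hgn => ?_) hf
    have h1 : (T g).eval z₀ = 0 := eq_zero_of_symbolPoly_eq_zero hsym hgn.le
    rcases hT g hg with h2 | h2
    · exact absurd (h2.2 z₀ h1) hz₀
    · rw [LinearMap.comp_apply, Set.mem_singleton_iff.mp h2, map_zero]
  exact hw₁ (hkill _ (natDegree_X_add_C_pow w₁ n).le)

theorem symbolStable_of_le {e : ℝ} {T : ℂ[X] →ₗ[ℂ] ℂ[X]} (hT : Preserves realLine T) {m n : ℕ}
    (hmn : m ≤ n) (h : SymbolStable e T n) :
    (∀ w : ℂ, T ((X + C w) ^ m) = 0) ∨ SymbolStable e T m := by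
  have key : (∀ w : ℂ, T ((X + C w) ^ n) = 0) ∨ SymbolStable e T n := Or.inr h
  clear h
  induction hmn with
  | refl => exact key
  | step _ ih => exact ih (symbolStable_of_succ hT key)

/-! ### Preservers of rank two -/

theorem exists_real_parts (f : ℂ[X]) :
    ∃ g h : ℂ[X], conjPoly g = g ∧ conjPoly h = h ∧ f = g + Complex.I • h := by
  refine ⟨(1 / 2 : ℂ) • (f + conjPoly f), (-Complex.I / 2) • (f + (-1 : ℂ) • conjPoly f),
    ?_, ?_, ?_⟩
  · simp only [conjPoly_smul, conjPoly_add, conjPoly_conjPoly]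
    have h1 : starRingEnd ℂ (1 / 2) = 1 / 2 := by
      rw [map_div₀, map_one, map_ofNat]
    rw [h1, add_comm]
  · simp only [conjPoly_smul, conjPoly_add, conjPoly_conjPoly]
    have h1 : starRingEnd ℂ (-Complex.I / 2) = Complex.I / 2 := by
      rw [map_div₀, map_neg, Complex.conj_I, neg_neg, map_ofNat]
    have h2 : starRingEnd ℂ (-1 : ℂ) = -1 := by simp
    rw [h1, h2]
    module
  · rw [smul_smul]
    have : Complex.I * (-Complex.I / 2) = 1 / 2 := by
      linear_combination (-1 / 2) * Complex.I_mul_I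
    rw [this]
    module

theorem exists_map_eq_of_real {f : ℂ[X]} (hf : conjPoly f = f) :
    ∃ P : ℝ[X], P.map (algebraMap ℝ ℂ) = f := by
  have : f ∈ lifts (algebraMap ℝ ℂ) := by
    rw [lifts_iff_coeff_lifts]
    intro k
    have h := coeff_conjPoly f k
    rw [hf] at h
    exact ⟨(f.coeff k).re, Complex.conj_eq_iff_re.mp h.symm⟩
  exact (mem_lifts f).mp this

theorem exists_real_combination {u v w : ℂ}
    (h : ∀ s t : ℝ, (s : ℂ) * v + t * w = 0 → s = 0 ∧ t = 0) :
    ∃ s t : ℝ, u = s * v + t * w := by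
  -- Cramer's rule in ℂ = ℝ²: d is the determinant of v and w.
  set d := v.re * w.im - v.im * w.re with hd
  have hd0 : d ≠ 0 := by
    intro hd0
    have h1 := h w.im (-v.im) (Complex.ext (by simp; linarith) (by simp; ring))
    have h2 := h w.re (-v.re) (Complex.ext (by simp; ring) (by simp; linarith))
    have hw : w = 0 := Complex.ext h2.1 h1.1
    have := h 0 1 (by simp [hw])
    exact one_ne_zero this.2
  refine ⟨(u.re * w.im - u.im * w.re) / d, (v.re * u.im - v.im * u.re) / d, ?_⟩
  apply Complex.ext
  · simp only [Complex.add_re, Complex.mul_re, Complex.ofReal_re, Complex.ofReal_im, zero_mul,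
      sub_zero]
    field_simp
    rw [hd]; ring
  · simp only [Complex.add_im, Complex.mul_im, Complex.ofReal_re, Complex.ofReal_im, zero_mul,
      add_zero]
    field_simp
    rw [hd]; ring

/-- `T f = α(f) P + β(f) Q` with real functionals and hyperbolic polynomials whose zeros
interlace. -/
def IsRealCombination (T : ℂ[X] →ₗ[ℂ] ℂ[X]) : Prop :=
  ∃ (α β : ℂ[X] →ₗ[ℂ] ℂ) (P Q : ℝ[X]), IsHyperbolic P ∧ IsHyperbolic Q ∧ Interlacing P Q ∧
    (∀ f, conjPoly f = f → (α f).im = 0 ∧ (β f).im = 0) ∧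
    ∀ f, T f = α f • P.map (algebraMap ℝ ℂ) + β f • Q.map (algebraMap ℝ ℂ)

theorem isHyperbolic_of_map_mem_zerosIn {P : ℝ[X]}
    (h : P.map (algebraMap ℝ ℂ) ∈ zerosIn realLine) : IsHyperbolic P := by
  refine ⟨fun h0 => h.1 (by rw [h0, Polynomial.map_zero]), fun z hz => h.2 z ?_⟩
  change eval _ _ = 0
  rwa [eval_map_algebraMap]

/-- A real-rooted polynomial does not vanish at i, so evaluation at i is injective on T(ℝ[z]), which
therefore has real dimension at most two. Its real combinations have no nonreal zeros unless they
vanish, and this is exactly the criterion for interlacing. -/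
theorem isRealCombination_of_mapsRealToRealRooted {T : ℂ[X] →ₗ[ℂ] ℂ[X]}
    (hreal : ∀ f, conjPoly (T f) = T (conjPoly f)) (h : ∀ n, MapsRealToRealRooted T n) {x y : ℂ[X]}
    (hxy : LinearIndependent ℂ ![T x, T y]) : IsRealCombination T := by
  have hroot : ∀ g, conjPoly g = g → ∀ z : ℂ, z.im ≠ 0 → (T g).eval z = 0 → T g = 0 :=
    fun g hg z hz h0 => by
      rcases h g.natDegree g hg le_rfl with h1 | h1
      · exact absurd (h1.2 z h0) hz
      · exact h1
  obtain ⟨a, b, ha, hb, hab⟩ : ∃ a b, conjPoly a = a ∧ conjPoly b = b ∧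
      LinearIndependent ℂ ![T a, T b] := by
    by_contra! hc
    have hx0 : T x ≠ 0 := by simpa using hxy.ne_zero 0
    obtain ⟨a, ha, ha0⟩ : ∃ a, conjPoly a = a ∧ T a ≠ 0 := by
      by_contra! h0
      obtain ⟨g, k, hg, hk, rfl⟩ := exists_real_parts x
      exact hx0 (by rw [map_add, map_smul, h0 g hg, h0 k hk, smul_zero, add_zero])
    have hmul : ∀ f, ∃ s : ℂ, T f = s • T a := fun f => by
      obtain ⟨g, k, hg, hk, rfl⟩ := exists_real_parts f
      have h1 := hc a g ha hg
      have h2 := hc a k ha hk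
      rw [LinearIndependent.pair_iff' ha0] at h1 h2
      push Not at h1 h2
      obtain ⟨s, hs⟩ := h1
      obtain ⟨t, ht⟩ := h2
      exact ⟨s + Complex.I * t, by rw [map_add, map_smul, ← hs, ← ht]; module⟩
    obtain ⟨s, hs⟩ := hmul x
    obtain ⟨t, ht⟩ := hmul y
    rw [LinearIndependent.pair_iff] at hxy
    have := hxy t (-s) (by rw [hs, ht]; module)
    rw [hs, neg_eq_zero.mp this.2, zero_smul] at hx0
    exact hx0 rfl
  have hTreal : ∀ g, conjPoly g = g → conjPoly (T g) = T g := fun g hg => by rw [hreal, hg]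
  obtain ⟨P, hP⟩ := exists_map_eq_of_real (hTreal a ha)
  obtain ⟨Q, hQ⟩ := exists_map_eq_of_real (hTreal b hb)
  have hPh : IsHyperbolic P := by
    refine isHyperbolic_of_map_mem_zerosIn ?_
    rw [hP]
    exact (h _ a ha le_rfl).resolve_right (by simpa using hab.ne_zero 0)
  have hQh : IsHyperbolic Q := by
    refine isHyperbolic_of_map_mem_zerosIn ?_
    rw [hQ]
    exact (h _ b hb le_rfl).resolve_right (by simpa using hab.ne_zero 1)
  have hpair := LinearIndependent.pair_iff.mp hab
  have hcomb : ∀ (s t : ℝ) (z : ℂ), z.im ≠ 0 → (s : ℂ) * aeval z P + t * aeval z Q = 0 →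
      s = 0 ∧ t = 0 := fun s t z hz h0 => by
    have h1 : T ((s : ℂ) • a + (t : ℂ) • b) = 0 := by
      refine hroot _ ?_ z hz ?_
      · rw [conjPoly_add, conjPoly_smul, conjPoly_smul, ha, hb, Complex.conj_ofReal,
          Complex.conj_ofReal]
      · rw [map_add, map_smul, map_smul, ← hP, ← hQ, eval_add, eval_smul, eval_smul,
          eval_map_algebraMap, eval_map_algebraMap]
        exact h0
    rw [map_add, map_smul, map_smul] at h1
    have := hpair _ _ h1
    exact ⟨by exact_mod_cast this.1, by exact_mod_cast this.2⟩
  have hspan : ∀ g, conjPoly g = g → ∃ s t : ℝ, T g = (s : ℂ) • T a + (t : ℂ) • T b :=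
    fun g hg => by
      obtain ⟨s, t, hst⟩ := exists_real_combination (u := (T g).eval Complex.I)
        (fun s t => hcomb s t Complex.I (by simp))
      refine ⟨s, t, ?_⟩
      have h1 : T (g + (((-s : ℝ) : ℂ) • a + ((-t : ℝ) : ℂ) • b)) = 0 := by
        refine hroot _ ?_ Complex.I (by simp) ?_
        · simp only [conjPoly_add, conjPoly_smul, ha, hb, hg, Complex.conj_ofReal]
        · rw [map_add, map_add, map_smul, map_smul, ← hP, ← hQ, eval_add, eval_add, eval_smul,
            eval_smul, eval_map_algebraMap, eval_map_algebraMap, hst]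
          simp only [smul_eq_mul]
          push_cast
          ring
      rw [map_add, map_add, map_smul, map_smul] at h1
      push_cast at h1
      rw [eq_neg_of_add_eq_zero_left h1]
      module
  have hmem : ∀ f, T f ∈ Submodule.span ℂ (Set.range ![T a, T b]) := fun f => by
    obtain ⟨g, k, hg, hk, rfl⟩ := exists_real_parts f
    obtain ⟨s, t, hst⟩ := hspan g hg
    obtain ⟨s', t', hst'⟩ := hspan k hk
    rw [map_add, map_smul, hst, hst', Matrix.range_cons, Matrix.range_cons, Matrix.range_empty,
      Set.union_empty, Set.singleton_union, Submodule.mem_span_pair]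
    exact ⟨s + Complex.I * s', t + Complex.I * t', by module⟩
  set R : ℂ[X] →ₗ[ℂ] (Fin 2 →₀ ℂ) :=
    LinearMap.comp hab.repr (T.codRestrict (Submodule.span ℂ (Set.range ![T a, T b])) hmem)
    with hR
  have hTR : ∀ f, T f = R f 0 • T a + R f 1 • T b := fun f => by
    have h1 := hab.linearCombination_repr ⟨T f, hmem f⟩
    rw [Finsupp.linearCombination_apply, Finsupp.sum_fintype _ _ (by simp),
      Fin.sum_univ_two] at h1
    exact h1.symm
  refine ⟨(Finsupp.lapply 0).comp R, (Finsupp.lapply 1).comp R, P, Q, hPh, hQh,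
    interlacing_of_forall_combination hPh hQh fun s t z hz h0 => (hcomb s t z hz.ne' h0).1,
    fun g hg => ?_, fun f => ?_⟩
  · obtain ⟨s, t, hst⟩ := hspan g hg
    have h1 := hTR g
    rw [hst] at h1
    have h2 := hpair (R g 0 - s) (R g 1 - t) (by
      rw [sub_smul, sub_smul, sub_add_sub_comm, ← h1, sub_self])
    have h3 : R g 0 = s := sub_eq_zero.mp h2.1
    have h4 : R g 1 = t := sub_eq_zero.mp h2.2
    constructor
    · rw [LinearMap.comp_apply, Finsupp.lapply_apply, h3, Complex.ofReal_im]
    · rw [LinearMap.comp_apply, Finsupp.lapply_apply, h4, Complex.ofReal_im]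
  · rw [hP, hQ]
    exact hTR f

theorem preserves_smul {S : Set ℂ} {T : ℂ[X] →ₗ[ℂ] ℂ[X]} (hT : Preserves S T) (κ : ℂ) :
    Preserves S (κ • T) := fun f hf => by
  rw [LinearMap.smul_apply]
  rcases hT f hf with h | h
  · exact smul_mem_zerosIn_union_zero h κ
  · right
    rw [Set.mem_singleton_iff.mp h, smul_zero]
    rfl

/-- If sending real polynomials to real-rooted ones fails in some degree, it fails in all larger
ones, and each of these is stable with some sign. One sign occurs in arbitrarily large degrees, and
stability with that sign descends. -/
theorem exists_smul_isRealCombination_or_symbolStable {T : ℂ[X] →ₗ[ℂ] ℂ[X]}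
    (hT : Preserves realLine T) {x y : ℂ[X]} (hxy : LinearIndependent ℂ ![T x, T y]) :
    (∃ κ : ℂ, κ ≠ 0 ∧ IsRealCombination (κ • T)) ∨
      (∀ n, (∀ w : ℂ, T ((X + C w) ^ n) = 0) ∨ SymbolStable 1 T n) ∨
      ∀ n, (∀ w : ℂ, T ((X + C w) ^ n) = 0) ∨ SymbolStable (-1) T n := by
  obtain ⟨κ, hκ, hreal⟩ := exists_smul_real hT hxy
  have hT' := preserves_smul hT κ
  have hxy' : LinearIndependent ℂ ![(κ • T) x, (κ • T) y] := by
    rw [LinearIndependent.pair_iff] at hxy ⊢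
    intro s t hst
    have := hxy (s * κ) (t * κ) (by rw [mul_smul, mul_smul]; exact hst)
    exact ⟨(mul_eq_zero.mp this.1).resolve_right hκ, (mul_eq_zero.mp this.2).resolve_right hκ⟩
  by_cases hall : ∀ n, MapsRealToRealRooted (κ • T) n
  · left
    exact ⟨κ, hκ, isRealCombination_of_mapsRealToRealRooted hreal hall hxy'⟩
  right
  push Not at hall
  obtain ⟨n₀, hn₀⟩ := hall
  have hst : ∀ n, n₀ + 1 ≤ n → SymbolStable 1 T n ∨ SymbolStable (-1) T n := fun n hn => by
    have h1 := symbolStable_of_not_mapsRealToRealRooted hT' hreal (n := n) (by omega)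
      fun h => hn₀ (h.mono (by omega))
    have h2 : ∀ e, SymbolStable e (κ • T) n → SymbolStable e T n := fun e h z w hzw h0 =>
      h z w hzw (by rw [LinearMap.smul_apply, eval_smul, h0, smul_zero])
    exact h1.imp (h2 1) (h2 (-1))
  by_cases hfreq : ∀ m, ∃ n, m ≤ n ∧ SymbolStable 1 T n
  · left
    intro m
    obtain ⟨n, hmn, hn⟩ := hfreq m
    exact symbolStable_of_le hT hmn hn
  · right
    push Not at hfreq
    obtain ⟨m₀, hm₀⟩ := hfreq
    intro m
    have h1 := (hst (max (n₀ + 1) (max m m₀)) (le_max_left _ _)).resolve_left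
      (hm₀ _ ((le_max_right _ _).trans (le_max_right _ _)))
    exact symbolStable_of_le hT ((le_max_left _ _).trans (le_max_right _ _)) h1

/-! ### Divisibility from bounds -/

/-- The bound extends to the closure of U, so Q vanishes at any root of P; the common linear factor
cancels from the bound on U, where P has no zeros. -/
theorem dvd_of_norm_eval_le {U : Set ℂ} {c : ℝ} (N : ℕ) : ∀ P Q : ℂ[X], P.natDegree = N →
    P ≠ 0 → (∀ z, P.IsRoot z → z ∈ closure U) → (∀ z ∈ U, P.eval z ≠ 0) →
    (∀ z ∈ U, ‖Q.eval z‖ ≤ c * ‖P.eval z‖) → P ∣ Q := by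
  induction N with
  | zero =>
    intro P Q hN hP _ _ _
    rw [eq_C_of_natDegree_eq_zero hN]
    have : P.coeff 0 ≠ 0 := by
      intro h0
      rw [eq_C_of_natDegree_eq_zero hN, h0, C_0] at hP
      exact hP rfl
    exact (isUnit_C.mpr this.isUnit).dvd
  | succ N ih =>
    intro P Q hN hP hroot hU hb
    obtain ⟨ξ, hξ⟩ := IsAlgClosed.exists_root P (by
      intro h0
      have := natDegree_eq_of_degree_eq_some (n := 0) h0
      omega)
    have hclosed : IsClosed {z : ℂ | ‖Q.eval z‖ ≤ c * ‖P.eval z‖} :=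
      isClosed_le Q.continuous.norm (P.continuous.norm.const_mul c)
    have hξQ : ‖Q.eval ξ‖ ≤ c * ‖P.eval ξ‖ := closure_minimal hb hclosed (hroot ξ hξ)
    rw [hξ, norm_zero, mul_zero] at hξQ
    obtain ⟨P₁, rfl⟩ := dvd_iff_isRoot.mpr hξ
    obtain ⟨Q₁, rfl⟩ := dvd_iff_isRoot.mpr (norm_le_zero_iff.mp hξQ)
    have hP₁ : P₁ ≠ 0 := right_ne_zero_of_mul hP
    refine mul_dvd_mul_left _ (ih P₁ Q₁ ?_ hP₁ (fun z hz => hroot z (root_mul.mpr (Or.inr hz)))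
      (fun z hz h0 => hU z hz (by rw [eval_mul, h0, mul_zero])) fun z hz => ?_)
    · rw [natDegree_mul (X_sub_C_ne_zero ξ) hP₁, natDegree_X_sub_C] at hN
      omega
    · have h1 := hb z hz
      have h2 : (X - C ξ : ℂ[X]).eval z ≠ 0 := fun h0 => hU z hz (by rw [eval_mul, h0, zero_mul])
      rw [eval_mul, eval_mul, norm_mul, norm_mul, mul_left_comm] at h1
      exact le_of_mul_le_mul_left h1 (norm_pos_iff.mpr h2)

/-- The unit circle in `ℂ`. -/
def unitCircle : Set ℂ := {z | ‖z‖ = 1}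

theorem unitCircle_eq_sphere : unitCircle = Metric.sphere 0 1 := by
  ext z; simp [unitCircle]

theorem infinite_unitCircle : unitCircle.Infinite := by
  have h : (Set.Icc (0 : ℝ) 1).Infinite := Set.Icc_infinite one_pos
  refine Set.infinite_of_injOn_mapsTo (f := fun t : ℝ => Complex.exp (t * Complex.I)) ?_ ?_ h
  · intro s hs t ht hst
    have h1 := congrArg Complex.arg hst
    have hpi := Real.pi_gt_three
    simp only [Complex.arg_exp_mul_I] at h1
    rwa [(toIocMod_eq_self Real.two_pi_pos).mpr ⟨by linarith [hs.1], by linarith [hs.2]⟩,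
      (toIocMod_eq_self Real.two_pi_pos).mpr ⟨by linarith [ht.1], by linarith [ht.2]⟩] at h1
  · intro t _
    exact Complex.norm_exp_ofReal_mul_I t

theorem mem_closure_disk {z : ℂ} (hz : z ∈ unitCircle) : z ∈ closure {z : ℂ | ‖z‖ < 1} := by
  have : {z : ℂ | ‖z‖ < 1} = Metric.ball 0 1 := by ext; simp
  rw [this, closure_ball _ one_ne_zero]
  have hz' : ‖z‖ = 1 := hz
  simp [hz']

theorem mem_closure_exterior {z : ℂ} (hz : z ∈ unitCircle) : z ∈ closure {z : ℂ | 1 < ‖z‖} := by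
  have : {z : ℂ | 1 < ‖z‖} = (Metric.closedBall 0 1)ᶜ := by ext; simp
  rw [this, closure_compl, interior_closedBall _ one_ne_zero]
  have hz' : ‖z‖ = 1 := hz
  simp [hz']

theorem norm_multiset_prod_le {B : ℝ} (m : Multiset ℂ) (h : ∀ r ∈ m, ‖r‖ ≤ B) :
    ‖m.prod‖ ≤ B ^ m.card := by
  induction m using Multiset.induction_on with
  | empty => simp
  | cons a m ih =>
    have h1 := ih fun r hr => h r (Multiset.mem_cons_of_mem hr)
    have h2 := h a (Multiset.mem_cons_self a m)
    rw [Multiset.prod_cons, Multiset.card_cons, norm_mul, pow_succ']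
    gcongr
    exact (norm_nonneg a).trans h2

theorem norm_coeff_zero_le {p : ℂ[X]} {B : ℝ} (h : ∀ r, p.eval r = 0 → ‖r‖ ≤ B) :
    ‖p.coeff 0‖ ≤ ‖p.leadingCoeff‖ * B ^ p.natDegree := by
  have hs := IsAlgClosed.splits p
  rw [hs.coeff_zero_eq_leadingCoeff_mul_prod_roots, norm_mul, norm_mul, norm_pow, norm_neg,
    norm_one, one_pow, one_mul]
  gcongr
  rw [hs.natDegree_eq_card_roots]
  exact norm_multiset_prod_le _ fun r hr => h r (isRoot_of_mem_roots hr)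

theorem natDegree_eq_zero_of_norm_eval_le {u : ℂ[X]} {c : ℝ}
    (h : ∀ z : ℂ, 1 < ‖z‖ → ‖u.eval z‖ ≤ c) : u.natDegree = 0 := by
  by_contra hne
  have hdeg : 0 < u.degree := natDegree_pos_iff_degree_pos.mp (Nat.pos_of_ne_zero hne)
  have h1 : Tendsto (fun n : ℕ => ‖(n : ℂ)‖) atTop atTop := by
    simp_rw [Complex.norm_natCast]
    exact tendsto_natCast_atTop_atTop
  have h2 := u.tendsto_norm_atTop hdeg h1
  obtain ⟨n, hn1, hn2⟩ := ((h1.eventually_gt_atTop 1).and (h2.eventually_gt_atTop c)).exists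
  exact absurd (h n hn1) (not_le.mpr hn2)

theorem map_eq_mul_comp {T : ℂ[X] →ₗ[ℂ] ℂ[X]} {P V : ℂ[X]} (h : ∀ k, T (X ^ k) = P * V ^ k)
    (f : ℂ[X]) : T f = P * f.comp V := by
  induction f using Polynomial.induction_on' with
  | add p q hp hq => rw [map_add, hp, hq, add_comp, mul_add]
  | monomial k a =>
    rw [← smul_X_eq_monomial, map_smul, h, smul_comp, X_pow_comp, mul_smul_comm]

theorem map_eq_smul_of_forall_X_pow {T : ℂ[X] →ₗ[ℂ] ℂ[X]} {P : ℂ[X]}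
    (h : ∀ k, ∃ a : ℂ, T (X ^ k) = a • P) (f : ℂ[X]) : ∃ a : ℂ, T f = a • P := by
  induction f using Polynomial.induction_on' with
  | add p q hp hq =>
    obtain ⟨a, ha⟩ := hp
    obtain ⟨b, hb⟩ := hq
    exact ⟨a + b, by rw [map_add, ha, hb, add_smul]⟩
  | monomial k a =>
    obtain ⟨b, hb⟩ := h k
    exact ⟨a * b, by rw [← smul_X_eq_monomial, map_smul, hb, smul_smul]⟩

/-! ### The circle: symbols stable on equal sides -/

/-- The hypothesis leaves only rank at most one. Let X^j be the first power not annihilated and P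
its image. For |z| > 1 the symbol of degree k has leading coefficient binom(k, j) P(z) and all its
zeros in the closed disk, so its constant term T(X^k)(z) is at most binom(k, j)|P(z)|. Hence P
divides T(X^k) with a quotient bounded outside the disk, which is a constant. -/
theorem preserves_unitCircle_of_same_side {T : ℂ[X] →ₗ[ℂ] ℂ[X]}
    (h : ∀ n, (∀ w : ℂ, T ((X + C w) ^ n) = 0) ∨ ∀ z w : ℂ,
      (1 < ‖z‖ ∧ 1 < ‖w‖) ∨ (‖z‖ < 1 ∧ ‖w‖ < 1) → (T ((X + C w) ^ n)).eval z ≠ 0) :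
    Preserves unitCircle T := by
  classical
  intro f hf
  by_cases hall : ∀ k, T (X ^ k) = 0
  · right
    have := map_eq_mul_comp (T := T) (P := 0) (V := 0) (fun k => by rw [hall, zero_mul]) f
    rw [this, zero_mul]
    rfl
  push Not at hall
  set j := Nat.find hall with hj
  have hPne : T (X ^ j) ≠ 0 := Nat.find_spec hall
  have hlt : ∀ i < j, T (X ^ i) = 0 := fun i hi => not_not.mp (Nat.find_min hall hi)
  set P := T (X ^ j) with hP
  have hst : ∀ k, j ≤ k → ∀ z w : ℂ, (1 < ‖z‖ ∧ 1 < ‖w‖) ∨ (‖z‖ < 1 ∧ ‖w‖ < 1) →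
      (symbolPoly (evalAt T z) k).eval w ≠ 0 := fun k hk z w hzw => by
    rw [eval_symbolPoly, evalAt_apply]
    refine (h k).resolve_left (fun h0 => hPne ?_) z w hzw
    exact map_eq_zero_of_pow_eq_zero Set.infinite_univ (fun w _ => h0 w)
      (by rwa [natDegree_X_pow])
  have hdeg : ∀ k, j ≤ k → ∀ z, (symbolPoly (evalAt T z) k).natDegree ≤ k - j := by
    intro k hk z
    rw [natDegree_le_iff_coeff_eq_zero]
    intro i hi
    rcases le_or_gt i k with hik | hik
    · have := coeff_symbolPoly (evalAt T z) (n := k) (k := k - i) (by omega)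
      rw [show k - (k - i) = i by omega] at this
      rw [this, evalAt_apply, hlt _ (by omega), eval_zero, mul_zero]
    · exact coeff_eq_zero_of_natDegree_lt ((natDegree_symbolPoly_le _ _).trans_lt hik)
  have hPz : ∀ z : ℂ, 1 < ‖z‖ ∨ ‖z‖ < 1 → P.eval z ≠ 0 := by
    intro z hz
    have hc : symbolPoly (evalAt T z) j = C (P.eval z) := by
      have h1 := hdeg j le_rfl z
      rw [Nat.sub_self, Nat.le_zero] at h1
      rw [eq_C_of_natDegree_eq_zero h1]
      have := coeff_symbolPoly (evalAt T z) (n := j) (k := j) le_rfl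
      rw [Nat.sub_self, Nat.choose_self, Nat.cast_one, one_mul] at this
      rw [this, evalAt_apply]
    rcases hz with hz | hz
    · have := hst j le_rfl z 2 (Or.inl ⟨hz, by norm_num⟩)
      rwa [hc, eval_C] at this
    · have := hst j le_rfl z 0 (Or.inr ⟨hz, by norm_num⟩)
      rwa [hc, eval_C] at this
  have hPmem : P ∈ zerosIn unitCircle := by
    refine ⟨hPne, fun z hz => ?_⟩
    by_contra hne
    exact hPz z (lt_or_gt_of_ne hne).symm hz
  have hbound : ∀ k, j ≤ k → ∀ z : ℂ, 1 < ‖z‖ →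
      ‖(T (X ^ k)).eval z‖ ≤ (k.choose j : ℝ) * ‖P.eval z‖ := by
    intro k hk z hz
    set q := symbolPoly (evalAt T z) k with hq
    have hlead : q.coeff (k - j) = (k.choose j : ℂ) * P.eval z := coeff_symbolPoly _ hk
    have hne : q.coeff (k - j) ≠ 0 := by
      rw [hlead]
      exact mul_ne_zero (by exact_mod_cast (Nat.choose_pos hk).ne') (hPz z (Or.inl hz))
    have hnat : q.natDegree = k - j := le_antisymm (hdeg k hk z) (le_natDegree_of_ne_zero hne)
    have h0 : q.coeff 0 = (T (X ^ k)).eval z := by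
      have := coeff_symbolPoly (evalAt T z) (n := k) (k := k) le_rfl
      rwa [Nat.sub_self, Nat.choose_self, Nat.cast_one, one_mul] at this
    have h1 := norm_coeff_zero_le (p := q) (B := 1) fun r hr => by
      by_contra! hlt
      exact hst k hk z r (Or.inl ⟨hz, hlt⟩) hr
    rw [h0, one_pow, mul_one, leadingCoeff, hnat, hlead, norm_mul, Complex.norm_natCast] at h1
    exact h1
  have hmul : ∀ k, ∃ a : ℂ, T (X ^ k) = a • P := by
    intro k
    rcases lt_or_ge k j with hk | hk
    · exact ⟨0, by rw [hlt k hk, zero_smul]⟩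
    obtain ⟨u, hu⟩ := dvd_of_norm_eval_le (U := {z : ℂ | 1 < ‖z‖}) _ P (T (X ^ k)) rfl hPne
      (fun z hz => mem_closure_exterior (hPmem.2 z hz)) (fun z hz => hPz z (Or.inl hz))
      (hbound k hk)
    have hu0 : u.natDegree = 0 := natDegree_eq_zero_of_norm_eval_le (c := (k.choose j : ℝ))
      fun z hz => by
        have h1 := hbound k hk z hz
        rw [hu, eval_mul, norm_mul, mul_comm] at h1
        exact le_of_mul_le_mul_right h1 (norm_pos_iff.mpr (hPz z (Or.inl hz)))
    exact ⟨u.coeff 0, by rw [hu, eq_C_of_natDegree_eq_zero hu0, coeff_C_zero, smul_eq_C_mul,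
      mul_comm]⟩
  obtain ⟨a, ha⟩ := map_eq_smul_of_forall_X_pow hmul f
  rw [ha]
  exact smul_mem_zerosIn_union_zero hPmem a

/-! ### The circle: symbols stable on opposite sides -/

theorem re_multiset_sum_pos {m : Multiset ℂ} (h : ∀ x ∈ m, 0 < x.re) (hm : m ≠ 0) :
    0 < m.sum.re := by
  induction m using Multiset.induction_on with
  | empty => exact absurd rfl hm
  | cons a m ih =>
    have h1 := h a (Multiset.mem_cons_self a m)
    rw [Multiset.sum_cons, Complex.add_re]
    rcases eq_or_ne m 0 with rfl | hm0
    · simpa using h1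
    · have := ih (fun x hx => h x (Multiset.mem_cons_of_mem hx)) hm0
      linarith

/-- For |η| = 1, r ↦ η/(η - r) sends the closed disk without η to Re ≥ 1/2. Hence η p'(η)/p(η), a
sum of such terms, cannot vanish. -/
theorem re_div_sub_pos {η r : ℂ} (hη : ‖η‖ = 1) (hr : ‖r‖ ≤ 1) (hne : η ≠ r) :
    0 < (η / (η - r)).re := by
  have h1 : η - r ≠ 0 := sub_ne_zero.mpr hne
  have h2 : 0 < Complex.normSq (η - r) := Complex.normSq_pos.mpr h1
  rw [Complex.div_re, ← add_div]
  refine div_pos ?_ h2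
  have h3 : η.re * η.re + η.im * η.im = 1 := by
    rw [← Complex.normSq_apply, Complex.normSq_eq_norm_sq, hη]; norm_num
  have h4 : r.re * r.re + r.im * r.im ≤ 1 := by
    rw [← Complex.normSq_apply, Complex.normSq_eq_norm_sq]
    nlinarith [norm_nonneg r]
  rw [Complex.normSq_apply] at h2
  simp only [Complex.sub_re, Complex.sub_im] at h2 ⊢
  nlinarith

/-- A critical point on the unit circle of a polynomial with zeros in the closed unit disk is a
zero. -/
theorem eval_eq_zero_of_derivative {p : ℂ[X]} (hp : p.natDegree ≠ 0)
    (h : ∀ r, p.eval r = 0 → ‖r‖ ≤ 1) {η : ℂ} (hη : ‖η‖ = 1) (hd : (derivative p).eval η = 0) :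
    p.eval η = 0 := by
  by_contra hne
  have hs := IsAlgClosed.splits p
  have hsum := hs.eval_derivative_div_eval_of_ne_zero hne
  rw [hd, zero_div] at hsum
  have h1 : (p.roots.map fun r => η / (η - r)).sum = 0 := by
    have : (p.roots.map fun r => η / (η - r)) = p.roots.map fun r => η * (1 / (η - r)) := by
      refine Multiset.map_congr rfl fun r _ => ?_
      rw [mul_one_div]
    rw [this, Multiset.sum_map_mul_left, ← hsum, mul_zero]
  have h2 := re_multiset_sum_pos (m := p.roots.map fun r => η / (η - r)) (fun x hx => by
    obtain ⟨r, hr, rfl⟩ := Multiset.mem_map.mp hx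
    have hr0 : p.eval r = 0 := isRoot_of_mem_roots hr
    exact re_div_sub_pos hη (h r hr0) (by rintro rfl; exact hne hr0)) (by
      rw [Ne, Multiset.map_eq_zero]
      exact hs.roots_ne_zero hp)
  rw [h1] at h2
  simp at h2

theorem succ_le_choose_add {K : ℕ} (hK : 0 < K) (N : ℕ) : N + 1 ≤ (K + N).choose K := by
  induction K, hK using Nat.le_induction with
  | base => rw [Nat.choose_one_right]; omega
  | succ K _ ih =>
    rw [show K + 1 + N = (K + N) + 1 by omega, Nat.choose_succ_succ]
    omega

theorem natDegree_symbolPoly {L : ℂ[X] →ₗ[ℂ] ℂ} (hL : L 1 ≠ 0) (n : ℕ) :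
    (symbolPoly L n).natDegree = n := by
  refine le_antisymm (natDegree_symbolPoly_le L n) (le_natDegree_of_ne_zero ?_)
  have := coeff_symbolPoly L (Nat.zero_le n)
  rw [Nat.sub_zero, Nat.choose_zero_right, Nat.cast_one, one_mul, pow_zero] at this
  rwa [this]

/-- If `L ((X + w) ^ n) = L 1 * (w - η) ^ n + ⋯` has for large `n` a zero of multiplicity `n - K` at
`η`, and bounded zeros, then it equals `L 1 * (w - η) ^ n`. -/
theorem apply_shifted_pow_eq_zero {L : ℂ[X] →ₗ[ℂ] ℂ} {η : ℂ} (hη : ‖η‖ = 1)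
    (hroots : ∀ n w, L ((X + C w) ^ n) = 0 → ‖w‖ ≤ 1) {m : ℕ}
    (hm : ∀ k, m ≤ k → L ((X + C η) ^ k) = 0) {k : ℕ} (hk : k ≠ 0) :
    L ((X + C η) ^ k) = 0 := by
  classical
  by_contra hne
  set c : ℕ → ℂ := fun k => L ((X + C η) ^ k) with hc
  have hL : c 0 ≠ 0 := fun h0 => by
    have := hroots 0 2 (by simpa [hc] using h0)
    norm_num at this
  set K := Nat.findGreatest (fun k => c k ≠ 0) m with hKdef
  have hkm : k ≤ m := by
    by_contra! h
    exact hne (hm k h.le)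
  have hcK : c K ≠ 0 := Nat.findGreatest_spec (P := fun k => c k ≠ 0) hkm hne
  have hkK : k ≤ K := Nat.le_findGreatest hkm hne
  have hgt : ∀ i, K < i → c i = 0 := fun i hi => by
    rcases le_or_gt i m with him | him
    · exact not_not.mp (Nat.findGreatest_is_greatest hi him)
    · exact hm i him.le
  have hbound : ∀ N : ℕ, ((K + N).choose K : ℝ) * ‖c K‖ ≤ ‖c 0‖ * 2 ^ K := by
    intro N
    set M := K + N with hM
    -- The symbol of degree K + N at η + x is x^N r(x), where r has degree K, leading coefficient c₀
    -- and constant term binom(K + N, K) c_K. The zeros of r have modulus at most 2, which bounds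
    -- the constant term while the binomial grows with N.
    set r : ℂ[X] := ∑ i ∈ Finset.range (K + 1), monomial (K - i) ((M.choose i : ℂ) * c i) with hr
    have hcoeff : ∀ i ≤ K, r.coeff (K - i) = (M.choose i : ℂ) * c i := fun i hi => by
      rw [hr, finsetSum_coeff, Finset.sum_eq_single i]
      · rw [coeff_monomial, if_pos rfl]
      · intro j hj hji
        rw [coeff_monomial, if_neg]
        have := Finset.mem_range.mp hj
        omega
      · intro h
        exact absurd (Finset.mem_range.mpr (by omega)) h
    have hle : r.natDegree ≤ K := natDegree_sum_le_of_forall_le _ _ fun _ _ =>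
      (natDegree_monomial_le _).trans (Nat.sub_le _ _)
    have hlead : r.coeff K = c 0 := by
      have := hcoeff 0 (Nat.zero_le _)
      rwa [Nat.sub_zero, Nat.choose_zero_right, Nat.cast_one, one_mul] at this
    have hnat : r.natDegree = K := le_antisymm hle (le_natDegree_of_ne_zero (by rwa [hlead]))
    have hev : ∀ x, L ((X + C (η + x)) ^ M) = x ^ N * r.eval x := by
      intro x
      have h1 : (X + C (η + x) : ℂ[X]) = (X + C η) + C x := by rw [C_add]; ring
      rw [h1, add_pow, map_sum, hr, eval_finsetSum, Finset.mul_sum]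
      have h2 : ∀ i ∈ Finset.range (M + 1),
          L ((X + C η) ^ i * C x ^ (M - i) * (M.choose i : ℂ[X])) =
            x ^ (M - i) * ((M.choose i : ℂ) * c i) := fun i _ => by
        have : (X + C η : ℂ[X]) ^ i * C x ^ (M - i) * (M.choose i : ℂ[X]) =
            (x ^ (M - i) * (M.choose i : ℂ)) • (X + C η) ^ i := by
          rw [smul_eq_C_mul, C_mul, C_pow, map_natCast]; ring
        rw [this, map_smul, smul_eq_mul, mul_assoc]
      rw [Finset.sum_congr rfl h2]
      symm
      rw [← Finset.sum_subset (Finset.range_mono (show K + 1 ≤ M + 1 by omega))]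
      · refine Finset.sum_congr rfl fun i hi => ?_
        have := Finset.mem_range.mp hi
        rw [eval_monomial, show M - i = N + (K - i) by omega, pow_add]
        ring
      · intro i _ hi
        rw [hgt i (by simpa using hi), mul_zero, mul_zero]
    have h1 := norm_coeff_zero_le (p := r) (B := 2) fun x hx => by
      have h2 := hroots M (η + x) (by rw [hev, hx, mul_zero])
      calc ‖x‖ = ‖(η + x) - η‖ := by congr 1; ring
        _ ≤ ‖η + x‖ + ‖η‖ := norm_sub_le _ _
        _ ≤ 2 := by linarith
    have h0 := hcoeff K le_rfl
    rw [Nat.sub_self] at h0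
    rw [leadingCoeff, hnat, hlead, h0, norm_mul, Complex.norm_natCast] at h1
    exact h1
  have hpos : 0 < ‖c K‖ := norm_pos_iff.mpr hcK
  obtain ⟨N, hN⟩ := exists_nat_gt (‖c 0‖ * 2 ^ K / ‖c K‖)
  rw [div_lt_iff₀ hpos] at hN
  have h1 : ((N : ℝ) + 1) ≤ ((K + N).choose K : ℝ) := by
    exact_mod_cast succ_le_choose_add (Nat.lt_of_lt_of_le (Nat.pos_of_ne_zero hk) hkK) N
  have h2 := hbound N
  nlinarith

/-- The functional is a multiple of evaluation at -η for a common zero η of all symbols of positive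
degree. If some symbol has a zero η on the circle, then η is a critical point of the next symbol,
whose zeros lie in the closed disk, so it is again a zero; it thus persists upwards, and boundedness
of the zeros extends it downwards. If no zero is ever on the circle, every zero is e. -/
theorem exists_apply_X_pow_eq {L : ℂ[X] →ₗ[ℂ] ℂ} {e : ℂ} (he : ‖e‖ < 1)
    (hL : L 1 ≠ 0) (hroots : ∀ n w, L ((X + C w) ^ n) = 0 → ‖w‖ = 1 ∨ w = e) :
    ∃ u : ℂ, ∀ n, L (X ^ n) = L 1 * u ^ n := by
  have hle : ∀ n w, L ((X + C w) ^ n) = 0 → ‖w‖ ≤ 1 := fun n w h => by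
    rcases hroots n w h with h | rfl
    exacts [h.le, he.le]
  have hη : ∃ η : ℂ, ∀ k, k ≠ 0 → L ((X + C η) ^ k) = 0 := by
    by_cases hex : ∃ m η, m ≠ 0 ∧ ‖η‖ = 1 ∧ L ((X + C η) ^ m) = 0
    · obtain ⟨m, η, hm, hη, h0⟩ := hex
      refine ⟨η, fun k hk => apply_shifted_pow_eq_zero hη hle (m := m) (fun i hi => ?_) hk⟩
      induction i, hi using Nat.le_induction with
      | base => exact h0
      | succ i hi ih =>
        rw [← eval_symbolPoly]
        refine eval_eq_zero_of_derivative ?_ (fun r hr => ?_) hη ?_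
        · rw [natDegree_symbolPoly hL]; omega
        · rw [eval_symbolPoly] at hr; exact hle _ _ hr
        · rw [derivative_symbolPoly, eval_mul, eval_symbolPoly, ih, mul_zero]
    · refine ⟨e, fun k hk => ?_⟩
      obtain ⟨r, hr⟩ := IsAlgClosed.exists_root (symbolPoly L k) (by
        intro h0
        have := natDegree_eq_of_degree_eq_some (n := 0) h0
        rw [natDegree_symbolPoly hL] at this
        exact hk this)
      rw [IsRoot, eval_symbolPoly] at hr
      rcases hroots k r hr with h | rfl
      · exact absurd ⟨k, r, hk, h, hr⟩ hex
      · exact hr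
  obtain ⟨η, hη⟩ := hη
  refine ⟨-η, fun n => ?_⟩
  have h1 : (X : ℂ[X]) = (X + C η) + C (-η) := by rw [C_neg]; ring
  conv_lhs => rw [h1, add_pow, map_sum]
  rw [Finset.sum_eq_single 0]
  · have : (X + C η : ℂ[X]) ^ 0 * C (-η) ^ (n - 0) * (n.choose 0 : ℂ[X]) = ((-η) ^ n) • 1 := by
      rw [smul_eq_C_mul, C_pow]; simp
    rw [this, map_smul, smul_eq_mul, mul_comm]
  · intro i _ hi
    have : (X + C η : ℂ[X]) ^ i * C (-η) ^ (n - i) * (n.choose i : ℂ[X]) =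
        ((-η) ^ (n - i) * (n.choose i : ℂ)) • (X + C η) ^ i := by
      rw [smul_eq_C_mul, C_mul, C_pow, map_natCast]; ring
    rw [this, map_smul, hη i hi, smul_zero]
  · intro h
    exact absurd (Finset.mem_range.mpr (Nat.succ_pos n)) h

/-- For nonconstant u, points off the circle do not map onto it. By the open mapping theorem, an
inner point z with |u(z)| = 1 would have inner neighbours with values t u(z), t > 1; an outer one
would have outer neighbours with |e| < t < 1, so with values inside the disk and different from e.
-/
theorem preserves_unitCircle_of_comp {T : ℂ[X] →ₗ[ℂ] ℂ[X]} {P u : ℂ[X]} {e : ℂ} (he : ‖e‖ < 1)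
    (hP : P ∈ zerosIn unitCircle) (hT : ∀ f, T f = P * f.comp u)
    (hin : ∀ z : ℂ, ‖z‖ < 1 → ‖u.eval z‖ ≤ 1)
    (hout : ∀ z : ℂ, 1 < ‖z‖ → 1 ≤ ‖u.eval z‖ ∨ u.eval z = e) : Preserves unitCircle T := by
  intro f hf
  by_cases hu : u.natDegree = 0
  · have : T f = (f.eval (u.coeff 0)) • P := by
      rw [hT, eq_C_of_natDegree_eq_zero hu, comp_C, coeff_C_zero, smul_eq_C_mul, mul_comm]
    rw [this]
    exact smul_mem_zerosIn_union_zero hP _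
  have hopen : IsOpenMap fun z : ℂ => u.eval z := by
    have han : AnalyticOnNhd ℂ (fun z : ℂ => u.eval z) Set.univ := fun z _ => by
      simpa using (AnalyticOnNhd.eval_polynomial u) z (Set.mem_univ z)
    refine han.is_constant_or_isOpenMap.resolve_left ?_
    rintro ⟨w, hw⟩
    apply hu
    have : u = C w := Polynomial.funext fun z => by rw [hw, eval_C]
    rw [this, natDegree_C]
  have hcirc : ∀ z, ‖u.eval z‖ = 1 → ‖z‖ = 1 := by
    intro z hz
    have hline : Tendsto (fun t : ℝ => (t : ℂ) * u.eval z) (𝓝 1) (𝓝 (u.eval z)) := by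
      have : Continuous fun t : ℝ => (t : ℂ) * u.eval z := by fun_prop
      simpa using this.tendsto 1
    by_contra hne
    rcases lt_or_gt_of_ne hne with hlt | hgt
    · have hU : IsOpen {z : ℂ | ‖z‖ < 1} := isOpen_lt continuous_norm continuous_const
      have h1 := hline.eventually ((hopen _ hU).mem_nhds ⟨z, hlt, rfl⟩)
      obtain ⟨t, ⟨y, hy, hyt⟩, ht⟩ :=
        ((h1.filter_mono nhdsWithin_le_nhds).and (self_mem_nhdsWithin (s := Set.Ioi 1))).exists
      have h2 := hin y hy
      have ht' : (1 : ℝ) < t := ht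
      have hyt' : u.eval y = t * u.eval z := hyt
      rw [hyt', norm_mul, hz, mul_one, Complex.norm_real, Real.norm_eq_abs,
        abs_of_pos (by linarith)] at h2
      linarith
    · have hU : IsOpen {z : ℂ | 1 < ‖z‖} := isOpen_lt continuous_const continuous_norm
      have h1 := hline.eventually ((hopen _ hU).mem_nhds ⟨z, hgt, rfl⟩)
      obtain ⟨t, ⟨⟨y, hy, hyt⟩, het⟩, ht⟩ :=
        (((h1.and (lt_mem_nhds he)).filter_mono nhdsWithin_le_nhds).and
          (self_mem_nhdsWithin (s := Set.Iio 1))).exists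
      have ht' : t < (1 : ℝ) := ht
      have hyt' : u.eval y = t * u.eval z := hyt
      have hnorm : ‖u.eval y‖ = t := by
        rw [hyt', norm_mul, hz, mul_one, Complex.norm_real, Real.norm_eq_abs, abs_of_nonneg]
        exact (norm_nonneg e).trans (le_of_lt het)
      rcases hout y hy with h | h
      · linarith
      · rw [h] at hnorm
        linarith
  by_cases hTf : T f = 0
  · right; exact hTf
  left
  refine ⟨hTf, fun z hz => ?_⟩
  rw [hT] at hz
  rcases root_mul.mp hz with h | h
  · exact hP.2 z h
  · have h1 : f.eval (u.eval z) = 0 := by rw [← eval_comp]; exact h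
    exact hcirc z (hf.2 _ h1)

/-- The degree-one symbol bounds T(X) by P = T(1) in the disk, so T(X) = P u. At a point of the
circle where P does not vanish, limits from both sides confine the w-zeros of all symbols to the
circle and e, so T acts there as P(z) times evaluation at u(z). -/
theorem preserves_unitCircle_of_opposite_side {T : ℂ[X] →ₗ[ℂ] ℂ[X]} {e : ℂ} (he : ‖e‖ < 1)
    (hP : T 1 ∈ zerosIn unitCircle)
    (hout : ∀ n z w, 1 < ‖z‖ → ‖w‖ < 1 → w ≠ e → (T ((X + C w) ^ n)).eval z ≠ 0)
    (hin : ∀ n z w, ‖z‖ < 1 → 1 < ‖w‖ → (T ((X + C w) ^ n)).eval z ≠ 0) :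
    Preserves unitCircle T := by
  set P := T 1 with hPdef
  have hlinear : ∀ z w, (T ((X + C w) ^ 1)).eval z = (T X).eval z + w * P.eval z := fun z w => by
    have : ((X + C w) ^ 1 : ℂ[X]) = X + w • 1 := by rw [smul_eq_C_mul]; ring
    rw [this, map_add, map_smul, eval_add, eval_smul, smul_eq_mul]
  have hP0 : ∀ z : ℂ, ‖z‖ ≠ 1 → P.eval z ≠ 0 := fun z hz h0 => hz (hP.2 z h0)
  obtain ⟨u, hu⟩ : P ∣ T X := by
    refine dvd_of_norm_eval_le (U := {z : ℂ | ‖z‖ < 1}) (c := 1) _ P (T X) rfl hP.1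
      (fun z hz => mem_closure_disk (hP.2 z hz)) (fun z hz => hP0 z (ne_of_lt hz)) fun z hz => ?_
    have hPz : P.eval z ≠ 0 := hP0 z (ne_of_lt hz)
    by_contra! hlt
    refine hin 1 z (-(T X).eval z / P.eval z) hz ?_ ?_
    · rw [norm_div, norm_neg, lt_div_iff₀ (norm_pos_iff.mpr hPz)]
      exact hlt
    · rw [hlinear, div_mul_cancel₀ _ hPz]
      ring
  have hpow : ∀ n, T (X ^ n) = P * u ^ n := by
    intro n
    refine eq_of_infinite_eval_eq _ _ ((infinite_unitCircle.sdiff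
      (finite_setOfPred_isRoot hP.1)).mono ?_)
    rintro z ⟨hz, hPz⟩
    have hPz' : P.eval z ≠ 0 := hPz
    have hz' : ‖z‖ = 1 := hz
    have hL : evalAt T z 1 ≠ 0 := hPz'
    have htend : ∀ m w, Tendsto (fun y : ℂ => (symbolPoly (evalAt T y) m).eval w) (𝓝 z)
        (𝓝 ((symbolPoly (evalAt T z) m).eval w)) := fun m w => by
      simp_rw [eval_symbolPoly, evalAt_apply]
      exact (T ((X + C w) ^ m)).continuous.tendsto z
    have hne : ∀ m, symbolPoly (evalAt T z) m ≠ 0 := fun m h0 => by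
      have := coeff_symbolPoly (evalAt T z) (Nat.zero_le m)
      rw [h0, coeff_zero, Nat.choose_zero_right, Nat.cast_one, one_mul, pow_zero] at this
      exact hL this.symm
    have hroots : ∀ m w, evalAt T z ((X + C w) ^ m) = 0 → ‖w‖ = 1 ∨ w = e := by
      intro m w hw
      rw [← eval_symbolPoly] at hw
      have hdeg : ∀ y, (symbolPoly (evalAt T y) m).natDegree ≤ m := fun y =>
        natDegree_symbolPoly_le _ _
      by_contra! hc
      rcases lt_or_gt_of_ne hc.1 with hlt | hgt
      · have : (𝓝[{y : ℂ | 1 < ‖y‖}] z).NeBot := mem_closure_iff_nhdsWithin_neBot.mp (mem_closure_exterior hz)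
        refine (eq_zero_or_eval_ne_zero_of_tendsto (l := 𝓝[{y : ℂ | 1 < ‖y‖}] z)
          (Eventually.of_forall hdeg)
          (fun x => (htend m x).mono_left nhdsWithin_le_nhds) (U := {x : ℂ | ‖x‖ < 1} ∩ {e}ᶜ)
          ((isOpen_lt continuous_norm continuous_const).inter isOpen_compl_singleton)
          ?_).resolve_left (hne m) w ⟨hlt, hc.2⟩ hw
        filter_upwards [self_mem_nhdsWithin] with y hy x hx
        rw [eval_symbolPoly]
        exact hout m y x hy hx.1 hx.2
      · have : (𝓝[{y : ℂ | ‖y‖ < 1}] z).NeBot := mem_closure_iff_nhdsWithin_neBot.mp (mem_closure_disk hz)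
        refine (eq_zero_or_eval_ne_zero_of_tendsto (l := 𝓝[{y : ℂ | ‖y‖ < 1}] z)
          (Eventually.of_forall hdeg)
          (fun x => (htend m x).mono_left nhdsWithin_le_nhds) (U := {x : ℂ | 1 < ‖x‖})
          (isOpen_lt continuous_const continuous_norm)
          ?_).resolve_left (hne m) w hgt hw
        filter_upwards [self_mem_nhdsWithin] with y hy x hx
        rw [eval_symbolPoly]
        exact hin m y x hy hx
    obtain ⟨v, hv⟩ := exists_apply_X_pow_eq he hL hroots
    have h1 := hv 1
    rw [pow_one, pow_one, evalAt_apply, evalAt_apply, hu, eval_mul] at h1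
    have h2 : u.eval z = v := mul_left_cancel₀ hPz' h1
    change eval z _ = eval z _
    have h3 := hv n
    rw [evalAt_apply, evalAt_apply, ← h2] at h3
    rw [h3, eval_mul, eval_pow]
  -- The zero of the degree-one symbol is w = -u(z), so the exceptional value of u is -e.
  refine preserves_unitCircle_of_comp (e := -e) (by rwa [norm_neg]) hP (map_eq_mul_comp hpow)
    (fun z hz => ?_) (fun z hz => ?_)
  · by_contra! hlt
    refine hin 1 z (-u.eval z) hz (by rwa [norm_neg]) ?_
    rw [hlinear, hu, eval_mul]
    ring
  · by_contra! hc
    refine hout 1 z (-u.eval z) hz (by rw [norm_neg]; exact hc.1) (fun h => hc.2 ?_) ?_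
    · rw [← h, neg_neg]
    · rw [hlinear, hu, eval_mul]
      ring

/-! ### Preservers of polynomials with zeros on the unit circle -/

/-- The conjugate-reversed polynomial `z ^ n * conj (f (1 / conj z))`. -/
noncomputable def conjReflect (n : ℕ) (f : ℂ[X]) : ℂ[X] := reflect n (conjPoly f)

theorem coeff_conjReflect (n : ℕ) (f : ℂ[X]) (i : ℕ) :
    (conjReflect n f).coeff i = starRingEnd ℂ (f.coeff (revAt n i)) := by
  rw [conjReflect, coeff_reflect, coeff_conjPoly]

@[simp] theorem conjReflect_conjReflect (n : ℕ) (f : ℂ[X]) :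
    conjReflect n (conjReflect n f) = f := by
  ext i; rw [coeff_conjReflect, coeff_conjReflect, revAt_invol, Complex.conj_conj]

theorem conjReflect_add (n : ℕ) (f g : ℂ[X]) :
    conjReflect n (f + g) = conjReflect n f + conjReflect n g := by
  rw [conjReflect, conjPoly_add, reflect_add]; rfl

theorem conjReflect_smul (n : ℕ) (s : ℂ) (f : ℂ[X]) :
    conjReflect n (s • f) = starRingEnd ℂ s • conjReflect n f := by
  rw [conjReflect, conjPoly_smul, smul_eq_C_mul, reflect_C_mul, smul_eq_C_mul]; rfl

theorem natDegree_conjReflect_le {n : ℕ} {f : ℂ[X]} (hf : f.natDegree ≤ n) :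
    (conjReflect n f).natDegree ≤ n := by
  refine natDegree_reflect_le.trans ?_
  rw [natDegree_conjPoly]
  exact max_le le_rfl hf

theorem conjReflect_add_deg {n : ℕ} (k : ℕ) {f : ℂ[X]} (hf : f.natDegree ≤ n) :
    conjReflect (n + k) f = X ^ k * conjReflect n f := by
  have h := reflect_mul (conjPoly f) 1 (F := n) (G := k) (by rwa [natDegree_conjPoly]) (by simp)
  rw [mul_one, reflect_one, mul_comm] at h
  exact h

theorem natDegree_multiset_prod_X_sub_C_conj (m : Multiset ℂ) :
    (m.map fun r => X - C (starRingEnd ℂ r)).prod.natDegree = m.card := by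
  have h := natDegree_multiset_prod_X_sub_C_eq_card (m.map (starRingEnd ℂ))
  rwa [Multiset.map_map, Multiset.card_map] at h

/-- If |a| = 1, conjugate reversal sends X - a to 1 - conj(a) X = -conj(a)(X - a), and it is
multiplicative over the linear factors. -/
theorem conjReflect_mem_zerosIn {f : ℂ[X]} (hf : f ∈ zerosIn unitCircle) :
    ∃ c : ℂ, conjReflect f.natDegree f = c • f := by
  have key : ∀ m : Multiset ℂ, (∀ r ∈ m, ‖r‖ = 1) → ∃ c : ℂ,
      reflect m.card (m.map fun r => X - C (starRingEnd ℂ r)).prod =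
        c • (m.map fun r => X - C r).prod := fun m => by
    induction m using Multiset.induction_on with
    | empty => intro _; exact ⟨1, by simp⟩
    | cons a m ih =>
      intro hm
      obtain ⟨c, hc⟩ := ih fun r hr => hm r (Multiset.mem_cons_of_mem hr)
      have ha : starRingEnd ℂ a * a = 1 := by
        rw [Complex.conj_mul', hm a (Multiset.mem_cons_self a m)]; simp
      have h1 : reflect 1 (X - C (starRingEnd ℂ a)) = (-starRingEnd ℂ a) • (X - C a) := by
        rw [reflect_sub, reflect_one_X, reflect_C, pow_one, smul_eq_C_mul, C_neg, neg_mul, mul_sub,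
          ← C_mul, ha, C_1]
        ring
      refine ⟨-starRingEnd ℂ a * c, ?_⟩
      rw [Multiset.map_cons, Multiset.prod_cons, Multiset.map_cons, Multiset.prod_cons,
        Multiset.card_cons, add_comm, reflect_mul _ _ (natDegree_X_sub_C _).le
          (natDegree_multiset_prod_X_sub_C_conj m).le, h1, hc, smul_mul_smul_comm]
  have hl : f.leadingCoeff ≠ 0 := leadingCoeff_ne_zero.mpr hf.1
  have hs := IsAlgClosed.splits f
  obtain ⟨c, hc⟩ := key f.roots fun r hr => hf.2 r (isRoot_of_mem_roots hr)
  refine ⟨starRingEnd ℂ f.leadingCoeff * c / f.leadingCoeff, ?_⟩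
  have h1 : conjPoly f = C (starRingEnd ℂ f.leadingCoeff) *
      (f.roots.map fun r => X - C (starRingEnd ℂ r)).prod := by
    conv_lhs => rw [hs.eq_prod_roots]
    rw [conjPoly, Polynomial.map_mul, map_C, Polynomial.map_multiset_prod, Multiset.map_map]
    simp
  rw [conjReflect, h1, reflect_C_mul, hs.natDegree_eq_card_roots, hc, smul_eq_C_mul, smul_eq_C_mul]
  conv_rhs => arg 2; rw [hs.eq_prod_roots]
  rw [← mul_assoc, ← mul_assoc, ← C_mul, ← C_mul, div_mul_cancel₀ _ hl]

/-- The operator `conjReflect m ∘ T ∘ conjReflect n`. -/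
noncomputable def reflectOp (T : ℂ[X] →ₗ[ℂ] ℂ[X]) (n m : ℕ) : ℂ[X] →ₗ[ℂ] ℂ[X] where
  toFun f := conjReflect m (T (conjReflect n f))
  map_add' f g := by rw [conjReflect_add, map_add, conjReflect_add]
  map_smul' s f := by
    rw [conjReflect_smul, map_smul, conjReflect_smul, Complex.conj_conj, RingHom.id_apply]

theorem reflectOp_apply (T : ℂ[X] →ₗ[ℂ] ℂ[X]) (n m : ℕ) (f : ℂ[X]) :
    reflectOp T n m f = conjReflect m (T (conjReflect n f)) := rfl

/-- Along f + t g the factor L is a nonzero polynomial of degree one in t and can be cancelled. This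
permits an identity to be tested only where L ≠ 0. -/
theorem PolyOnLines.eq_zero_of_mul {G : ℂ[X] → ℂ} (hG : PolyOnLines G) {L : ℂ[X] →ₗ[ℂ] ℂ}
    {n : ℕ} (h : ∀ f : ℂ[X], f.natDegree ≤ n → L f * G f = 0) {g : ℂ[X]} (hg : g.natDegree ≤ n)
    (hL : L g ≠ 0) {f : ℂ[X]} (hf : f.natDegree ≤ n) : G f = 0 := by
  obtain ⟨p, hp⟩ := hG f g
  have hdeg : ∀ t : ℂ, (f + t • g).natDegree ≤ n := fun t =>
    (natDegree_add_le _ _).trans (max_le hf ((natDegree_smul_le _ _).trans hg))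
  have hmul : (C (L f) + C (L g) * X) * p = 0 := by
    refine Polynomial.funext fun t => ?_
    have h1 := h _ (hdeg t)
    rw [hp, map_add, map_smul, smul_eq_mul] at h1
    simp only [eval_mul, eval_add, eval_C, eval_X, eval_zero]
    rw [← h1]
    ring
  have hp0 : p = 0 := by
    refine (mul_eq_zero.mp hmul).resolve_left fun h0 => hL ?_
    have := congrArg (fun q => coeff q 1) h0
    simpa [coeff_C] using this
  have := hp 0
  rwa [hp0, eval_zero, zero_smul, add_zero] at this

theorem maxDeg_mono (T : ℂ[X] →ₗ[ℂ] ℂ[X]) {m n : ℕ} (h : m ≤ n) : maxDeg T m ≤ maxDeg T n := by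
  obtain ⟨f, hf, hfm⟩ := (isGreatest_maxDeg T m).1
  rw [← hfm]
  exact natDegree_map_le_maxDeg T
    ((natDegree_le_iff_degree_le.mpr (mem_degreeLE.mp hf)).trans h)

theorem exists_coeff_maxDeg_ne_zero {T : ℂ[X] →ₗ[ℂ] ℂ[X]} {n : ℕ} {g : ℂ[X]}
    (hg : g.natDegree ≤ n) (hTg : T g ≠ 0) :
    ∃ f : ℂ[X], f.natDegree ≤ n ∧ (T f).coeff (maxDeg T n) ≠ 0 := by
  obtain ⟨f, hf, hfm⟩ := (isGreatest_maxDeg T n).1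
  have hf' : f.natDegree ≤ n := natDegree_le_iff_degree_le.mpr (mem_degreeLE.mp hf)
  by_cases h0 : T f = 0
  · refine ⟨g, hg, ?_⟩
    have h1 := natDegree_map_le_maxDeg T hg
    have h2 : maxDeg T n = 0 := by rw [← hfm]; simp [h0]
    rw [h2] at h1 ⊢
    have h3 := Nat.le_zero.mp h1
    rw [eq_C_of_natDegree_eq_zero h3] at hTg
    exact fun h4 => hTg (by rw [h4, C_0])
  · refine ⟨f, hf', ?_⟩
    rw [← hfm]
    exact leadingCoeff_ne_zero.mpr h0

/-- If p in π(circle) has degree n and T p has the full degree m, both are fixed up to scalars by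
conjugate reversal at the levels n and m, so `reflectOp` sends p to a multiple of T p. Images of
lower degree are excluded by multiplying the minors with the m-th coefficient of T p, a factor that
is cancelled after the identity is extended to all polynomials. -/
theorem reflectOp_eq_smul {T : ℂ[X] →ₗ[ℂ] ℂ[X]} (hT : Preserves unitCircle T) {x y : ℂ[X]}
    (hxy : LinearIndependent ℂ ![T x, T y]) {n : ℕ} (hx : x.natDegree ≤ n)
    (hy : y.natDegree ≤ n) :
    ∃ c : ℂ, ∀ f : ℂ[X], f.natDegree ≤ n → reflectOp T n (maxDeg T n) f = c • T f := by
  set m := maxDeg T n with hm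
  have hmemLE : ∀ f : ℂ[X], f.natDegree ≤ n ↔ f ∈ polyLE n := fun f => by
    rw [mem_degreeLE, natDegree_le_iff_degree_le]
  obtain ⟨g, hg, hgm⟩ := exists_coeff_maxDeg_ne_zero hx
    (show T x ≠ 0 by simpa using hxy.ne_zero 0)
  have hprop : ∀ f : ℂ[X], f.natDegree ≤ n → T f ≠ 0 →
      ∃ c : ℂ, reflectOp T n m f = c • T f := fun f hf hTf => by
    refine exists_smul_eq_of_coeff_mul_eq hTf fun i j => ?_
    have hpoly := ((PolyOnLines.of_linear ((lcoeff ℂ i).comp T)).mul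
        (PolyOnLines.of_linear ((lcoeff ℂ j).comp (reflectOp T n m)))).sub
      ((PolyOnLines.of_linear ((lcoeff ℂ j).comp T)).mul
        (PolyOnLines.of_linear ((lcoeff ℂ i).comp (reflectOp T n m))))
    refine hpoly.eq_zero_of_mul (L := (lcoeff ℂ m).comp T) (fun q hq => ?_) hg hgm hf
    refine ((PolyOnLines.of_linear ((lcoeff ℂ m).comp T)).mul hpoly).eq_zero (n := n)
      infinite_unitCircle (fun p hp hpn => ?_) hq
    by_cases h0 : (T p).coeff m = 0
    · simp only [LinearMap.comp_apply, lcoeff_apply, h0, zero_mul]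
    have hTp : T p ∈ zerosIn unitCircle := by
      refine (hT p hp).resolve_right fun h1 => h0 ?_
      rw [Set.mem_singleton_iff.mp h1, coeff_zero]
    have hdeg : (T p).natDegree = m := le_antisymm (natDegree_map_le_maxDeg T hpn.le)
      (le_natDegree_of_ne_zero h0)
    obtain ⟨c, hc⟩ := conjReflect_mem_zerosIn hp
    obtain ⟨d, hd⟩ := conjReflect_mem_zerosIn hTp
    rw [hpn] at hc
    rw [hdeg] at hd
    have : reflectOp T n m p = (starRingEnd ℂ c * d) • T p := by
      rw [reflectOp_apply, hc, map_smul, conjReflect_smul, hd, smul_smul]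
    simp only [LinearMap.comp_apply, lcoeff_apply, this, coeff_smul, smul_eq_mul]
    ring
  obtain ⟨c, hc⟩ := exists_eq_smul_of_proportional (A := T.domRestrict (polyLE n))
    (B := (reflectOp T n m).domRestrict (polyLE n))
    (fun v hv => hprop v ((hmemLE v).mpr v.2) hv)
    (x := ⟨x, (hmemLE x).mp hx⟩) (y := ⟨y, (hmemLE y).mp hy⟩) hxy
  exact ⟨c, fun f hf => hc ⟨f, (hmemLE f).mp hf⟩⟩

/-- Passing from level n to n + 1 multiplies the reversal on the source by X and on the target by
X^k, k being the increase of `maxDeg`. Comparing the two proportionalities gives the recursion. -/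
theorem map_X_mul_eq {T : ℂ[X] →ₗ[ℂ] ℂ[X]} (hT : Preserves unitCircle T) {x y : ℂ[X]}
    (hxy : LinearIndependent ℂ ![T x, T y]) {n : ℕ} (hx : x.natDegree ≤ n)
    (hy : y.natDegree ≤ n) :
    ∃ (d : ℂ) (k : ℕ), ∀ g : ℂ[X], g.natDegree ≤ n → T (X * g) = (C d * X ^ k) * T g := by
  obtain ⟨c, hc⟩ := reflectOp_eq_smul hT hxy hx hy
  obtain ⟨c', hc'⟩ := reflectOp_eq_smul hT hxy (n := n + 1) (by omega) (by omega)
  obtain ⟨k, hk⟩ := Nat.exists_eq_add_of_le (maxDeg_mono T (Nat.le_succ n))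
  refine ⟨starRingEnd ℂ c' * c, k, fun g hg => ?_⟩
  have hf := natDegree_conjReflect_le hg
  have h1 := hc g hg
  have h2 := hc' (conjReflect n g) (by omega)
  rw [reflectOp_apply, conjReflect_add_deg 1 hf, conjReflect_conjReflect, pow_one] at h2
  have h3 := congrArg (conjReflect (maxDeg T (n + 1))) h2
  rw [conjReflect_conjReflect, conjReflect_smul, hk,
    conjReflect_add_deg k (natDegree_map_le_maxDeg T hf), ← reflectOp_apply, h1] at h3
  rw [h3, smul_eq_C_mul, smul_eq_C_mul, C_mul]
  ring

/-- A preserver of `π` of the unit circle of rank at least two is of the form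
`f ↦ P * f (d * z ^ k)`. -/
theorem exists_eq_mul_comp_of_preserves_unitCircle {T : ℂ[X] →ₗ[ℂ] ℂ[X]}
    (hT : Preserves unitCircle T) {x y : ℂ[X]} (hxy : LinearIndependent ℂ ![T x, T y]) :
    ∃ (P : ℂ[X]) (d : ℂ) (k : ℕ), P ∈ zerosIn unitCircle ∧ ‖d‖ = 1 ∧ k ≠ 0 ∧
      ∀ f, T f = P * f.comp (C d * X ^ k) := by
  set n₀ := max x.natDegree y.natDegree with hn₀
  have hX : ∀ n, n₀ ≤ n → ∃ (d : ℂ) (k : ℕ), ∀ g : ℂ[X], g.natDegree ≤ n →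
      T (X * g) = (C d * X ^ k) * T g := fun n hn =>
    map_X_mul_eq hT hxy ((le_max_left _ _).trans hn) ((le_max_right _ _).trans hn)
  have hTx : T x ≠ 0 := by simpa using hxy.ne_zero 0
  have hT1 : T 1 ≠ 0 := by
    intro h0
    have hall : ∀ i, T (X ^ i) = 0 := fun i => by
      induction i with
      | zero => rw [pow_zero, h0]
      | succ i ih =>
        obtain ⟨d, k, h⟩ := hX (max n₀ i) (le_max_left _ _)
        rw [pow_succ', h _ (by rw [natDegree_X_pow]; exact le_max_right _ _), ih, mul_zero]
    refine hTx ?_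
    have := map_eq_mul_comp (T := T) (P := 0) (V := 0) (fun k => by rw [hall, zero_mul]) x
    rw [this, zero_mul]
  obtain ⟨d, k, hdk⟩ := hX n₀ le_rfl
  set V : ℂ[X] := C d * X ^ k with hV
  have hTX : T X = V * T 1 := by
    have := hdk 1 (by simp)
    rwa [mul_one] at this
  have hpow : ∀ i, T (X ^ i) = T 1 * V ^ i := fun i => by
    induction i with
    | zero => simp
    | succ i ih =>
      -- The multiplier obtained at a larger level is the same one, since T(X) = V T(1) already
      -- determines it.
      obtain ⟨d', k', h⟩ := hX (max n₀ i) (le_max_left _ _)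
      have h1 := h 1 (by simp)
      rw [mul_one, hTX] at h1
      have h2 : C d' * X ^ k' = V := (mul_right_cancel₀ hT1 h1).symm
      rw [pow_succ', h _ (by rw [natDegree_X_pow]; exact le_max_right _ _), ih, h2]
      ring
  have hcomp := map_eq_mul_comp hpow
  have hnc : ∀ s : ℂ, V ≠ C s := fun s hs => by
    have hmul : ∀ f, T f = f.eval s • T 1 := fun f => by
      rw [hcomp, hs, comp_C, smul_eq_C_mul, mul_comm]
    rw [LinearIndependent.pair_iff] at hxy
    have := hxy (y.eval s) (-x.eval s) (by rw [hmul x, hmul y]; module)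
    rw [hmul x, neg_eq_zero.mp this.2, zero_smul] at hTx
    exact hTx rfl
  have hd0 : d ≠ 0 := by
    rintro rfl
    exact hnc 0 (by rw [hV, C_0, zero_mul])
  have hk0 : k ≠ 0 := by
    rintro rfl
    exact hnc d (by rw [hV, pow_zero, mul_one])
  have h1mem : (1 : ℂ[X]) ∈ zerosIn unitCircle := by
    simpa using C_mem_zerosIn unitCircle one_ne_zero
  have hP : T 1 ∈ zerosIn unitCircle := (hT 1 h1mem).resolve_right hT1
  refine ⟨T 1, d, k, hP, ?_, hk0, hcomp⟩
  have h1 : T (X - C 1) = T 1 * (V - C 1) := by rw [hcomp]; simp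
  have h2 : T (X - C 1) ∈ zerosIn unitCircle := by
    refine (hT _ (X_sub_C_mem_zerosIn (s := 1) (by simp [unitCircle]))).resolve_right fun h => ?_
    rw [Set.mem_singleton_iff, h1, mul_eq_zero] at h
    exact h.elim hT1 fun h => hnc 1 (sub_eq_zero.mp h)
  -- A solution of d z^k = 1 is a zero of T(X - 1), so it has modulus one and |d| = 1.
  obtain ⟨z, hz⟩ := IsAlgClosed.exists_pow_nat_eq d⁻¹ (Nat.pos_of_ne_zero hk0)
  have hz1 : ‖z‖ = 1 := by
    refine h2.2 z ?_
    rw [IsRoot, h1, hV, eval_mul, eval_sub, eval_mul, eval_C, eval_C, eval_pow, eval_X, hz,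
      mul_inv_cancel₀ hd0, sub_self, mul_zero]
  have h3 := congrArg norm hz
  rw [norm_pow, hz1, one_pow, norm_inv] at h3
  exact inv_eq_one.mp h3.symm

/-! ### The Hermitian form of a Möbius transformation -/

/-- `Im ((a z + b) * conj (c z + d))`, which has the sign of the imaginary part of
`(a z + b) / (c z + d)`. -/
noncomputable def mobiusForm (a b c d z : ℂ) : ℝ :=
  ((a * z + b) * starRingEnd ℂ (c * z + d)).im

theorem mobiusForm_eq (a b c d z : ℂ) : mobiusForm a b c d z =
    Complex.normSq (c * z + d) * ((a * z + b) / (c * z + d)).im := by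
  rcases eq_or_ne (c * z + d) 0 with h | h
  · simp [mobiusForm, h]
  · have h1 : (a * z + b) * starRingEnd ℂ (c * z + d) =
        (Complex.normSq (c * z + d) : ℂ) * ((a * z + b) / (c * z + d)) := by
      rw [Complex.normSq_eq_conj_mul_self, mul_assoc, mul_div_cancel₀ _ h, mul_comm]
    rw [mobiusForm, h1, Complex.im_ofReal_mul]

theorem mobiusDomain_eq (a b c d : ℂ) : mobiusDomain a b c d = {z | 0 < mobiusForm a b c d z} := by
  ext z
  simp only [mobiusDomain, Set.mem_ofPred_eq, mobiusForm_eq]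
  rcases eq_or_ne (c * z + d) 0 with h | h
  · simp [h]
  · have : 0 < Complex.normSq (c * z + d) := Complex.normSq_pos.mpr h
    simp [h, this]

/-- Completing the square. The form has |z|²-coefficient A = Im(a conj c), and the sign of A decides
whether its positive set is a disk (A < 0), a half-plane (A = 0) or the exterior of a disk (A > 0).
-/
theorem four_mul_mobiusForm (a b c d z : ℂ) :
    4 * (a * starRingEnd ℂ c).im * mobiusForm a b c d z =
      Complex.normSq (2 * ((a * starRingEnd ℂ c).im : ℂ) * z +
        Complex.I * starRingEnd ℂ (a * starRingEnd ℂ d - starRingEnd ℂ b * c)) -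
      Complex.normSq (a * d - b * c) := by
  simp only [mobiusForm, Complex.normSq_apply, Complex.mul_im, Complex.mul_re, Complex.add_re,
    Complex.add_im, Complex.sub_re, Complex.sub_im, Complex.conj_re, Complex.conj_im,
    Complex.ofReal_re, Complex.ofReal_im, Complex.I_re, Complex.I_im, map_sub, map_mul,
    Complex.re_ofNat, Complex.im_ofNat]
  ring

theorem mobiusForm_eq_of_im_eq_zero {a b c d : ℂ} (h : (a * starRingEnd ℂ c).im = 0) (z : ℂ) :
    mobiusForm a b c d z =
      ((a * starRingEnd ℂ d - starRingEnd ℂ b * c) * z).im + (b * starRingEnd ℂ d).im := by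
  have h1 : mobiusForm a b c d z = (a * starRingEnd ℂ c).im * Complex.normSq z +
      ((a * starRingEnd ℂ d - starRingEnd ℂ b * c) * z).im + (b * starRingEnd ℂ d).im := by
    simp only [mobiusForm, Complex.normSq_apply, Complex.mul_im, Complex.mul_re, Complex.add_re,
      Complex.add_im, Complex.sub_re, Complex.sub_im, Complex.conj_re, Complex.conj_im]
    ring
  rw [h1, h, zero_mul, zero_add]

/-- If `Φ⁻¹(H)` is unbounded and not a half-plane, it is the image of the exterior of the unit disk
under an affine map. -/
theorem exists_affine_mobiusForm_eq {a b c d : ℂ} (hdet : a * d - b * c ≠ 0)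
    (hunb : ¬ Bornology.IsBounded (mobiusDomain a b c d))
    (hhalf : ¬ IsOpenHalfPlane (mobiusDomain a b c d)) :
    0 < (a * starRingEnd ℂ c).im ∧ ∃ (ρ : ℝ) (α β : ℂ), 0 < ρ ∧ α ≠ 0 ∧
      ∀ z, mobiusForm a b c d (α * z + β) = ρ * (‖z‖ ^ 2 - 1) := by
  have hΔ : 0 < Complex.normSq (a * d - b * c) := Complex.normSq_pos.mpr hdet
  have hA := four_mul_mobiusForm a b c d
  have hA0 := mobiusForm_eq_of_im_eq_zero (a := a) (b := b) (c := c) (d := d)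
  set A := (a * starRingEnd ℂ c).im with hAdef
  set u := a * starRingEnd ℂ d - starRingEnd ℂ b * c with hu
  rcases lt_trichotomy A 0 with h | h | h
  · refine absurd ?_ hunb
    rw [mobiusDomain_eq, Metric.isBounded_iff_subset_ball (-(Complex.I * starRingEnd ℂ u) / (2 * A))]
    refine ⟨‖a * d - b * c‖ / (2 * |A|), fun z hz => ?_⟩
    have h1 : 4 * A * mobiusForm a b c d z < 0 := by
      have : 0 < mobiusForm a b c d z := hz
      nlinarith
    rw [hA, sub_neg, Complex.normSq_eq_norm_sq, Complex.normSq_eq_norm_sq,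
      sq_lt_sq, abs_norm, abs_norm] at h1
    have hA1 : (A : ℂ) ≠ 0 := by exact_mod_cast h.ne
    have h2 : 2 * (A : ℂ) * z + Complex.I * starRingEnd ℂ u =
        (2 * A) * (z - -(Complex.I * starRingEnd ℂ u) / (2 * A)) := by
      field_simp; ring
    have hA2 : 0 < 2 * |A| := mul_pos two_pos (abs_pos.mpr h.ne)
    rw [h2, norm_mul, norm_mul, Complex.norm_real, Real.norm_eq_abs, Complex.norm_ofNat] at h1
    rw [Metric.mem_ball, dist_eq_norm, lt_div_iff₀ hA2, mul_comm]
    exact h1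
  · refine absurd ⟨u, -(b * starRingEnd ℂ d).im, ?_, ?_⟩ hhalf
    · intro h0
      have := hA 0
      rw [h, h0] at this
      simp at this
      exact hdet this
    · rw [mobiusDomain_eq]
      ext z
      simp only [Set.mem_ofPred_eq, hA0 h z]
      constructor <;> intro <;> linarith
  · have hA1 : (A : ℂ) ≠ 0 := by exact_mod_cast h.ne'
    refine ⟨h, Complex.normSq (a * d - b * c) / (4 * A), ‖a * d - b * c‖ / (2 * A),
      -(Complex.I * starRingEnd ℂ u) / (2 * A), by positivity, ?_, fun z => ?_⟩
    · exact div_ne_zero (by simpa using hdet) (by simpa using h.ne')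
    · have h1 := hA (‖a * d - b * c‖ / (2 * A) * z + -(Complex.I * starRingEnd ℂ u) / (2 * A))
      have h2 : 2 * (A : ℂ) * (‖a * d - b * c‖ / (2 * A) * z +
          -(Complex.I * starRingEnd ℂ u) / (2 * A)) + Complex.I * starRingEnd ℂ u =
          ‖a * d - b * c‖ * z := by
        field_simp; ring
      rw [h2, Complex.normSq_mul, Complex.normSq_ofReal, ← sq, ← Complex.normSq_eq_norm_sq] at h1
      rw [← Complex.normSq_eq_norm_sq z]
      generalize mobiusForm a b c d _ = M at h1 ⊢
      field_simp
      linear_combination h1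

/-- The hypothesis is Φ(w) = -Φ(y) cleared of denominators, and z ↦ -z exchanges the two
half-planes. -/
theorem mobiusForm_neg_of_add_eq_zero {a b c d : ℂ} (hdet : a * d - b * c ≠ 0) {y w : ℂ}
    (h : (a * y + b) * (c * w + d) + (a * w + b) * (c * y + d) = 0) :
    (0 < mobiusForm a b c d y → mobiusForm a b c d w < 0) ∧
      (mobiusForm a b c d y < 0 → 0 < mobiusForm a b c d w) := by
  have h1 : mobiusForm a b c d y * Complex.normSq (c * w + d) +
      mobiusForm a b c d w * Complex.normSq (c * y + d) = 0 := by
    have h2 : ((a * y + b) * starRingEnd ℂ (c * y + d)) * (Complex.normSq (c * w + d) : ℂ) +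
        ((a * w + b) * starRingEnd ℂ (c * w + d)) * (Complex.normSq (c * y + d) : ℂ) = 0 := by
      rw [Complex.normSq_eq_conj_mul_self, Complex.normSq_eq_conj_mul_self]
      linear_combination starRingEnd ℂ (c * y + d) * starRingEnd ℂ (c * w + d) * h
    have h3 := congrArg Complex.im h2
    rwa [Complex.add_im, Complex.im_mul_ofReal, Complex.im_mul_ofReal, Complex.zero_im] at h3
  have hw : mobiusForm a b c d y ≠ 0 → 0 < Complex.normSq (c * w + d) := fun hy => by
    refine Complex.normSq_pos.mpr fun h0 => ?_
    rw [h0, mul_zero, zero_add] at h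
    have hy0 : c * y + d ≠ 0 := fun h0 => hy (by simp [mobiusForm, h0])
    have h3 := (mul_eq_zero.mp h).resolve_right hy0
    exact hdet (by linear_combination a * h0 - c * h3)
  have h4 := Complex.normSq_nonneg (c * y + d)
  constructor <;> intro hy
  · have := hw hy.ne'
    by_contra! h5
    nlinarith [mul_pos hy this, mul_nonneg h5 h4]
  · have := hw hy.ne
    by_contra! h5
    nlinarith [mul_pos (neg_pos.mpr hy) this, mul_nonneg (neg_nonneg.mpr h5) h4]

/-- Here Φ(y) = -a/c = -Φ(∞), and Φ(∞) lies in the upper half-plane because Im(a conj c) > 0. -/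
theorem mobiusForm_neg_of_antipode {a b c d : ℂ} (hdet : a * d - b * c ≠ 0)
    (hA : 0 < (a * starRingEnd ℂ c).im) {y : ℂ} (hy : 2 * a * c * y + (a * d + b * c) = 0) :
    mobiusForm a b c d y < 0 := by
  have hc : c ≠ 0 := by rintro rfl; simp at hA
  have hy0 : c * y + d ≠ 0 := fun h0 => by
    have : c * (a * y + b) = 0 := by linear_combination hy - a * h0
    have h3 := (mul_eq_zero.mp this).resolve_left hc
    exact hdet (by linear_combination a * h0 - c * h3)
  have h1 : ((a * y + b) * starRingEnd ℂ (c * y + d)) * (Complex.normSq c : ℂ) =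
      -((a * starRingEnd ℂ c) * (Complex.normSq (c * y + d) : ℂ)) := by
    rw [Complex.normSq_eq_conj_mul_self, Complex.normSq_eq_conj_mul_self]
    linear_combination starRingEnd ℂ c * starRingEnd ℂ (c * y + d) * hy
  have h2 := congrArg Complex.im h1
  rw [Complex.neg_im, Complex.im_mul_ofReal, Complex.im_mul_ofReal] at h2
  have h3 : 0 < Complex.normSq (c * y + d) := Complex.normSq_pos.mpr hy0
  have h4 : 0 < Complex.normSq c := Complex.normSq_pos.mpr hc
  change ((a * y + b) * starRingEnd ℂ (c * y + d)).im < 0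
  by_contra! h5
  nlinarith [mul_pos hA h3, mul_nonneg h5 h4.le]

/-! ### Affine changes of variables -/

theorem preimage_frontier_affine {α : ℂ} (hα : α ≠ 0) (β : ℂ) (D : Set ℂ) :
    (fun z => α * z + β) ⁻¹' frontier D = frontier ((fun z => α * z + β) ⁻¹' D) :=
  ((Homeomorph.mulLeft₀ α hα).trans (Homeomorph.addRight β)).preimage_frontier D

theorem preimage_interior_affine {α : ℂ} (hα : α ≠ 0) (β : ℂ) (D : Set ℂ) :
    (fun z => α * z + β) ⁻¹' interior D = interior ((fun z => α * z + β) ⁻¹' D) :=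
  ((Homeomorph.mulLeft₀ α hα).trans (Homeomorph.addRight β)).preimage_interior D

theorem mem_iff_of_preimage_affine {α : ℂ} (hα : α ≠ 0) {β : ℂ} {D : Set ℂ} {p : ℂ → Prop}
    (h : ∀ z, α * z + β ∈ D ↔ p (α * z + β)) (z : ℂ) : z ∈ D ↔ p z := by
  have := h (α⁻¹ * (z - β))
  rwa [mul_inv_cancel_left₀ hα, sub_add_cancel] at this

theorem mem_frontier_line {α : ℂ} (hα : α ≠ 0) {β : ℂ} {D : Set ℂ}
    (h : ∀ z, α * z + β ∈ D ↔ 0 < z.im) (z : ℂ) : α * z + β ∈ frontier D ↔ z ∈ realLine := by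
  change z ∈ (fun z => α * z + β) ⁻¹' frontier D ↔ _
  have : (fun z => α * z + β) ⁻¹' D = {z | 0 < z.im} := Set.ext h
  rw [preimage_frontier_affine hα, this, Complex.frontier_setOfPred_lt_im]
  rfl

theorem mem_interior_compl_line {α : ℂ} (hα : α ≠ 0) {β : ℂ} {D : Set ℂ}
    (h : ∀ z, α * z + β ∈ D ↔ 0 < z.im) (z : ℂ) : α * z + β ∈ interior Dᶜ ↔ z.im < 0 := by
  change z ∈ (fun z => α * z + β) ⁻¹' interior Dᶜ ↔ _
  have : (fun z => α * z + β) ⁻¹' Dᶜ = {z | z.im ≤ 0} := by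
    ext z
    change ¬ (α * z + β ∈ D) ↔ _
    rw [h, not_lt]; rfl
  rw [preimage_interior_affine hα, this, Complex.interior_setOfPred_im_le]
  rfl

theorem mem_frontier_circle {α : ℂ} (hα : α ≠ 0) {β : ℂ} {D : Set ℂ}
    (h : ∀ z, α * z + β ∈ D ↔ 1 < ‖z‖) (z : ℂ) : α * z + β ∈ frontier D ↔ z ∈ unitCircle := by
  change z ∈ (fun z => α * z + β) ⁻¹' frontier D ↔ _
  have : (fun z => α * z + β) ⁻¹' D = (Metric.closedBall 0 1)ᶜ := by
    ext z
    change α * z + β ∈ D ↔ _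
    simp [h]
  rw [preimage_frontier_affine hα, this, frontier_compl, frontier_closedBall _ one_ne_zero,
    unitCircle_eq_sphere]

theorem mem_interior_compl_circle {α : ℂ} (hα : α ≠ 0) {β : ℂ} {D : Set ℂ}
    (h : ∀ z, α * z + β ∈ D ↔ 1 < ‖z‖) (z : ℂ) : α * z + β ∈ interior Dᶜ ↔ ‖z‖ < 1 := by
  change z ∈ (fun z => α * z + β) ⁻¹' interior Dᶜ ↔ _
  have : (fun z => α * z + β) ⁻¹' Dᶜ = Metric.closedBall 0 1 := by
    ext z
    change ¬ (α * z + β ∈ D) ↔ _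
    simp [h]
  rw [preimage_interior_affine hα, this, interior_closedBall _ one_ne_zero]
  simp

/-- The operator `T` in the variable `ζ`, where `z = α ζ + β`. -/
noncomputable def affineConj (α β : ℂ) (T : ℂ[X] →ₗ[ℂ] ℂ[X]) : ℂ[X] →ₗ[ℂ] ℂ[X] :=
  (aeval (C α * X + C β)).toLinearMap ∘ₗ T ∘ₗ (aeval (C α⁻¹ * (X - C β))).toLinearMap

theorem affineConj_apply (α β : ℂ) (T : ℂ[X] →ₗ[ℂ] ℂ[X]) (f : ℂ[X]) :
    affineConj α β T f = (T (f.comp (C α⁻¹ * (X - C β)))).comp (C α * X + C β) := by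
  simp [affineConj, comp_eq_aeval]

theorem eval_affineConj (α β : ℂ) (T : ℂ[X] →ₗ[ℂ] ℂ[X]) (f : ℂ[X]) (z : ℂ) :
    (affineConj α β T f).eval z = (T (f.comp (C α⁻¹ * (X - C β)))).eval (α * z + β) := by
  simp [affineConj_apply]

theorem comp_affine_comp {α : ℂ} (hα : α ≠ 0) (β : ℂ) (f : ℂ[X]) :
    (f.comp (C α * X + C β)).comp (C α⁻¹ * (X - C β)) = f := by
  rw [comp_assoc]
  have : (C α * X + C β : ℂ[X]).comp (C α⁻¹ * (X - C β)) = X := by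
    simp only [add_comp, mul_comp, C_comp, X_comp]
    rw [← mul_assoc, ← C_mul, mul_inv_cancel₀ hα, C_1]; ring
  rw [this, comp_X]

theorem comp_affine_inv_comp {α : ℂ} (hα : α ≠ 0) (β : ℂ) (f : ℂ[X]) :
    (f.comp (C α⁻¹ * (X - C β))).comp (C α * X + C β) = f := by
  rw [comp_assoc]
  have : (C α⁻¹ * (X - C β) : ℂ[X]).comp (C α * X + C β) = X := by
    simp only [sub_comp, mul_comp, C_comp, X_comp, add_sub_cancel_right]
    rw [← mul_assoc, ← C_mul, inv_mul_cancel₀ hα, C_1, one_mul]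
  rw [this, comp_X]

theorem affineConj_comp {α : ℂ} (hα : α ≠ 0) (β : ℂ) (T : ℂ[X] →ₗ[ℂ] ℂ[X]) (f : ℂ[X]) :
    affineConj α β T (f.comp (C α * X + C β)) = (T f).comp (C α * X + C β) := by
  rw [affineConj_apply, comp_affine_comp hα]

theorem eval_apply_affine {α : ℂ} (hα : α ≠ 0) (β : ℂ) (T : ℂ[X] →ₗ[ℂ] ℂ[X]) (f : ℂ[X]) (z : ℂ) :
    (T f).eval (α * z + β) = (affineConj α β T (f.comp (C α * X + C β))).eval z := by
  rw [affineConj_comp hα]; simp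

theorem comp_affine_mem_zerosIn {α : ℂ} (hα : α ≠ 0) {β : ℂ} {F S : Set ℂ}
    (h : ∀ z, α * z + β ∈ F ↔ z ∈ S) (f : ℂ[X]) :
    f.comp (C α * X + C β) ∈ zerosIn S ↔ f ∈ zerosIn F := by
  constructor
  · rintro ⟨h0, hz⟩
    refine ⟨fun hf => h0 (by rw [hf, zero_comp]), fun z hfz => ?_⟩
    have hzz : α * (α⁻¹ * (z - β)) + β = z := by rw [mul_inv_cancel_left₀ hα, sub_add_cancel]
    have := (h (α⁻¹ * (z - β))).mpr (hz _ (by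
      simp only [IsRoot, eval_comp, eval_add, eval_mul, eval_C, eval_X, hzz]
      exact hfz))
    rwa [hzz] at this
  · rintro ⟨h0, hz⟩
    refine ⟨fun hf => h0 (by rw [← comp_affine_comp hα β f, hf, zero_comp]), fun z hfz => ?_⟩
    exact (h z).mp (hz _ (by simpa [IsRoot] using hfz))

theorem preserves_affineConj_iff {α : ℂ} (hα : α ≠ 0) {β : ℂ} {F S : Set ℂ}
    (h : ∀ z, α * z + β ∈ F ↔ z ∈ S) (T : ℂ[X] →ₗ[ℂ] ℂ[X]) :
    Preserves S (affineConj α β T) ↔ Preserves F T := by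
  constructor
  · intro hT f hf
    rcases hT _ ((comp_affine_mem_zerosIn hα h f).mpr hf) with h1 | h1
    · left
      rwa [affineConj_comp hα, comp_affine_mem_zerosIn hα h] at h1
    · right
      rw [Set.mem_singleton_iff, affineConj_comp hα] at h1
      rw [Set.mem_singleton_iff, ← comp_affine_comp hα β (T f), h1, zero_comp]
  · intro hT f hf
    have hf' : f.comp (C α⁻¹ * (X - C β)) ∈ zerosIn F := by
      rwa [← comp_affine_mem_zerosIn hα h, comp_affine_inv_comp hα]
    rw [affineConj_apply]
    rcases hT _ hf' with h1 | h1
    · left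
      rwa [comp_affine_mem_zerosIn hα h]
    · right
      rw [Set.mem_singleton_iff] at h1 ⊢
      rw [h1, zero_comp]

theorem linearIndependent_affineConj {α : ℂ} (hα : α ≠ 0) (β : ℂ) {T : ℂ[X] →ₗ[ℂ] ℂ[X]} {x y : ℂ[X]}
    (h : LinearIndependent ℂ ![T x, T y]) : ∃ x' y',
      LinearIndependent ℂ ![affineConj α β T x', affineConj α β T y'] := by
  refine ⟨x.comp (C α * X + C β), y.comp (C α * X + C β), ?_⟩
  rw [affineConj_comp hα, affineConj_comp hα]
  rw [LinearIndependent.pair_iff] at h ⊢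
  intro s t hst
  refine h s t ?_
  have := congrArg (fun p => p.comp (C α⁻¹ * (X - C β))) hst
  simpa only [add_comp, smul_comp, comp_affine_comp hα, zero_comp] using this

/-! ### Symbols -/

theorem extend_eq_zero_iff_evalEval (T : ℂ[X] →ₗ[ℂ] ℂ[X]) (F : ℂ[X][X]) :
    extend T F = 0 ↔ ∀ z w : ℂ, (extend T F).evalEval z w = 0 := by
  refine ⟨fun h z w => by rw [h]; simp, fun h => ?_⟩
  rw [extend_eq_zero_iff]
  refine fun w => Polynomial.funext fun z => ?_
  rw [← evalEval_extend, h, eval_zero]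

theorem eval_plusKernel (a b c d w : ℂ) : (plusKernel a b c d).eval (C w) =
    (C a * X + C b) * C (c * w + d) + C (a * w + b) * (C c * X + C d) := by
  simp [plusKernel]

theorem eval_minusKernel (a b c d w : ℂ) : (minusKernel a b c d).eval (C w) =
    (C a * X + C b) * C (c * w + d) - C (a * w + b) * (C c * X + C d) := by
  simp [minusKernel]

theorem evalEval_extend_pow {T : ℂ[X] →ₗ[ℂ] ℂ[X]} {F : ℂ[X][X]} {α β κ ω w : ℂ}
    (hF : F.eval (C w) = C κ * (C α⁻¹ * (X - C β) + C ω)) (n : ℕ) (z : ℂ) :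
    (extend T (F ^ n)).evalEval (α * z + β) w =
      κ ^ n * (affineConj α β T ((X + C ω) ^ n)).eval z := by
  have h1 : (F ^ n).eval (C w) = κ ^ n • ((X + C ω) ^ n).comp (C α⁻¹ * (X - C β)) := by
    rw [eval_pow, hF, mul_pow, smul_eq_C_mul, C_pow]
    simp
  rw [evalEval_extend, h1, map_smul, eval_smul, smul_eq_mul, eval_affineConj]

/-- In the coordinates z = αζ + β, w = α(sω) + β the kernel is κ(ζ + ω), so its powers give the
symbols of the operator in the variable ζ. The factor s absorbs the sign that separates the two
kernels. -/
theorem extend_pow_stable_iff {T : ℂ[X] →ₗ[ℂ] ℂ[X]} {F : ℂ[X][X]} {α β κ s : ℂ} (hα : α ≠ 0)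
    (hs : s ≠ 0) (hκ : κ ≠ 0)
    (hF : ∀ ω, F.eval (C (α * (s * ω) + β)) = C κ * (C α⁻¹ * (X - C β) + C ω)) (n : ℕ)
    (U V : Set ℂ) :
    (extend T (F ^ n) = 0 ∨ (IsStableOn U (extend T (F ^ n)) ∧ IsStableOn V (extend T (F ^ n)))) ↔
      ((∀ ω, affineConj α β T ((X + C ω) ^ n) = 0) ∨ ∀ z ω,
        (α * z + β ∈ U ∧ α * (s * ω) + β ∈ U) ∨ (α * z + β ∈ V ∧ α * (s * ω) + β ∈ V) →
        (affineConj α β T ((X + C ω) ^ n)).eval z ≠ 0) := by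
  have hκn : κ ^ n ≠ 0 := pow_ne_zero n hκ
  have hsurj : ∀ z, ∃ z', z = α * z' + β := fun z =>
    ⟨α⁻¹ * (z - β), by rw [mul_inv_cancel_left₀ hα, sub_add_cancel]⟩
  have hsurj' : ∀ z, ∃ z', z = α * (s * z') + β := fun z => by
    obtain ⟨z', hz'⟩ := hsurj z
    exact ⟨s⁻¹ * z', by rw [mul_inv_cancel_left₀ hs, hz']⟩
  refine or_congr ?_ ?_
  · rw [extend_eq_zero_iff_evalEval]
    constructor
    · refine fun h ω => Polynomial.funext fun z => ?_
      have := h (α * z + β) (α * (s * ω) + β)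
      rw [evalEval_extend_pow (hF ω)] at this
      rw [(mul_eq_zero.mp this).resolve_left hκn, eval_zero]
    · intro h z w
      obtain ⟨z, rfl⟩ := hsurj z
      obtain ⟨w, rfl⟩ := hsurj' w
      rw [evalEval_extend_pow (hF w), h, eval_zero, mul_zero]
  · constructor
    · rintro ⟨h1, h2⟩ z ω (⟨hz, hw⟩ | ⟨hz, hw⟩) h0
      · exact h1 _ hz _ hw (by rw [evalEval_extend_pow (hF ω), h0, mul_zero])
      · exact h2 _ hz _ hw (by rw [evalEval_extend_pow (hF ω), h0, mul_zero])
    · refine fun h => ⟨fun z hz w hw => ?_, fun z hz w hw => ?_⟩ <;>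
      obtain ⟨z, rfl⟩ := hsurj z <;> obtain ⟨w, rfl⟩ := hsurj' w <;>
      rw [evalEval_extend_pow (hF w)]
      · exact mul_ne_zero hκn (h z w (Or.inl ⟨hz, hw⟩))
      · exact mul_ne_zero hκn (h z w (Or.inr ⟨hz, hw⟩))

theorem eval_plusKernel_line {a b d : ℂ} (ha : a ≠ 0) (hd : d ≠ 0) (ω : ℂ) :
    (plusKernel a b 0 d).eval (C (d / a * (1 * ω) + -b / a)) =
      C (d ^ 2) * (C (d / a)⁻¹ * (X - C (-b / a)) + C ω) := by
  rw [eval_plusKernel]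
  refine Polynomial.funext fun z => ?_
  simp only [eval_add, eval_mul, eval_C, eval_X, eval_sub]
  field_simp
  ring

theorem eval_minusKernel_line {a b d : ℂ} (ha : a ≠ 0) (hd : d ≠ 0) (ω : ℂ) :
    (minusKernel a b 0 d).eval (C (d / a * (-1 * ω) + -b / a)) =
      C (d ^ 2) * (C (d / a)⁻¹ * (X - C (-b / a)) + C ω) := by
  rw [eval_minusKernel]
  refine Polynomial.funext fun z => ?_
  simp only [eval_add, eval_mul, eval_C, eval_X, eval_sub]
  field_simp
  ring

theorem eval_minusKernel_affine {α : ℂ} (hα : α ≠ 0) (a b c d β ω : ℂ) :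
    (minusKernel a b c d).eval (C (α * (-1 * ω) + β)) =
      C ((a * d - b * c) * α) * (C α⁻¹ * (X - C β) + C ω) := by
  rw [eval_minusKernel]
  refine Polynomial.funext fun z => ?_
  simp only [eval_add, eval_mul, eval_C, eval_X, eval_sub]
  field_simp
  ring

/-- The symbol of `plusKernel` at the point `w` with `Φ(w) = -Φ(y)`. -/
theorem eval_plusKernel_antipode {α : ℂ} (hα : α ≠ 0) {a b c d β ω w y : ℂ}
    (hy : y = β - α * ω)
    (hw : w * (2 * a * c * y + (a * d + b * c)) = -((a * d + b * c) * y + 2 * b * d)) :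
    (plusKernel a b c d).eval (C w) =
      C ((2 * a * c * w + (a * d + b * c)) * α) * (C α⁻¹ * (X - C β) + C ω) := by
  rw [eval_plusKernel]
  refine Polynomial.funext fun z => ?_
  simp only [eval_add, eval_mul, eval_C, eval_X, eval_sub]
  have h1 : α * (α⁻¹ * (z - β) + ω) = z - y := by
    rw [mul_add, mul_inv_cancel_left₀ hα, hy]; ring
  rw [mul_assoc _ α, h1]
  linear_combination hw

/-! ### Sufficiency of the stability conditions -/

section Line
variable {T : ℂ[X] →ₗ[ℂ] ℂ[X]} {α β s κ : ℂ} {D : Set ℂ} {F : ℂ[X][X]}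

theorem symbolStable_iff_line {e : ℝ} (he : e = 1 ∨ e = -1) (hα : α ≠ 0)
    (hD : ∀ z, α * z + β ∈ D ↔ 0 < z.im) (hκ : κ ≠ 0)
    (hF : ∀ ω, F.eval (C (α * ((e : ℂ) * ω) + β)) = C κ * (C α⁻¹ * (X - C β) + C ω)) (n : ℕ) :
    (extend T (F ^ n) = 0 ∨ (IsStableOn D (extend T (F ^ n)) ∧
      IsStableOn (interior Dᶜ) (extend T (F ^ n)))) ↔
    ((∀ w, affineConj α β T ((X + C w) ^ n) = 0) ∨ SymbolStable e (affineConj α β T) n) := by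
  have he0 : (e : ℂ) ≠ 0 := by rcases he with rfl | rfl <;> simp
  rw [extend_pow_stable_iff hα he0 hκ hF]
  refine or_congr Iff.rfl (forall₂_congr fun z w => ?_)
  refine imp_congr ?_ Iff.rfl
  rw [hD, hD, mem_interior_compl_line hα hD, mem_interior_compl_line hα hD, Complex.im_ofReal_mul]
  rw [show e * z.im * w.im = z.im * (e * w.im) by ring]
  exact mul_pos_iff.symm

end Line

section Circle
variable {T : ℂ[X] →ₗ[ℂ] ℂ[X]} {a b c d α β : ℂ} {D : Set ℂ}

theorem preserves_of_minusKernel_circle (hdet : a * d - b * c ≠ 0) (hα : α ≠ 0)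
    (hD : ∀ z, α * z + β ∈ D ↔ 1 < ‖z‖)
    (h : ∀ n, extend T (minusKernel a b c d ^ n) = 0 ∨
      (IsStableOn D (extend T (minusKernel a b c d ^ n)) ∧
        IsStableOn (interior Dᶜ) (extend T (minusKernel a b c d ^ n)))) :
    Preserves (frontier D) T := by
  rw [← preserves_affineConj_iff hα (mem_frontier_circle hα hD)]
  refine preserves_unitCircle_of_same_side fun n => ?_
  have := (extend_pow_stable_iff hα (neg_ne_zero.mpr one_ne_zero) (mul_ne_zero hdet hα)
    (eval_minusKernel_affine hα a b c d β) n D (interior Dᶜ)).mp (h n)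
  refine this.imp id fun h1 z w hzw => h1 z w ?_
  rw [hD, hD, mem_interior_compl_circle hα hD, mem_interior_compl_circle hα hD]
  simpa using hzw

/-- For y = β - αω, the point w with Φ(w) = -Φ(y) turns the kernel into a multiple of ζ + ω, where z
= αζ + β. It lies on the other side of the circle from y, so (c) becomes stability of the symbol for
ζ and ω on opposite sides of the unit circle. A single ω inside the disk is lost, the one whose w
would be infinite. -/
theorem preserves_of_plusKernel_circle (hdet : a * d - b * c ≠ 0)
    (hA : 0 < (a * starRingEnd ℂ c).im) (hα : α ≠ 0)
    (hD : ∀ z, α * z + β ∈ D ↔ 1 < ‖z‖)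
    (hpos : ∀ z, z ∈ D ↔ 0 < mobiusForm a b c d z)
    (hneg : ∀ z, z ∈ interior Dᶜ ↔ mobiusForm a b c d z < 0)
    (h : ∀ n, extend T (plusKernel a b c d ^ n) = 0 ∨
      (IsStableOn D (extend T (plusKernel a b c d ^ n)) ∧
        IsStableOn (interior Dᶜ) (extend T (plusKernel a b c d ^ n)))) :
    Preserves (frontier D) T := by
  have hac : 2 * a * c ≠ 0 := by
    rw [mul_assoc]
    refine mul_ne_zero two_ne_zero (mul_ne_zero ?_ ?_) <;> rintro rfl <;> simp at hA
  set B := a * d + b * c with hB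
  have hdisc : B ^ 2 - (2 * a * c) * (2 * b * d) = (a * d - b * c) ^ 2 := by rw [hB]; ring
  have hF := mem_frontier_circle hα hD
  have hI := mem_interior_compl_circle hα hD
  -- the antipode of a point `y = β - α ω`
  have key : ∀ ω : ℂ, 2 * a * c * (β - α * ω) + B ≠ 0 → ∃ w κ : ℂ, κ ≠ 0 ∧
      (plusKernel a b c d).eval (C w) = C κ * (C α⁻¹ * (X - C β) + C ω) ∧
      (a * (β - α * ω) + b) * (c * w + d) + (a * w + b) * (c * (β - α * ω) + d) = 0 := by
    intro ω hω
    set y := β - α * ω with hy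
    have hw : -(B * y + 2 * b * d) / (2 * a * c * y + B) * (2 * a * c * y + B) =
        -(B * y + 2 * b * d) := div_mul_cancel₀ _ hω
    refine ⟨-(B * y + 2 * b * d) / (2 * a * c * y + B), _, ?_, eval_plusKernel_antipode hα hy hw, ?_⟩
    · refine mul_ne_zero (fun h0 => ?_) hα
      generalize -(B * y + 2 * b * d) / (2 * a * c * y + B) = w at hw h0
      refine pow_ne_zero 2 hdet ?_
      rw [← hdisc]
      linear_combination (2 * a * c * y + B) * h0 - 2 * a * c * hw
    · generalize -(B * y + 2 * b * d) / (2 * a * c * y + B) = w at hw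
      linear_combination hw
  -- The point e satisfies Φ(e) = -Φ(∞). At w = e the kernel is a nonzero constant in z, so the
  -- hypothesis there is a statement about T(1).
  set e := -B / (2 * a * c) with he
  have hee : 2 * a * c * e + B = 0 := by
    rw [he, mul_div_cancel₀ _ hac, neg_add_cancel]
  have heneg := mobiusForm_neg_of_antipode hdet hA hee
  set η := α⁻¹ * (e - β) with hη
  have hηe : α * η + β = e := by rw [hη, mul_inv_cancel_left₀ hα, sub_add_cancel]
  have heta : ‖η‖ < 1 := by rw [← hI, hηe, hneg]; exact heneg
  have hne : ∀ ω, ω ≠ -η → 2 * a * c * (β - α * ω) + B ≠ 0 := fun ω hω h0 => by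
    have h1 : 2 * a * c * α * (ω + η) = 0 := by linear_combination hee - h0 + 2 * a * c * hηe
    rcases mul_eq_zero.mp h1 with h2 | h2
    · exact mul_ne_zero hac hα h2
    · exact hω (eq_neg_of_add_eq_zero_left h2)
  have hconst : (plusKernel a b c d).eval (C e) = C (B * e + 2 * b * d) := by
    rw [eval_plusKernel]
    refine Polynomial.funext fun z => ?_
    simp only [eval_add, eval_mul, eval_C, eval_X]
    linear_combination z * hee
  have hconst0 : B * e + 2 * b * d ≠ 0 := fun h0 => by
    refine pow_ne_zero 2 hdet ?_
    rw [← hdisc]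
    linear_combination B * hee - 2 * a * c * h0
  have hconstn : ∀ n z, (extend T (plusKernel a b c d ^ n)).evalEval z e =
      (B * e + 2 * b * d) ^ n * (T 1).eval z := fun n z => by
    rw [evalEval_extend, eval_pow, hconst, ← C_pow, ← mul_one (C _), ← smul_eq_C_mul, map_smul,
      eval_smul, smul_eq_mul]
  -- If T(1) = 0, the symbols vanish at (e, e) with e inside the circle, so none is stable and all
  -- are zero; then T = 0.
  by_cases hT1 : T 1 = 0
  · have hzero : ∀ n, extend T (plusKernel a b c d ^ n) = 0 := fun n => by
      refine (h n).resolve_right fun h1 => ?_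
      refine h1.2 e ((hneg e).mpr heneg) e ((hneg e).mpr heneg) ?_
      rw [hconstn, hT1, eval_zero, mul_zero]
    rw [← preserves_affineConj_iff hα hF]
    intro f _
    right
    refine map_eq_zero_of_pow_eq_zero (Set.finite_singleton (-η)).infinite_compl
      (fun ω hω => ?_) (le_refl f.natDegree)
    obtain ⟨w, κ, hκ, hK, -⟩ := key ω (hne ω hω)
    refine Polynomial.funext fun z => ?_
    have h1 := evalEval_extend_pow (T := T) hK f.natDegree z
    rw [hzero, evalEval_zero] at h1
    rw [(mul_eq_zero.mp h1.symm).resolve_left (pow_ne_zero _ hκ), eval_zero]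
  · have hst : ∀ n, IsStableOn D (extend T (plusKernel a b c d ^ n)) ∧
        IsStableOn (interior Dᶜ) (extend T (plusKernel a b c d ^ n)) := fun n => by
      refine (h n).resolve_left fun h1 => hT1 (Polynomial.funext fun z => ?_)
      have h2 := hconstn n z
      rw [h1] at h2
      rw [eval_zero]
      simpa [hconst0] using h2
    rw [← preserves_affineConj_iff hα hF]
    refine preserves_unitCircle_of_opposite_side (e := -η) (by rwa [norm_neg]) ?_ ?_ ?_
    · have h1 : (1 : ℂ[X]) = (1 : ℂ[X]).comp (C α * X + C β) := by simp
      rw [h1, affineConj_comp hα, comp_affine_mem_zerosIn hα hF]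
      refine ⟨hT1, fun z hz => ?_⟩
      have h2 : ∀ w, (extend T (plusKernel a b c d ^ 0)).evalEval z w = 0 := fun w => by
        rw [evalEval_extend, pow_zero, eval_one]; exact hz
      obtain ⟨z, rfl⟩ : ∃ z', z = α * z' + β :=
        ⟨α⁻¹ * (z - β), by rw [mul_inv_cancel_left₀ hα, sub_add_cancel]⟩
      rw [hF]
      rcases lt_trichotomy ‖z‖ 1 with h3 | h3 | h3
      · exact absurd (h2 _) ((hst 0).2 _ ((hI z).mpr h3) _ ((hI z).mpr h3))
      · exact h3
      · exact absurd (h2 _) ((hst 0).1 _ ((hD z).mpr h3) _ ((hD z).mpr h3))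
    · intro n z ω hz hω hωη h0
      obtain ⟨w, κ, hκ, hK, hsum⟩ := key ω (hne ω hωη)
      have hy : mobiusForm a b c d (β - α * ω) < 0 := by
        rw [← hneg, show β - α * ω = α * (-ω) + β by ring, hI, norm_neg]; exact hω
      have hw := (mobiusForm_neg_of_add_eq_zero hdet hsum).2 hy
      refine (hst n).1 (α * z + β) ((hD z).mpr hz) w ((hpos w).mpr hw) ?_
      rw [evalEval_extend_pow hK, h0, mul_zero]
    · intro n z ω hz hω h0
      have hωη : ω ≠ -η := by rintro rfl; rw [norm_neg] at hω; linarith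
      obtain ⟨w, κ, hκ, hK, hsum⟩ := key ω (hne ω hωη)
      have hy : 0 < mobiusForm a b c d (β - α * ω) := by
        rw [← hpos, show β - α * ω = α * (-ω) + β by ring, hD, norm_neg]; exact hω
      have hw := (mobiusForm_neg_of_add_eq_zero hdet hsum).1 hy
      refine (hst n).2 (α * z + β) ((hI z).mpr hz) w ((hneg w).mpr hw) ?_
      rw [evalEval_extend_pow hK, h0, mul_zero]

/-- Preservers for a circle satisfy the stability condition for `plusKernel`, unless they have
rank at most one. -/
theorem plusKernel_stable_of_preserves_circle (hdet : a * d - b * c ≠ 0) (hα : α ≠ 0)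
    (hD : ∀ z, α * z + β ∈ D ↔ 1 < ‖z‖)
    (hpos : ∀ z, z ∈ D ↔ 0 < mobiusForm a b c d z)
    (hneg : ∀ z, z ∈ interior Dᶜ ↔ mobiusForm a b c d z < 0)
    (hT : Preserves (frontier D) T) {x y : ℂ[X]} (hxy : LinearIndependent ℂ ![T x, T y]) (n : ℕ) :
    IsStableOn D (extend T (plusKernel a b c d ^ n)) ∧
      IsStableOn (interior Dᶜ) (extend T (plusKernel a b c d ^ n)) := by
  have hI := mem_interior_compl_circle hα hD
  rw [← preserves_affineConj_iff hα (mem_frontier_circle hα hD)] at hT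
  obtain ⟨x', y', hxy'⟩ := linearIndependent_affineConj hα β hxy
  obtain ⟨P, δ, k, hP, hδ, hk, hform⟩ := exists_eq_mul_comp_of_preserves_unitCircle hT hxy'
  have hev : ∀ z w, (extend T (plusKernel a b c d ^ n)).evalEval (α * z + β) w = P.eval z *
      ((a * (α * (δ * z ^ k) + β) + b) * (c * w + d) +
        (a * w + b) * (c * (α * (δ * z ^ k) + β) + d)) ^ n := fun z w => by
    rw [evalEval_extend, eval_apply_affine hα, hform, eval_pow, eval_plusKernel]
    simp
  have hsurj : ∀ z, ∃ z', z = α * z' + β := fun z =>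
    ⟨α⁻¹ * (z - β), by rw [mul_inv_cancel_left₀ hα, sub_add_cancel]⟩
  refine ⟨fun z hz w hw h0 => ?_, fun z hz w hw h0 => ?_⟩ <;>
  obtain ⟨z, rfl⟩ := hsurj z <;> rw [hev] at h0
  · rw [hD] at hz
    rcases mul_eq_zero.mp h0 with h1 | h1
    · have h2 : ‖z‖ = 1 := hP.2 z h1
      linarith
    · have h2 := (mobiusForm_neg_of_add_eq_zero hdet (eq_zero_of_pow_eq_zero h1)).1 (by
        rw [← hpos, hD, norm_mul, hδ, one_mul, norm_pow]
        exact one_lt_pow₀ hz hk)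
      exact lt_asymm h2 ((hpos w).mp hw)
  · rw [hI] at hz
    rcases mul_eq_zero.mp h0 with h1 | h1
    · have h2 : ‖z‖ = 1 := hP.2 z h1
      linarith
    · have h2 := (mobiusForm_neg_of_add_eq_zero hdet (eq_zero_of_pow_eq_zero h1)).2 (by
        rw [← hneg, hI, norm_mul, hδ, one_mul, norm_pow]
        exact pow_lt_one₀ (norm_nonneg z) hz hk)
      exact lt_asymm h2 ((hneg w).mp hw)

end Circle

/-! ### Operators of rank at most two -/

/-- The range is spanned by T g for some g in π(S) with T g ≠ 0, which exists because π(S) detects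
nonzero operators; this puts P = T g in π(S). -/
theorem exists_smul_form_of_rank_le_one {S : Set ℂ} (hS : S.Infinite) {T : ℂ[X] →ₗ[ℂ] ℂ[X]}
    (hT : Preserves S T) (hrank : Module.rank ℂ (LinearMap.range T) ≤ 1) :
    ∃ (α : ℂ[X] →ₗ[ℂ] ℂ) (P : ℂ[X]), P ∈ zerosIn S ∧ ∀ f : ℂ[X], T f = α f • P := by
  by_cases h0 : ∀ f, T f = 0
  · exact ⟨0, C 1, C_mem_zerosIn S one_ne_zero, fun f => by simp [h0 f]⟩
  push Not at h0
  obtain ⟨f₁, hf₁⟩ := h0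
  obtain ⟨g, hg, hTg⟩ := exists_mem_zerosIn_map_ne_zero hS hf₁
  have hl : (T g).leadingCoeff ≠ 0 := leadingCoeff_ne_zero.mpr hTg
  refine ⟨(T g).leadingCoeff⁻¹ • (lcoeff ℂ (T g).natDegree).comp T, T g,
    (hT g hg).resolve_right hTg, fun f => ?_⟩
  obtain ⟨v, hv⟩ := (rank_le_one_iff).mp hrank
  obtain ⟨r, hr⟩ := hv ⟨T g, g, rfl⟩
  obtain ⟨s, hs⟩ := hv ⟨T f, f, rfl⟩
  have hr' : r • (v : ℂ[X]) = T g := congrArg Subtype.val hr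
  have hs' : s • (v : ℂ[X]) = T f := congrArg Subtype.val hs
  have hr0 : r ≠ 0 := by
    rintro rfl
    exact hTg (by rw [← hr', zero_smul])
  have hf : T f = (s / r) • T g := by
    rw [← hr', smul_smul, div_mul_cancel₀ _ hr0, hs']
  rw [LinearMap.smul_apply, LinearMap.comp_apply, lcoeff_apply, hf, coeff_smul, coeff_natDegree,
    smul_eq_mul, smul_eq_mul, mul_comm (s / r), inv_mul_cancel_left₀ hl]

theorem rank_range_le_two {V : Type*} [AddCommGroup V] [Module ℂ V] {S : V →ₗ[ℂ] ℂ[X]}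
    {P Q : ℂ[X]} (h : ∀ v, ∃ s t : ℂ, S v = s • P + t • Q) :
    Module.rank ℂ (LinearMap.range S) ≤ 2 := by
  classical
  have hsub : LinearMap.range S ≤
      Submodule.span ℂ (({P, Q} : Finset ℂ[X]) : Set ℂ[X]) := by
    rintro _ ⟨v, rfl⟩
    obtain ⟨s, t, hst⟩ := h v
    rw [Finset.coe_pair, Submodule.mem_span_pair]
    exact ⟨s, t, hst.symm⟩
  have hcard : ({P, Q} : Finset ℂ[X]).card ≤ 2 := Finset.card_le_two
  refine (Submodule.rank_mono hsub).trans ((rank_span_finset_le _).trans ?_)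
  exact_mod_cast hcard

theorem finrank_range_le_two {n m : ℕ} {S : polyLE n →ₗ[ℂ] polyLE m} {P Q : ℂ[X]}
    (h : ∀ f, ∃ s t : ℂ, (S f : ℂ[X]) = s • P + t • Q) :
    Module.finrank ℂ (LinearMap.range S) ≤ 2 := by
  have h1 := rank_range_le_two (S := (polyLE m).subtype ∘ₗ S) h
  rw [LinearMap.range_comp, ← (Submodule.equivMapOfInjective _ (polyLE m).subtype_injective
    (LinearMap.range S)).rank_eq] at h1
  exact Module.finrank_le_of_rank_le (by exact_mod_cast h1)

theorem rank_range_eq_two {T : ℂ[X] →ₗ[ℂ] ℂ[X]}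
    (h1 : ¬ Module.rank ℂ (LinearMap.range T) ≤ 1) {P Q : ℂ[X]}
    (h : ∀ f, ∃ s t : ℂ, T f = s • P + t • Q) : Module.rank ℂ (LinearMap.range T) = 2 := by
  refine le_antisymm (rank_range_le_two h) ?_
  rw [← one_add_one_eq_two]
  exact Cardinal.add_one_le_of_lt (not_le.mp h1)

/-! ### Conjugation by `φ_n` -/

section Phi
variable {a b c d : ℂ} (h : a * d - b * c ≠ 0)

theorem eval_phi (n : ℕ) (f : polyLE n) {z : ℂ} (hz : c * z + d ≠ 0) :
    (phi h n f : ℂ[X]).eval z =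
      (c * z + d) ^ n * (f : ℂ[X]).eval ((a * z + b) / (c * z + d)) :=
  eval_phiLin a b c d n f z hz

theorem natDegree_le_of_polyLE {n : ℕ} (f : polyLE n) : (f : ℂ[X]).natDegree ≤ n :=
  natDegree_le_iff_degree_le.mpr (mem_degreeLE.mp f.2)

theorem coeff_phi (n : ℕ) (f : polyLE n) : (phi h n f : ℂ[X]).coeff n =
    ∑ k ∈ Finset.range (n + 1), (f : ℂ[X]).coeff k * (a ^ k * c ^ (n - k)) := by
  change (phiLin a b c d n f : ℂ[X]).coeff n = _
  simp only [phiLin, LinearMap.coe_mk, AddHom.coe_mk, finsetSum_coeff]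
  refine Finset.sum_congr rfl fun k hk => ?_
  have hk' : k ≤ n := Nat.lt_succ_iff.mp (Finset.mem_range.mp hk)
  rw [coeff_C_mul]
  congr 1
  have hp : ∀ u v : ℂ, ∀ m, ((C u * X + C v : ℂ[X]) ^ m).coeff m = u ^ m := fun u v m => by
    have := coeff_pow_of_natDegree_le (p := (C u * X + C v : ℂ[X])) (n := 1) (m := m)
      (natDegree_linear_le (a := u) (b := v))
    simpa using this
  have h1 := natDegree_pow_le_of_le k (natDegree_linear_le (a := a) (b := b))
  have h2 := natDegree_pow_le_of_le (n - k) (natDegree_linear_le (a := c) (b := d))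
  have := coeff_mul_add_eq_of_natDegree_le (df := k) (dg := n - k) (h1.trans (by omega))
    (h2.trans (by omega))
  rw [Nat.add_sub_cancel' hk'] at this
  rw [this, hp, hp]

/-- If `f = φ_n(g)` has degree `n` and its zeros have real image under `Φ`, the zeros of `g` are
real. -/
theorem phi_symm_mem_zerosIn {F : Set ℂ} (hF : ∀ z, z ∈ F ↔ mobiusForm a b c d z = 0) {n : ℕ}
    {g : polyLE n} (hf : (phi h n g : ℂ[X]) ∈ zerosIn F) (hn : (phi h n g : ℂ[X]).natDegree = n) :
    (g : ℂ[X]) ∈ zerosIn realLine := by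
  refine ⟨fun h0 => hf.1 ?_, fun ζ hζ => ?_⟩
  · have : g = 0 := Subtype.ext h0
    rw [this, map_zero]; rfl
  -- A zero of g at a/c = Φ(∞) would lower the degree of φ_n(g) below n.
  by_cases h2 : -c * ζ + a = 0
  · exfalso
    have hc : c ≠ 0 := by
      rintro rfl
      have : a = 0 := by linear_combination h2
      simp [this] at h
    have ha : a = c * ζ := by linear_combination h2
    have h3 : (phi h n g : ℂ[X]).coeff n = c ^ n * (g : ℂ[X]).eval ζ := by
      rw [coeff_phi, eval_eq_sum_range' (Nat.lt_succ_of_le (natDegree_le_of_polyLE g)),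
        Finset.mul_sum]
      refine Finset.sum_congr rfl fun k hk => ?_
      have hk' : k ≤ n := Nat.lt_succ_iff.mp (Finset.mem_range.mp hk)
      rw [ha, mul_pow]
      have : c ^ n = c ^ k * c ^ (n - k) := by rw [← pow_add, Nat.add_sub_cancel' hk']
      rw [this]; ring
    have h4 : (phi h n g : ℂ[X]).leadingCoeff = 0 := by
      rw [leadingCoeff, hn, h3, hζ.eq_zero, mul_zero]
    exact hf.1 (leadingCoeff_eq_zero.mp h4)
  · have key : c * ((d * ζ - b) / (-c * ζ + a)) + d = (a * d - b * c) / (-c * ζ + a) := by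
      rw [mul_div_assoc', div_add' _ _ _ h2]
      congr 1
      ring
    have hz : c * ((d * ζ - b) / (-c * ζ + a)) + d ≠ 0 := by
      rw [key]
      exact div_ne_zero h h2
    have h3 : (a * ((d * ζ - b) / (-c * ζ + a)) + b) /
        (c * ((d * ζ - b) / (-c * ζ + a)) + d) = ζ := by
      rw [div_eq_iff hz, key, mul_div_assoc', mul_div_assoc', div_add' _ _ _ h2]
      congr 1
      ring
    have hroot := hf.2 ((d * ζ - b) / (-c * ζ + a)) (by
      rw [IsRoot, eval_phi h n g hz, h3, hζ.eq_zero, mul_zero])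
    rw [hF, mobiusForm_eq, h3] at hroot
    exact (mul_eq_zero.mp hroot).resolve_left (Complex.normSq_pos.mpr hz).ne'

theorem phi_mem_zerosIn {F : Set ℂ} (hF : ∀ z, z ∈ F ↔ mobiusForm a b c d z = 0) {n : ℕ}
    {g : polyLE n} (hg : (g : ℂ[X]) ∈ zerosIn realLine) : (phi h n g : ℂ[X]) ∈ zerosIn F := by
  refine ⟨fun h0 => hg.1 ?_, fun z hz => ?_⟩
  · have : g = 0 := (phi h n).map_eq_zero_iff.mp (Subtype.ext h0)
    rw [this]; rfl
  rw [hF, mobiusForm_eq]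
  by_cases hz0 : c * z + d = 0
  · simp [hz0]
  · rw [IsRoot, eval_phi h n g hz0] at hz
    have := hg.2 _ ((mul_eq_zero.mp hz).resolve_left (pow_ne_zero _ hz0))
    rw [show ((a * z + b) / (c * z + d)).im = 0 from this, mul_zero]

theorem exists_smul_real_of_mem_zerosIn {f : ℂ[X]} (hf : f ∈ zerosIn realLine) :
    conjPoly (f.leadingCoeff⁻¹ • f) = f.leadingCoeff⁻¹ • f := by
  obtain ⟨r, hr⟩ := conjPoly_eq_smul_of_mem_zerosIn hf
  have hl : f.leadingCoeff ≠ 0 := leadingCoeff_ne_zero.mpr hf.1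
  have h1 : starRingEnd ℂ f.leadingCoeff = r * f.leadingCoeff := by
    have := congrArg (fun p => coeff p f.natDegree) hr
    simpa only [coeff_conjPoly, coeff_smul, smul_eq_mul, coeff_natDegree] using this
  have hr0 : r ≠ 0 := by
    rintro rfl
    rw [zero_mul, map_eq_zero] at h1
    exact hl h1
  rw [conjPoly_smul, hr, smul_smul, map_inv₀, h1]
  congr 1
  field_simp

/-- Taking n equal to deg f makes all zeros of φ_n⁻¹(f) real. After normalization it is a real
polynomial, which S_n sends to a scalar times a real combination of P and Q; this is real-rooted or
zero, and φ returns it to the curve. -/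
theorem preserves_of_isRankTwoPreserver {F : Set ℂ}
    (hF : ∀ z, z ∈ F ↔ mobiusForm a b c d z = 0) {T : ℂ[X] →ₗ[ℂ] ℂ[X]}
    (hT : ∀ n, IsRankTwoPreserver (conjugate h T n)) : Preserves F T := by
  intro f hf
  set n := f.natDegree with hn
  obtain ⟨-, η, α, β, P, Q, hα, hβ, hP, hQ, hPQ, hform⟩ := hT n
  set ff : polyLE n := ⟨f, mem_degreeLE.mpr (natDegree_le_iff_degree_le.mp hn.symm.le)⟩
  set g := (phi h n).symm ff with hgdef
  have hphig : phi h n g = ff := (phi h n).apply_symm_apply ff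
  have hg : (g : ℂ[X]) ∈ zerosIn realLine :=
    phi_symm_mem_zerosIn h hF (by rw [hphig]; exact hf) (by rw [hphig])
  have hTf : (phi h (maxDeg T n) (conjugate h T n g) : ℂ[X]) = T f := by
    change (phi h (maxDeg T n) ((phi h (maxDeg T n)).symm (restrictT T n (phi h n g))) : ℂ[X]) = _
    rw [LinearEquiv.apply_symm_apply, hphig]; rfl
  have hl : (g : ℂ[X]).leadingCoeff ≠ 0 := leadingCoeff_ne_zero.mpr hg.1
  have hg0 := exists_smul_real_of_mem_zerosIn hg
  set g₀ : polyLE n := (g : ℂ[X]).leadingCoeff⁻¹ • g with hg₀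
  have hreal : ∀ k, ((g₀ : ℂ[X]).coeff k).im = 0 := fun k => by
    rw [← Complex.conj_eq_iff_im, ← coeff_conjPoly]
    exact congrArg (fun p => coeff p k) hg0
  have hgg : g = (g : ℂ[X]).leadingCoeff • g₀ := by rw [hg₀, smul_inv_smul₀ hl]
  have hαr : α g₀ = ((α g₀).re : ℂ) := Complex.ext rfl (hα g₀ hreal)
  have hβr : β g₀ = ((β g₀).re : ℂ) := Complex.ext rfl (hβ g₀ hreal)
  have hS : (conjugate h T n g : ℂ[X]) = ((g : ℂ[X]).leadingCoeff * η) •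
      (C (α g₀).re * P + C (β g₀).re * Q).map (algebraMap ℝ ℂ) := by
    rw [hgg, map_smul, ← hgg]
    rw [Submodule.coe_smul, hform, hαr, hβr, Complex.ofReal_re, Complex.ofReal_re]
    rw [Polynomial.map_add, Polynomial.map_mul, Polynomial.map_mul, map_C, map_C]
    simp only [smul_eq_C_mul, C_mul, Complex.coe_algebraMap]
    ring
  rw [← hTf]
  by_cases h0 : (conjugate h T n g : ℂ[X]) = 0
  · right
    have : conjugate h T n g = 0 := Subtype.ext h0
    rw [Set.mem_singleton_iff, this, map_zero]; rfl
  · left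
    refine phi_mem_zerosIn h hF ⟨h0, fun z hz => ?_⟩
    by_contra hzim
    refine h0 ?_
    rw [IsRoot, hS, eval_smul, smul_eq_mul] at hz
    rw [hS]
    rcases mul_eq_zero.mp hz with h1 | h1
    · rw [h1, zero_smul]
    · rw [eval_map_algebraMap] at h1
      rw [hPQ.combination_eq_zero hP hQ hzim (by simpa using h1), Polynomial.map_zero, smul_zero]

end Phi

/-- For c = 0, φ_n is d^n times an affine substitution, so S_n is the operator in the affine
coordinate up to a scalar. -/
theorem conjugate_eq_smul_affineConj {a b d : ℂ} (ha : a ≠ 0) (hd : d ≠ 0)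
    (h : a * d - b * 0 ≠ 0) (T : ℂ[X] →ₗ[ℂ] ℂ[X]) (n : ℕ) (f : polyLE n) :
    (conjugate h T n f : ℂ[X]) =
      (d ^ n / d ^ maxDeg T n) • affineConj (d / a) (-b / a) T (f : ℂ[X]) := by
  have hcomp : ∀ m (g : polyLE m), (phi h m g : ℂ[X]) =
      d ^ m • (g : ℂ[X]).comp (C (d / a)⁻¹ * (X - C (-b / a))) := fun m g => by
    refine Polynomial.funext fun z => ?_
    rw [eval_phi h m g (by simpa using hd)]
    simp only [zero_mul, zero_add, eval_smul, eval_comp, eval_mul, eval_C, eval_sub, eval_X,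
      smul_eq_mul]
    congr 2
    field_simp
    ring
  have hα : d / a ≠ 0 := div_ne_zero hd ha
  have h1 : (phi h (maxDeg T n) (conjugate h T n f) : ℂ[X]) = T (phi h n f) := by
    change (phi h (maxDeg T n) ((phi h (maxDeg T n)).symm (restrictT T n (phi h n f))) : ℂ[X]) = _
    rw [LinearEquiv.apply_symm_apply]; rfl
  rw [hcomp, hcomp, map_smul] at h1
  have h2 := congrArg (fun p => p.comp (C (d / a) * X + C (-b / a))) h1
  simp only [smul_comp, comp_affine_inv_comp hα] at h2
  rw [affineConj_apply, div_eq_inv_mul, mul_smul, ← h2, smul_smul,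
    inv_mul_cancel₀ (pow_ne_zero _ hd), one_smul]

theorem isRankTwoPreserver_of_isRealCombination {a b d κ : ℂ} (ha : a ≠ 0) (hd : d ≠ 0)
    (h : a * d - b * 0 ≠ 0) {T : ℂ[X] →ₗ[ℂ] ℂ[X]} (hκ : κ ≠ 0)
    (hT : IsRealCombination (κ • affineConj (d / a) (-b / a) T))
    (hrank : ¬ Module.rank ℂ (LinearMap.range T) ≤ 1) :
    Module.rank ℂ (LinearMap.range T) = 2 ∧ ∀ n, IsRankTwoPreserver (conjugate h T n) := by
  obtain ⟨α, β, P, Q, hP, hQ, hPQ, hreal, hform⟩ := hT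
  have hα : d / a ≠ 0 := div_ne_zero hd ha
  have hform' : ∀ f, affineConj (d / a) (-b / a) T f =
      (κ⁻¹ * α f) • P.map (algebraMap ℝ ℂ) + (κ⁻¹ * β f) • Q.map (algebraMap ℝ ℂ) := fun f => by
    rw [mul_smul, mul_smul, ← smul_add, ← hform, LinearMap.smul_apply, inv_smul_smul₀ hκ]
  refine ⟨rank_range_eq_two hrank
    (P := (P.map (algebraMap ℝ ℂ)).comp (C (d / a)⁻¹ * (X - C (-b / a))))
    (Q := (Q.map (algebraMap ℝ ℂ)).comp (C (d / a)⁻¹ * (X - C (-b / a))))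
    fun f => ⟨κ⁻¹ * α (f.comp (C (d / a) * X + C (-b / a))),
      κ⁻¹ * β (f.comp (C (d / a) * X + C (-b / a))), ?_⟩, fun n => ?_⟩
  · rw [← smul_comp, ← smul_comp, ← add_comp, ← hform', affineConj_comp hα, comp_affine_comp hα]
  · have hS : ∀ f : polyLE n, (conjugate h T n f : ℂ[X]) =
        (d ^ n / d ^ maxDeg T n * κ⁻¹ * α f) • P.map (algebraMap ℝ ℂ) +
          (d ^ n / d ^ maxDeg T n * κ⁻¹ * β f) • Q.map (algebraMap ℝ ℂ) := fun f => by
      rw [conjugate_eq_smul_affineConj ha hd, hform', smul_add, smul_smul, smul_smul, mul_assoc,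
        mul_assoc]
    have hre : ∀ f : polyLE n, (∀ k, ((f : ℂ[X]).coeff k).im = 0) →
        conjPoly (f : ℂ[X]) = f := fun f hf => by
      ext k
      rw [coeff_conjPoly, Complex.conj_eq_iff_im]
      exact hf k
    exact ⟨finrank_range_le_two fun f => ⟨_, _, hS f⟩, d ^ n / d ^ maxDeg T n * κ⁻¹,
      α.comp (polyLE n).subtype, β.comp (polyLE n).subtype, P, Q,
      fun f hf => (hreal f (hre f hf)).1, fun f hf => (hreal f (hre f hf)).2, hP, hQ, hPQ, hS⟩

end PolyaSchur

/-! ### The equivalence, for a line and for a circle -/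

theorem corollary2p17 (T : ℂ[X] →ₗ[ℂ] ℂ[X]) (a b c d : ℂ) (hdet : a * d - b * c ≠ 0)
    (D : Set ℂ) (hD : D = PolyaSchur.mobiusDomain a b c d)
    (hunbounded : ¬ Bornology.IsBounded D)
    (hhalf : PolyaSchur.IsOpenHalfPlane D → c = 0) :
    (∀ f ∈ PolyaSchur.zerosIn (frontier D), T f ∈ PolyaSchur.zerosIn (frontier D) ∪ {0}) ↔
      ((Module.rank ℂ (LinearMap.range T) ≤ 1 ∧
          ∃ (α : ℂ[X] →ₗ[ℂ] ℂ) (P : ℂ[X]), P ∈ PolyaSchur.zerosIn (frontier D) ∧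
            ∀ f : ℂ[X], T f = α f • P) ∨
        (Module.rank ℂ (LinearMap.range T) = 2 ∧
          ∀ n : ℕ, PolyaSchur.IsRankTwoPreserver (PolyaSchur.conjugate hdet T n)) ∨
        (∀ n : ℕ,
          PolyaSchur.extend T (PolyaSchur.plusKernel a b c d ^ n) = 0 ∨
          (PolyaSchur.IsStableOn D
              (PolyaSchur.extend T (PolyaSchur.plusKernel a b c d ^ n)) ∧
            PolyaSchur.IsStableOn (interior Dᶜ)
              (PolyaSchur.extend T (PolyaSchur.plusKernel a b c d ^ n)))) ∨
        (∀ n : ℕ,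
          PolyaSchur.extend T (PolyaSchur.minusKernel a b c d ^ n) = 0 ∨
          (PolyaSchur.IsStableOn D
              (PolyaSchur.extend T (PolyaSchur.minusKernel a b c d ^ n)) ∧
            PolyaSchur.IsStableOn (interior Dᶜ)
              (PolyaSchur.extend T (PolyaSchur.minusKernel a b c d ^ n))))) := by
  open PolyaSchur in
  have hpos : ∀ z, z ∈ D ↔ 0 < mobiusForm a b c d z := fun z => by
    rw [hD, mobiusDomain_eq]; rfl
  have ha_case : ∀ (α : ℂ[X] →ₗ[ℂ] ℂ) (P : ℂ[X]), P ∈ zerosIn (frontier D) →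
      (∀ f, T f = α f • P) → Preserves (frontier D) T := fun α P hP hf f _ => by
    rw [hf]; exact smul_mem_zerosIn_union_zero hP _
  change Preserves (frontier D) T ↔ _
  by_cases hc : c = 0
  · subst hc
    have ha : a ≠ 0 := by rintro rfl; simp at hdet
    have hd : d ≠ 0 := by rintro rfl; simp at hdet
    have hα : d / a ≠ 0 := div_ne_zero hd ha
    have hform : ∀ z, mobiusForm a b 0 d (d / a * z + -b / a) = Complex.normSq d * z.im :=
      fun z => by
        rw [mobiusForm_eq]
        congr 2
        · simp
        · field_simp; ring
    have hN : 0 < Complex.normSq d := Complex.normSq_pos.mpr hd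
    have hDA : ∀ z, d / a * z + -b / a ∈ D ↔ 0 < z.im := fun z => by
      rw [hpos, hform, mul_pos_iff_of_pos_left hN]
    have hF := mem_frontier_line hα hDA
    have hfr : ∀ z, z ∈ frontier D ↔ mobiusForm a b 0 d z = 0 :=
      mem_iff_of_preimage_affine hα (β := -b / a) fun z => by
        rw [hF, hform, mul_eq_zero, or_iff_right hN.ne']; rfl
    have hinf : (frontier D).Infinite := by
      refine (infinite_realLine.image (f := fun z => d / a * z + -b / a) ?_).mono ?_
      · intro x _ y _ hxy
        exact mul_left_cancel₀ hα (add_right_cancel hxy)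
      · rintro _ ⟨z, hz, rfl⟩
        exact (hF z).mpr hz
    have hplus := symbolStable_iff_line (T := T) (e := 1) (Or.inl rfl) hα hDA
      (pow_ne_zero 2 hd) (by simpa using eval_plusKernel_line (b := b) ha hd)
    have hminus := symbolStable_iff_line (T := T) (e := -1) (Or.inr rfl) hα hDA
      (pow_ne_zero 2 hd) (by simpa using eval_minusKernel_line (b := b) ha hd)
    constructor
    · intro hT
      by_cases hrank : Module.rank ℂ (LinearMap.range T) ≤ 1
      · exact Or.inl ⟨hrank, exists_smul_form_of_rank_le_one hinf hT hrank⟩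
      · right
        obtain ⟨x, y, hxy⟩ := exists_linearIndependent_of_not_rank_le_one hrank
        obtain ⟨x', y', hxy'⟩ := linearIndependent_affineConj hα (-b / a) hxy
        rcases exists_smul_isRealCombination_or_symbolStable
          ((preserves_affineConj_iff hα hF T).mpr hT) hxy' with ⟨κ, hκ, h1⟩ | h1 | h1
        · exact Or.inl (isRankTwoPreserver_of_isRealCombination ha hd hdet hκ h1 hrank)
        · exact Or.inr (Or.inl fun n => (hplus n).mpr (h1 n))
        · exact Or.inr (Or.inr fun n => (hminus n).mpr (h1 n))
    · rintro (⟨-, α, P, hP, hf⟩ | ⟨-, h1⟩ | h1 | h1)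
      · exact ha_case α P hP hf
      · exact preserves_of_isRankTwoPreserver hdet hfr h1
      · exact (preserves_affineConj_iff hα hF T).mp (preserves_realLine_of_symbolStable one_ne_zero
          fun n => (hplus n).mp (h1 n))
      · exact (preserves_affineConj_iff hα hF T).mp (preserves_realLine_of_symbolStable
          (neg_ne_zero.mpr one_ne_zero) fun n => (hminus n).mp (h1 n))
  · obtain ⟨hA, ρ, α, β, hρ, hα, hform⟩ := exists_affine_mobiusForm_eq hdet (hD ▸ hunbounded)
      (hD ▸ fun h => hc (hhalf h))
    have hDA : ∀ z, α * z + β ∈ D ↔ 1 < ‖z‖ := fun z => by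
      rw [hpos, hform, mul_pos_iff_of_pos_left hρ, sub_pos, one_lt_sq_iff₀ (norm_nonneg z)]
    have hF := mem_frontier_circle hα hDA
    have hI := mem_interior_compl_circle hα hDA
    have hfr : ∀ z, z ∈ frontier D ↔ mobiusForm a b c d z = 0 :=
      mem_iff_of_preimage_affine hα (β := β) fun z => by
        rw [hF, hform, mul_eq_zero, or_iff_right hρ.ne', sub_eq_zero,
          pow_eq_one_iff_of_nonneg (norm_nonneg z) two_ne_zero]; rfl
    have hneg : ∀ z, z ∈ interior Dᶜ ↔ mobiusForm a b c d z < 0 :=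
      mem_iff_of_preimage_affine hα (β := β) fun z => by
        rw [hI, hform, mul_neg_iff, or_iff_left (fun h => absurd h.1 hρ.not_gt),
          and_iff_right hρ, sub_neg, sq_lt_one_iff₀ (norm_nonneg z)]
    have hinf : (frontier D).Infinite := by
      refine (infinite_unitCircle.image (f := fun z => α * z + β) ?_).mono ?_
      · intro x _ y _ hxy
        exact mul_left_cancel₀ hα (add_right_cancel hxy)
      · rintro _ ⟨z, hz, rfl⟩
        exact (hF z).mpr hz
    constructor
    · intro hT
      by_cases hrank : Module.rank ℂ (LinearMap.range T) ≤ 1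
      · exact Or.inl ⟨hrank, exists_smul_form_of_rank_le_one hinf hT hrank⟩
      · obtain ⟨x, y, hxy⟩ := exists_linearIndependent_of_not_rank_le_one hrank
        -- On a circle, every preserver of rank at least two falls under (c).
        exact Or.inr (Or.inr (Or.inl fun n => Or.inr
          (plusKernel_stable_of_preserves_circle hdet hα hDA hpos hneg hT hxy n)))
    · rintro (⟨-, α, P, hP, hf⟩ | ⟨-, h1⟩ | h1 | h1)
      · exact ha_case α P hP hf
      · exact preserves_of_isRankTwoPreserver hdet hfr h1
      · exact preserves_of_plusKernel_circle hdet hA hα hDA hpos hneg h1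
      · exact preserves_of_minusKernel_circle hdet hα hDA h1
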